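/- Let $n\ge 3$, let $M$ be a smooth $n$-dimensional manifold (without boundary), let $T>0$, and let $g(t)$, $t\in[0,T]$, be a complete Ricci flow on $M$, i.e. a family of complete Riemannian metrics, smooth on $M\times[0,T]$, with $\partial_t g(t)=-2\,\mathrm{Rc}_{g(t)}$; the curvature is not assumed to be bounded. Let $\phi:M\times[0,T]\to\mathbb R$ be a smooth nonnegative function with compact support such that $\square\phi\le 0$ on $M\times[0,T]$, where $\square=\partial_t-\Delta_{g(t)}$ is the heat operator. Write $|\mathrm{Rm}|_{g(t)}$ for the norm of the full curvature tensor, $|\mathrm{Rm}|^2=R_{ijkl}R^{ijkl}$, and $dV_{g(t)}$ for the Riemannian volume measure. Then for every $\beta>0$ and every $t\in[0,T]$, all the integrands below are integrable, the derivative on the left exists (one-sided at $t=0$ and $t=T$), and \begin{align*} \frac{d}{dt}\int_M \phi^2\,(|\mathrm{Rm}|_{g(t)}^2+\beta)^{\frac n4}\,dV_{g(t)} \le{}& -\frac13\int_M \bigl|\nabla^{g(t)}\bigl(\phi\,(|\mathrm{Rm}|_{g(t)}^2+\beta)^{\frac n8}\bigr)\bigr|_{g(t)}^2\,dV_{g(t)}\\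 &+10n\int_M |\nabla^{g(t)}\phi|_{g(t)}^2\,(|\mathrm{Rm}|_{g(t)}^2+\beta)^{\frac n4}\,dV_{g(t)}\\ &+5n\int_M \phi^2\,(|\mathrm{Rm}|_{g(t)}^2+\beta)^{\frac n4+\frac12}\,dV_{g(t)}. \end{align*} -/

import Mathlib

open Set Filter MeasureTheory
open scoped Manifold ContDiff ENNReal

noncomputable section

/-! ### Riemannian geometry of a metric given by its coefficients on a domain of `ℝⁿ`

Here `G : ℝⁿ → Matrix` is the matrix field `(g_{ij})` of a metric in a coordinate system. -/

namespace Coord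

variable {n : ℕ}

/-- The partial derivative `∂_i f` at `y`. -/
def pd (i : Fin n) (f : EuclideanSpace ℝ (Fin n) → ℝ) (y : EuclideanSpace ℝ (Fin n)) : ℝ :=
  fderiv ℝ f y (EuclideanSpace.single i 1)

/-- The Christoffel symbol
`Γ^k_{ij} = (1/2) g^{kl} (∂_i g_{jl} + ∂_j g_{il} - ∂_l g_{ij})` of the Levi-Civita connection. -/
def christoffel (G : EuclideanSpace ℝ (Fin n) → Matrix (Fin n) (Fin n) ℝ) (k i j : Fin n)
    (y : EuclideanSpace ℝ (Fin n)) : ℝ :=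
  (1 / 2 : ℝ) * ∑ l, (G y)⁻¹ k l *
    (pd i (fun z => G z j l) y + pd j (fun z => G z i l) y - pd l (fun z => G z i j) y)

/-- The components `R_{ijk}^l` of the Riemann curvature tensor,
`R(∂_i, ∂_j) ∂_k = ∇_i ∇_j ∂_k - ∇_j ∇_i ∂_k = R_{ijk}^l ∂_l`. -/
def riem (G : EuclideanSpace ℝ (Fin n) → Matrix (Fin n) (Fin n) ℝ) (i j k l : Fin n)
    (y : EuclideanSpace ℝ (Fin n)) : ℝ :=
  pd i (christoffel G l j k) y - pd j (christoffel G l i k) y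
    + ∑ m, (christoffel G l i m y * christoffel G m j k y
      - christoffel G l j m y * christoffel G m i k y)

/-- The components `R_{jk} = R_{ijk}^i` of the Ricci tensor. -/
def ricci (G : EuclideanSpace ℝ (Fin n) → Matrix (Fin n) (Fin n) ℝ) (j k : Fin n)
    (y : EuclideanSpace ℝ (Fin n)) : ℝ :=
  ∑ i, riem G i j k i y

/-- The squared norm `|Rm|² = g^{ia} g^{jb} g^{kc} g_{ld} R_{ijk}^l R_{abc}^d` of the full
curvature tensor. -/
def rmSq (G : EuclideanSpace ℝ (Fin n) → Matrix (Fin n) (Fin n) ℝ)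
    (y : EuclideanSpace ℝ (Fin n)) : ℝ :=
  ∑ i, ∑ j, ∑ k, ∑ l, ∑ a, ∑ b, ∑ c, ∑ d,
    (G y)⁻¹ i a * (G y)⁻¹ j b * (G y)⁻¹ k c * G y l d * riem G i j k l y * riem G a b c d y

/-- The squared norm of the gradient, `|∇f|² = g^{ij} ∂_i f ∂_j f`. -/
def gradSq (G : EuclideanSpace ℝ (Fin n) → Matrix (Fin n) (Fin n) ℝ)
    (f : EuclideanSpace ℝ (Fin n) → ℝ) (y : EuclideanSpace ℝ (Fin n)) : ℝ :=
  ∑ i, ∑ j, (G y)⁻¹ i j * pd i f y * pd j f y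

/-- The Laplace-Beltrami operator `Δf = g^{ij} (∂_i ∂_j f - Γ^k_{ij} ∂_k f)`, the trace of the
Hessian. -/
def laplacian (G : EuclideanSpace ℝ (Fin n) → Matrix (Fin n) (Fin n) ℝ)
    (f : EuclideanSpace ℝ (Fin n) → ℝ) (y : EuclideanSpace ℝ (Fin n)) : ℝ :=
  ∑ i, ∑ j, (G y)⁻¹ i j * (pd i (pd j f) y - ∑ k, christoffel G k i j y * pd k f y)

end Coord

/-! ### Riemannian manifolds -/

section Manifold

variable {n : ℕ} {M : Type*} [TopologicalSpace M] [ChartedSpace (EuclideanSpace ℝ (Fin n)) M]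
  [IsManifold (𝓡 n) ∞ M]

variable (n M) in
/-- Smooth Riemannian metrics on the `n`-dimensional manifold `M`. -/
abbrev RMetric :=
  Bundle.ContMDiffRiemannianMetric (𝓡 n) ∞ (EuclideanSpace ℝ (Fin n))
    (fun x : M => TangentSpace (𝓡 n) x)

namespace RMetric

/-- The coefficients `g_{ij} = g(∂_i, ∂_j)` of `g` in the chart at `p`, as a function of the
coordinates `y`; here `∂_i` is the image of the `i`-th basis vector under the differential of the
inverse chart. Meaningful for `y` in the target of the chart. -/
def coeff (g : RMetric n M) (p : M) (y : EuclideanSpace ℝ (Fin n)) : Matrix (Fin n) (Fin n) ℝ :=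
  Matrix.of fun i j =>
    g.inner ((extChartAt (𝓡 n) p).symm y)
      (mfderiv 𝓘(ℝ, EuclideanSpace ℝ (Fin n)) (𝓡 n) (extChartAt (𝓡 n) p).symm y
        (EuclideanSpace.single i (1 : ℝ) : EuclideanSpace ℝ (Fin n)))
      (mfderiv 𝓘(ℝ, EuclideanSpace ℝ (Fin n)) (𝓡 n) (extChartAt (𝓡 n) p).symm y
        (EuclideanSpace.single j (1 : ℝ) : EuclideanSpace ℝ (Fin n)))

/-- `|Rm|²_g` at the point `x`, computed in the chart at `x`. -/
def rmSq (g : RMetric n M) (x : M) : ℝ :=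
  Coord.rmSq (g.coeff x) (extChartAt (𝓡 n) x x)

/-- `|∇f|²_g` at the point `x`, computed in the chart at `x`. -/
def gradSq (g : RMetric n M) (f : M → ℝ) (x : M) : ℝ :=
  Coord.gradSq (g.coeff x) (fun y => f ((extChartAt (𝓡 n) x).symm y)) (extChartAt (𝓡 n) x x)

/-- `Δ_g f` at the point `x`, computed in the chart at `x`. -/
def laplacian (g : RMetric n M) (f : M → ℝ) (x : M) : ℝ :=
  Coord.laplacian (g.coeff x) (fun y => f ((extChartAt (𝓡 n) x).symm y)) (extChartAt (𝓡 n) x x)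

/-- The measure `√(det g_{ij}) dy` in the chart at `p`, carried to the domain of this chart (and
zero outside this domain). -/
def chartVolume [MeasurableSpace M] (g : RMetric n M) (p : M) : Measure M :=
  ((volume.restrict (extChartAt (𝓡 n) p).target).withDensity
    (fun y => ENNReal.ofReal (Real.sqrt (g.coeff p y).det))).map (extChartAt (𝓡 n) p).symm

/-- The Riemannian volume measure `dV_g`: the least measure on `M` that dominates
`√(det g_{ij}) dy` in every chart. As the chart measures agree on the overlaps of the charts and
countably many charts cover `M`, this is the unique Borel measure whose restriction to the domain
of each chart is `√(det g_{ij}) dy`. -/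
def vol [MeasurableSpace M] (g : RMetric n M) : Measure M :=
  ⨆ p : M, g.chartVolume p

/-- The Riemannian distance of `g` (infinite between different components): the infimum of the
`g`-lengths of `C^1` paths. -/
def edist (g : RMetric n M) (x y : M) : ℝ≥0∞ :=
  letI : ∀ z : M, ENorm (TangentSpace (𝓡 n) z) :=
    fun z => ⟨fun v => ENNReal.ofReal (Real.sqrt (g.inner z v v))⟩
  Manifold.riemannianEDist (𝓡 n) x y

/-- Completeness of `(M, g)`: every Cauchy sequence of the Riemannian distance converges. -/
def IsComplete (g : RMetric n M) : Prop :=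
  ∀ u : ℕ → M,
    (∀ ε : ℝ≥0∞, 0 < ε → ∃ N, ∀ k ≥ N, ∀ l ≥ N, g.edist (u k) (u l) < ε) →
    ∃ x : M, ∀ ε : ℝ≥0∞, 0 < ε → ∃ N, ∀ k ≥ N, g.edist (u k) x < ε

end RMetric

/-- `g(t)`, `t ∈ [0,T]`, is a complete smooth Ricci flow on `M`. Derivatives in time are one-sided
at the end points of `[0,T]`. -/
structure IsCompleteRicciFlow (g : ℝ → RMetric n M) (T : ℝ) : Prop where
  /-- In each chart the coefficients `g_{ij}` are smooth in space and time, up to `t = 0, T`. -/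
  smooth : ∀ (p : M) (i j : Fin n),
    ContDiffOn ℝ ∞ (fun z : ℝ × EuclideanSpace ℝ (Fin n) => (g z.1).coeff p z.2 i j)
      (Icc 0 T ×ˢ (extChartAt (𝓡 n) p).target)
  /-- The Ricci flow equation `∂_t g_{ij} = -2 R_{ij}` in each chart. -/
  flow : ∀ (p : M), ∀ y ∈ (extChartAt (𝓡 n) p).target, ∀ t ∈ Icc 0 T, ∀ i j : Fin n,
    HasDerivWithinAt (fun s => (g s).coeff p y i j) (-2 * Coord.ricci ((g t).coeff p) i j y)
      (Icc 0 T) t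
  /-- Each `(M, g(t))` is complete. -/
  complete : ∀ t ∈ Icc 0 T, (g t).IsComplete

/-- The heat operator `□φ = ∂_t φ - Δ_{g(t)} φ` along the family `g` on `M × [0,T]`. -/
def heatOp (g : ℝ → RMetric n M) (T : ℝ) (φ : M → ℝ → ℝ) (x : M) (t : ℝ) : ℝ :=
  derivWithin (fun s => φ x s) (Icc 0 T) t - (g t).laplacian (fun x' => φ x' t) x

end Manifold

end

/-! Write u = |Rm|², w = u + β. Three facts drive the estimate. Under Ricci flow ∂_t u ≤ Δu − N + 16
u^{3/2}, where N = 2|∇Rm|² (`Coord.IsCoordFlow.evolution`). Kato's inequality gives |∇u|² ≤ 2uN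
(`gradSq_rmSq_le`). The volume form satisfies ∂_t dV = −Scal dV with |Scal| ≤ n|Rm| (`dt_density`,
`scal_sq_le`).

Since φ vanishes off one compact set for all times, the integral may be differentiated under the
integral sign (`hasDerivWithinAt_integral`). The divergences of 2φ w^{n/4} ∇φ and (n/4) φ² w^{n/4−1}
∇u integrate to zero (`integral_mul_laplacian`). Subtracting them cancels Δu and combines Δφ with
∂_t φ into a nonpositive term. What is left is a pointwise inequality: a quadratic form in ∇φ and ∇u
plus terms of order φ² w^{n/4+1/2}. Kato's inequality turns −N into a negative multiple of |∇u|²,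
and completing a square gives the result; the hypothesis n ≥ 3 makes the remaining coefficient
n(n−3)/24 of |∇u|² nonnegative (`energy_density_le`). The constant 5n is 16·(n/4) from the reaction
term plus n from the volume form.

For the evolution of u, pair ∂_t R_{ijkl} and ΔR_{ijkl} with R_{ijkl}. By the symmetries of the
curvature and the second Bianchi identity both yield −4 R_{ijkl} ∇_i∇_k R_{jl}, the Laplacian with
an additional commutator of covariant derivatives. The Ricci part of the commutator cancels against
the time derivative of the metric in |Rm|², and three contractions of type Rm * Rm * Rm remain, each
at most |Rm|³ by Cauchy–Schwarz (`CurvatureAlgebra.evolution_le`).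

All tensor identities are proved in coordinates, with the connection and curvature written as
matrices. Everything in the evolution inequality is invariant under changes of coordinates that do
not depend on time, so at a given time and point one may assume g_{ij} = δ_{ij} and Γ^k_{ij} = 0
(`exists_normal`); second covariant derivatives of the curvature then involve only ∂∂R and ∂Γ * R.
The same invariance lets quantities defined at x in the chart at x be read near any point in a
single chart, so that they are smooth on M and integrals reduce to charts by a partition of unity.
-/

noncomputable section

namespace Coord

open scoped Matrix Topology

variable {n : ℕ}

local notation "𝔼" n => EuclideanSpace ℝ (Fin n)
local notation "𝕄" n => Matrix (Fin n) (Fin n) ℝ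

/-! ### Partial derivatives of functions on ℝⁿ -/

section PartialDerivatives

variable {f h : (𝔼 n) → ℝ} {y : 𝔼 n} {i j : Fin n}

lemma pd_congr (hfh : f =ᶠ[𝓝 y] h) : pd i f y = pd i h y := by
  simp only [pd, hfh.fderiv_eq]

lemma pd_const (c : ℝ) : pd i (fun _ => c) y = 0 := by
  simp [pd]

lemma pd_add (hf : DifferentiableAt ℝ f y) (hh : DifferentiableAt ℝ h y) :
    pd i (fun z => f z + h z) y = pd i f y + pd i h y := by
  simp [pd, fderiv_fun_add hf hh]

lemma pd_sub (hf : DifferentiableAt ℝ f y) (hh : DifferentiableAt ℝ h y) :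
    pd i (fun z => f z - h z) y = pd i f y - pd i h y := by
  simp [pd, fderiv_fun_sub hf hh]

lemma pd_neg : pd i (fun z => - f z) y = - pd i f y := by
  simp [pd, fderiv_fun_neg]

lemma pd_mul (hf : DifferentiableAt ℝ f y) (hh : DifferentiableAt ℝ h y) :
    pd i (fun z => f z * h z) y = pd i f y * h y + f y * pd i h y := by
  simp only [pd, fderiv_fun_mul hf hh, add_apply, smul_apply, smul_eq_mul]
  ring

lemma pd_const_mul (c : ℝ) (hf : DifferentiableAt ℝ f y) :
    pd i (fun z => c * f z) y = c * pd i f y := by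
  rw [pd_mul (by fun_prop) hf, pd_const]; ring

lemma pd_sum {κ : Type*} (s : Finset κ) {F : κ → (𝔼 n) → ℝ}
    (hF : ∀ k ∈ s, DifferentiableAt ℝ (F k) y) :
    pd i (fun z => ∑ k ∈ s, F k z) y = ∑ k ∈ s, pd i (F k) y := by
  simp only [pd, fderiv_fun_sum hF, sum_apply]

lemma contDiffAt_pd (hf : ContDiffAt ℝ ∞ f y) : ContDiffAt ℝ ∞ (pd i f) y :=
  (hf.fderiv_right (m := ∞) (by simp)).clm_apply contDiffAt_const

lemma pd_comm (hf : ContDiffAt ℝ ∞ f y) : pd i (pd j f) y = pd j (pd i f) y := by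
  have hs : IsSymmSndFDerivAt ℝ f y := hf.isSymmSndFDerivAt (by
    simp only [minSmoothness_of_isRCLikeNormedField]; exact WithTop.coe_le_coe.2 le_top)
  have hd : DifferentiableAt ℝ (fderiv ℝ f) y :=
    (hf.fderiv_right (m := ∞) (by simp)).differentiableAt (by simp)
  have key : ∀ k l : Fin n, pd k (pd l f) y =
      fderiv ℝ (fderiv ℝ f) y (EuclideanSpace.single k 1) (EuclideanSpace.single l 1) := by
    intro k l
    unfold pd
    rw [fderiv_clm_apply hd (by fun_prop)]
    simp
  rw [key, key]
  exact hs.eq _ _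

lemma fderiv_apply_eq_sum (v : 𝔼 n) : fderiv ℝ f y v = ∑ a, v a * pd a f y := by
  conv_lhs => rw [show v = ∑ a, v a • EuclideanSpace.single a (1 : ℝ) by
    ext k; simp [Finset.sum_apply, Pi.single_apply]]
  simp [pd]

lemma pd_comp {ψ : (𝔼 n) → 𝔼 n} (hψ : DifferentiableAt ℝ ψ y)
    (hf : DifferentiableAt ℝ f (ψ y)) :
    pd i (fun z => f (ψ z)) y = ∑ a, pd i (fun z => ψ z a) y * pd a f (ψ y) := by
  have h1 : pd i (fun z => f (ψ z)) y
      = fderiv ℝ f (ψ y) (fderiv ℝ ψ y (EuclideanSpace.single i 1)) := by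
    unfold pd
    have := fderiv_comp y hf hψ
    simp only [Function.comp_def] at this
    rw [this]; rfl
  rw [h1, fderiv_apply_eq_sum]
  refine Finset.sum_congr rfl fun a _ => ?_
  congr 1
  have := ((EuclideanSpace.proj a : (𝔼 n) →L[ℝ] ℝ).hasFDerivAt.comp y hψ.hasFDerivAt).fderiv
  change fderiv ℝ (fun z => ψ z a) y = _ at this
  simp [pd, this]

end PartialDerivatives

/-! ### Entrywise calculus of matrix fields -/

section MatrixCalculus

/-- The entrywise partial derivative of a matrix field. -/
def dM (i : Fin n) (F : (𝔼 n) → 𝕄 n) (y : 𝔼 n) : 𝕄 n :=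
  Matrix.of fun k l => pd i (fun z => F z k l) y

/-- A matrix field is smooth at a point if its entries are. -/
def SmoothMAt (F : (𝔼 n) → 𝕄 n) (y : 𝔼 n) : Prop :=
  ∀ k l, ContDiffAt ℝ ∞ (fun z => F z k l) y

variable {F H : (𝔼 n) → 𝕄 n} {y : 𝔼 n} {i j : Fin n}

lemma SmoothMAt.diff (hF : SmoothMAt F y) (k l : Fin n) :
    DifferentiableAt ℝ (fun z => F z k l) y := (hF k l).differentiableAt (by simp)

lemma SmoothMAt.mul (hF : SmoothMAt F y) (hH : SmoothMAt H y) :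
    SmoothMAt (fun z => F z * H z) y := by
  intro k l
  simp only [Matrix.mul_apply]
  exact ContDiffAt.sum fun m _ => (hF k m).mul (hH m l)

lemma SmoothMAt.add (hF : SmoothMAt F y) (hH : SmoothMAt H y) :
    SmoothMAt (fun z => F z + H z) y := fun k l => (hF k l).add (hH k l)

lemma SmoothMAt.sub (hF : SmoothMAt F y) (hH : SmoothMAt H y) :
    SmoothMAt (fun z => F z - H z) y := fun k l => (hF k l).sub (hH k l)

lemma SmoothMAt.transpose (hF : SmoothMAt F y) : SmoothMAt (fun z => (F z)ᵀ) y :=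
  fun k l => hF l k

lemma SmoothMAt.smul {f : (𝔼 n) → ℝ} (hf : ContDiffAt ℝ ∞ f y) (hF : SmoothMAt F y) :
    SmoothMAt (fun z => f z • F z) y := fun k l => hf.mul (hF k l)

lemma SmoothMAt.sum {κ : Type*} {s : Finset κ} {F : κ → (𝔼 n) → 𝕄 n}
    (hF : ∀ k ∈ s, SmoothMAt (F k) y) : SmoothMAt (fun z => ∑ k ∈ s, F k z) y := by
  intro k l
  simp only [Matrix.sum_apply]
  exact ContDiffAt.sum fun m hm => hF m hm k l

lemma SmoothMAt.dM (hF : SmoothMAt F y) : SmoothMAt (dM i F) y :=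
  fun k l => contDiffAt_pd (hF k l)

lemma SmoothMAt.congr (hF : SmoothMAt F y) (h : H =ᶠ[𝓝 y] F) : SmoothMAt H y :=
  fun k l => (hF k l).congr_of_eventuallyEq (h.mono fun z hz => by simp [hz])

lemma dM_congr (h : F =ᶠ[𝓝 y] H) : dM i F y = dM i H y := by
  ext k l
  exact pd_congr (h.mono fun z hz => by simp [hz])

lemma dM_const (B : 𝕄 n) : dM i (fun _ => B) y = 0 := by
  ext k l; exact pd_const _

lemma dM_mul (hF : SmoothMAt F y) (hH : SmoothMAt H y) :
    dM i (fun z => F z * H z) y = dM i F y * H y + F y * dM i H y := by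
  ext k l
  simp only [dM, Matrix.of_apply, Matrix.mul_apply, Matrix.add_apply]
  have := pd_sum (i := i) Finset.univ (F := fun m z => F z k m * H z m l) (y := y)
    fun m _ => (hF.diff k m).fun_mul (hH.diff m l)
  rw [this, ← Finset.sum_add_distrib]
  exact Finset.sum_congr rfl fun m _ => pd_mul (hF.diff k m) (hH.diff m l)

lemma dM_add (hF : SmoothMAt F y) (hH : SmoothMAt H y) :
    dM i (fun z => F z + H z) y = dM i F y + dM i H y := by
  ext k l; exact pd_add (hF.diff k l) (hH.diff k l)

lemma dM_sub (hF : SmoothMAt F y) (hH : SmoothMAt H y) :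
    dM i (fun z => F z - H z) y = dM i F y - dM i H y := by
  ext k l; exact pd_sub (hF.diff k l) (hH.diff k l)

lemma dM_transpose : dM i (fun z => (F z)ᵀ) y = (dM i F y)ᵀ := rfl

lemma dM_smul {f : (𝔼 n) → ℝ} (hf : ContDiffAt ℝ ∞ f y) (hF : SmoothMAt F y) :
    dM i (fun z => f z • F z) y = pd i f y • F y + f y • dM i F y := by
  ext k l; exact pd_mul (hf.differentiableAt (by simp)) (hF.diff k l)

lemma dM_sum {κ : Type*} {s : Finset κ} {F : κ → (𝔼 n) → 𝕄 n}
    (hF : ∀ k ∈ s, SmoothMAt (F k) y) :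
    dM i (fun z => ∑ k ∈ s, F k z) y = ∑ k ∈ s, dM i (F k) y := by
  ext k l
  simp only [dM, Matrix.of_apply, Matrix.sum_apply]
  exact pd_sum _ fun m hm => (hF m hm).diff k l

lemma dM_comm (hF : SmoothMAt F y) : dM i (dM j F) y = dM j (dM i F) y := by
  ext k l; exact pd_comm (hF k l)

lemma dM_comp {ψ : (𝔼 n) → 𝔼 n} (hψ : DifferentiableAt ℝ ψ y) (hF : SmoothMAt F (ψ y)) :
    dM i (fun z => F (ψ z)) y = ∑ a, pd i (fun z => ψ z a) y • dM a F (ψ y) := by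
  ext k l
  simp only [dM, Matrix.of_apply, Matrix.sum_apply, Matrix.smul_apply, smul_eq_mul]
  exact pd_comp hψ (hF.diff k l)

lemma contDiffWithinAt_det {X : Type*} [NormedAddCommGroup X] [NormedSpace ℝ X]
    {κ : Type*} [Fintype κ] [DecidableEq κ] {F : X → Matrix κ κ ℝ} {s : Set X} {x : X}
    (hF : ∀ k l, ContDiffWithinAt ℝ ∞ (fun z => F z k l) s x) :
    ContDiffWithinAt ℝ ∞ (fun z => (F z).det) s x := by
  simp only [Matrix.det_apply']
  exact ContDiffWithinAt.sum fun σ _ => contDiffWithinAt_const.mul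
    (contDiffWithinAt_prod fun k _ => hF _ _)

/-- Cramer's rule: the entries of the inverse are polynomials in the entries divided by the
determinant. The version within a set serves the slab [0,T] × V, whose time boundary has no
neighbourhood inside it. -/
lemma contDiffWithinAt_inv {X : Type*} [NormedAddCommGroup X] [NormedSpace ℝ X]
    {F : X → 𝕄 n} {s : Set X} {x : X}
    (hF : ∀ k l, ContDiffWithinAt ℝ ∞ (fun z => F z k l) s x) (hx : (F x).det ≠ 0)
    (k l : Fin n) : ContDiffWithinAt ℝ ∞ (fun z => (F z)⁻¹ k l) s x := by
  simp only [Matrix.inv_def, Ring.inverse_eq_inv', Matrix.smul_apply, smul_eq_mul,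
    Matrix.adjugate_apply]
  refine ((contDiffWithinAt_det hF).inv hx).mul (contDiffWithinAt_det fun a b => ?_)
  by_cases h : a = l
  · subst h; simp only [Matrix.updateRow_self]; exact contDiffWithinAt_const
  · simp only [Matrix.updateRow_ne h]; exact hF a b

lemma SmoothMAt.det (hF : SmoothMAt F y) : ContDiffAt ℝ ∞ (fun z => (F z).det) y :=
  contDiffWithinAt_univ.1 (contDiffWithinAt_det fun k l => (hF k l).contDiffWithinAt)

lemma SmoothMAt.inv (hF : SmoothMAt F y) (h : (F y).det ≠ 0) :
    SmoothMAt (fun z => (F z)⁻¹) y := fun k l =>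
  contDiffWithinAt_univ.1 (contDiffWithinAt_inv (fun k l => (hF k l).contDiffWithinAt) h k l)

lemma dM_inv (hF : SmoothMAt F y) (h : (F y).det ≠ 0) :
    dM i (fun z => (F z)⁻¹) y = - ((F y)⁻¹ * dM i F y * (F y)⁻¹) := by
  have hev : (fun z => F z * (F z)⁻¹) =ᶠ[𝓝 y] fun _ => 1 := by
    filter_upwards [hF.det.continuousAt.eventually_ne h] with z hz
    exact Matrix.mul_nonsing_inv _ (isUnit_iff_ne_zero.2 hz)
  have h1 := dM_congr (i := i) hev
  rw [dM_const, dM_mul hF (hF.inv h)] at h1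
  have h2 : F y * dM i (fun z => (F z)⁻¹) y = - (dM i F y * (F y)⁻¹) := by
    rw [eq_neg_iff_add_eq_zero, add_comm]; exact h1
  have h3 : (F y)⁻¹ * F y = 1 := Matrix.nonsing_inv_mul _ (isUnit_iff_ne_zero.2 h)
  calc dM i (fun z => (F z)⁻¹) y = (F y)⁻¹ * F y * dM i (fun z => (F z)⁻¹) y := by
        rw [h3, one_mul]
    _ = _ := by rw [mul_assoc, h2]; noncomm_ring

end MatrixCalculus

end Coord

end

/-! ### The Levi-Civita connection and the Bianchi identities in matrix form -/

noncomputable section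

namespace Coord

open scoped Matrix Topology

variable {n : ℕ}

local notation "𝔼" n => EuclideanSpace ℝ (Fin n)
local notation "𝕄" n => Matrix (Fin n) (Fin n) ℝ

/-- `G` is a smooth Riemannian metric on the open set `V` of `ℝⁿ`. -/
structure IsMetricOn (G : (𝔼 n) → 𝕄 n) (V : Set (𝔼 n)) : Prop where
  isOpen : IsOpen V
  smooth : ∀ y ∈ V, SmoothMAt G y
  posDef : ∀ y ∈ V, (G y).PosDef

/-- The connection matrix `(A_i)_{kj} = Γ^k_{ij}`. -/
def conn (G : (𝔼 n) → 𝕄 n) (i : Fin n) (y : 𝔼 n) : 𝕄 n :=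
  Matrix.of fun k j => christoffel G k i j y

/-- The curvature matrix `(R_{ij})_{lk} = R_{ijk}^l`. -/
def curv (G : (𝔼 n) → 𝕄 n) (i j : Fin n) (y : 𝔼 n) : 𝕄 n :=
  Matrix.of fun l k => riem G i j k l y

/-- The structure equation R = dA + A ∧ A for the matrices A_i. It turns the differential identities
for the curvature into noncommutative algebra plus the symmetry of second derivatives. -/
lemma curv_eq {G : (𝔼 n) → 𝕄 n} {y : 𝔼 n} (i j : Fin n) : curv G i j y = dM i (conn G j) y - dM j (conn G i) y
    + (conn G i y * conn G j y - conn G j y * conn G i y) := by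
  ext l k
  simp [curv, riem, dM, conn, Matrix.mul_apply, Finset.sum_sub_distrib]

lemma curv_antisymm {G : (𝔼 n) → 𝕄 n} {y : 𝔼 n} (i j : Fin n) : curv G j i y = - curv G i j y := by
  rw [curv_eq, curv_eq]; abel

namespace IsMetricOn

variable {G : (𝔼 n) → 𝕄 n} {V : Set (𝔼 n)} (hG : IsMetricOn G V) {y : 𝔼 n} (hy : y ∈ V)
include hG hy

lemma eventually_mem : ∀ᶠ z in 𝓝 y, z ∈ V := hG.isOpen.mem_nhds hy

lemma transpose : (G y)ᵀ = G y := by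
  have := (hG.posDef y hy).1
  rwa [Matrix.IsHermitian, Matrix.conjTranspose_eq_transpose_of_trivial] at this

lemma symm (i j : Fin n) : G y i j = G y j i := by
  conv_lhs => rw [← hG.transpose hy]
  rfl

lemma det_ne : (G y).det ≠ 0 := (hG.posDef y hy).det_pos.ne'

lemma isUnit_det : IsUnit (G y).det := isUnit_iff_ne_zero.2 (hG.det_ne hy)

lemma inv_transpose : ((G y)⁻¹)ᵀ = (G y)⁻¹ := by
  rw [Matrix.transpose_nonsing_inv, hG.transpose hy]

lemma inv_symm (i j : Fin n) : (G y)⁻¹ i j = (G y)⁻¹ j i := by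
  conv_lhs => rw [← hG.inv_transpose hy]
  rfl

lemma smooth_inv : SmoothMAt (fun z => (G z)⁻¹) y := (hG.smooth y hy).inv (hG.det_ne hy)

lemma pd_symm (l i j : Fin n) : pd l (fun z => G z i j) y = pd l (fun z => G z j i) y :=
  pd_congr ((hG.eventually_mem hy).mono fun _ hz => hG.symm hz i j)

lemma smooth_conn (i : Fin n) : SmoothMAt (conn G i) y := by
  intro k j
  simp only [conn, christoffel, Matrix.of_apply]
  refine contDiffAt_const.mul (ContDiffAt.sum fun l _ => (hG.smooth_inv hy k l).mul ?_)
  exact ((contDiffAt_pd (hG.smooth y hy _ _)).add (contDiffAt_pd (hG.smooth y hy _ _))).sub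
    (contDiffAt_pd (hG.smooth y hy _ _))

lemma smooth_curv (i j : Fin n) : SmoothMAt (curv G i j) y := by
  have h : SmoothMAt (fun y => dM i (conn G j) y - dM j (conn G i) y
      + (conn G i y * conn G j y - conn G j y * conn G i y)) y :=
    (((hG.smooth_conn hy j).dM.sub (hG.smooth_conn hy i).dM)).add
      (((hG.smooth_conn hy i).mul (hG.smooth_conn hy j)).sub
        ((hG.smooth_conn hy j).mul (hG.smooth_conn hy i)))
  exact h.congr (Eventually.of_forall fun z => curv_eq i j)

lemma conn_symm (i j k : Fin n) : conn G i y k j = conn G j y k i := by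
  simp only [conn, christoffel, Matrix.of_apply]
  congr 1
  refine Finset.sum_congr rfl fun l _ => ?_
  rw [hG.pd_symm hy l i j]; ring

lemma metric_mul_conn (i m j : Fin n) : (G y * conn G i y) m j = (1 / 2 : ℝ) *
    (pd i (fun z => G z j m) y + pd j (fun z => G z i m) y - pd m (fun z => G z i j) y) := by
  have h : conn G i y = (G y)⁻¹ * Matrix.of fun m j => (1 / 2 : ℝ) *
    (pd i (fun z => G z j m) y + pd j (fun z => G z i m) y - pd m (fun z => G z i j) y) := by
    ext k j
    simp only [conn, christoffel, Matrix.of_apply, Matrix.mul_apply, Finset.mul_sum]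
    exact Finset.sum_congr rfl fun l _ => by ring
  rw [h, ← mul_assoc, Matrix.mul_nonsing_inv _ (hG.isUnit_det hy), one_mul]
  rfl

lemma dM_metric (i : Fin n) : dM i G y = (conn G i y)ᵀ * G y + G y * conn G i y := by
  have h : (conn G i y)ᵀ * G y = (G y * conn G i y)ᵀ := by
    rw [Matrix.transpose_mul, hG.transpose hy]
  ext m j
  rw [h, Matrix.add_apply, Matrix.transpose_apply, hG.metric_mul_conn hy, hG.metric_mul_conn hy]
  simp only [dM, Matrix.of_apply]
  rw [hG.pd_symm hy i j m, hG.pd_symm hy m i j]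
  ring

/-- Koszul's argument: symmetry and metric compatibility determine the lowered symbols G B_i through
an alternating sum of the derivatives of G. It yields the transformation law of Γ without
differentiating the Christoffel formula. -/
lemma conn_unique {B : Fin n → 𝕄 n} (hsymm : ∀ i j k, B i k j = B j k i)
    (hB : ∀ i, dM i G y = (B i)ᵀ * G y + G y * B i) (i : Fin n) : B i = conn G i y := by
  have hT : ∀ i, (B i)ᵀ * G y = (G y * B i)ᵀ := fun i => by
    rw [Matrix.transpose_mul, hG.transpose hy]
  have hs : ∀ i j m, (G y * B i) m j = (G y * B j) m i := fun i j m => by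
    simp only [Matrix.mul_apply]
    exact Finset.sum_congr rfl fun k _ => by rw [hsymm]
  have hd : ∀ l m j, pd l (fun z => G z m j) y = (G y * B l) j m + (G y * B l) m j := by
    intro l m j
    have := congrFun (congrFun (hB l) m) j
    rw [hT, Matrix.add_apply, Matrix.transpose_apply] at this
    exact this
  have h : G y * B i = G y * conn G i y := by
    ext m j
    rw [hG.metric_mul_conn hy, hd, hd, hd, hs i m j, hs j i m, hs j m i]
    rw [hs i j m]; ring
  calc B i = (G y)⁻¹ * (G y * B i) := by
        rw [← mul_assoc, Matrix.nonsing_inv_mul _ (hG.isUnit_det hy), one_mul]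
    _ = _ := by rw [h, ← mul_assoc, Matrix.nonsing_inv_mul _ (hG.isUnit_det hy), one_mul]

/-- Differentiate metric compatibility once more and antisymmetrise: the second derivatives of G
cancel, and what remains is the skew-symmetry of R_{ijkl} in its last two indices. -/
lemma curv_metric (i j : Fin n) : (curv G i j y)ᵀ * G y + G y * curv G i j y = 0 := by
  have hd : ∀ i j, dM i (dM j G) y = (dM i (conn G j) y)ᵀ * G y + (conn G j y)ᵀ * dM i G y
      + (dM i G y * conn G j y + G y * dM i (conn G j) y) := by
    intro i j
    rw [dM_congr ((hG.eventually_mem hy).mono fun z hz => hG.dM_metric hz j),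
      dM_add ((hG.smooth_conn hy j).transpose.mul (hG.smooth y hy))
        ((hG.smooth y hy).mul (hG.smooth_conn hy j)),
      dM_mul (hG.smooth_conn hy j).transpose (hG.smooth y hy),
      dM_mul (hG.smooth y hy) (hG.smooth_conn hy j), dM_transpose]
  have h := dM_comm (i := i) (j := j) (hG.smooth y hy)
  rw [hd, hd, hG.dM_metric hy, hG.dM_metric hy, ← sub_eq_zero] at h
  rw [curv_eq, ← h]
  simp only [Matrix.transpose_add, Matrix.transpose_sub, Matrix.transpose_mul]
  noncomm_ring

/-- Torsion-freeness, that is Γ^k_{ij} = Γ^k_{ji}, makes both the derivative terms and the products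
of Christoffel symbols cancel in the cyclic sum. -/
lemma bianchi_first (i j k l : Fin n) :
    curv G i j y l k + curv G j k y l i + curv G k i y l j = 0 := by
  have hc : ∀ p i j l, dM p (conn G i) y l j = dM p (conn G j) y l i := fun p i j l =>
    pd_congr ((hG.eventually_mem hy).mono fun z hz => hG.conn_symm hz i j l)
  have hm : ∀ i j k l, (conn G i y * conn G j y) l k = (conn G i y * conn G k y) l j := by
    intro i j k l
    simp only [Matrix.mul_apply]
    exact Finset.sum_congr rfl fun m _ => by rw [hG.conn_symm hy j k m]
  simp only [curv_eq, Matrix.add_apply, Matrix.sub_apply]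
  rw [hc i j k, hc j i k, hc j k i, hc k j i, hc k i j, hc i k j, hm i j k, hm j i k, hm k j i]
  ring

lemma dM_curv (p i j : Fin n) : dM p (curv G i j) y = dM p (dM i (conn G j)) y
    - dM p (dM j (conn G i)) y
    + ((dM p (conn G i) y * conn G j y + conn G i y * dM p (conn G j) y)
      - (dM p (conn G j) y * conn G i y + conn G j y * dM p (conn G i) y)) := by
  have hA := hG.smooth_conn hy
  rw [dM_congr (Eventually.of_forall fun z => curv_eq i j),
    dM_add ((hA j).dM.sub (hA i).dM) (((hA i).mul (hA j)).sub ((hA j).mul (hA i))),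
    dM_sub (hA j).dM (hA i).dM, dM_sub ((hA i).mul (hA j)) ((hA j).mul (hA i)),
    dM_mul (hA i) (hA j), dM_mul (hA j) (hA i)]

/-- This is d_A F_A = 0. Only the endomorphism indices carry connection terms; those for the form
indices would cancel in the cyclic sum because Γ is symmetric. -/
lemma bianchi_second (p i j : Fin n) :
    (dM p (curv G i j) y + (conn G p y * curv G i j y - curv G i j y * conn G p y))
    + (dM i (curv G j p) y + (conn G i y * curv G j p y - curv G j p y * conn G i y))
    + (dM j (curv G p i) y + (conn G j y * curv G p i y - curv G p i y * conn G j y)) = 0 := by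
  have hA := hG.smooth_conn hy
  rw [hG.dM_curv hy, hG.dM_curv hy, hG.dM_curv hy, curv_eq, curv_eq, curv_eq,
    dM_comm (i := i) (j := p) (hA j), dM_comm (i := j) (j := p) (hA i),
    dM_comm (i := j) (j := i) (hA p)]
  noncomm_ring

end IsMetricOn

end Coord

end

/-! ### Behaviour of curvature, gradient and Laplacian under changes of coordinates -/

noncomputable section

namespace Coord

open scoped Matrix Topology

variable {n : ℕ}

local notation "𝔼" n => EuclideanSpace ℝ (Fin n)
local notation "𝕄" n => Matrix (Fin n) (Fin n) ℝ

/-- The inner product of gradients, `⟨∇f, ∇h⟩ = g^{ij} ∂_i f ∂_j h`. -/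
def gradInner (G : (𝔼 n) → 𝕄 n) (f h : (𝔼 n) → ℝ) (y : 𝔼 n) : ℝ :=
  ∑ i, ∑ j, (G y)⁻¹ i j * pd i f y * pd j h y

/-- The scalar curvature `g^{jk} R_{jk}`. -/
def scal (G : (𝔼 n) → 𝕄 n) (y : 𝔼 n) : ℝ := ∑ j, ∑ k, (G y)⁻¹ j k * ricci G j k y

/-- The Jacobian matrix `∂_i ψ^a`. -/
def jac (ψ : (𝔼 n) → 𝔼 n) (w : 𝔼 n) : 𝕄 n := Matrix.of fun a i => pd i (fun z => ψ z a) w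

/-- `ψ : W → V` is a smooth map between open sets with invertible differential. -/
structure IsCoordChange (ψ : (𝔼 n) → 𝔼 n) (W V : Set (𝔼 n)) : Prop where
  isOpen : IsOpen W
  smooth : ∀ w ∈ W, ContDiffAt ℝ ∞ ψ w
  mapsTo : ∀ w ∈ W, ψ w ∈ V
  det_ne : ∀ w ∈ W, (jac ψ w).det ≠ 0

/-- One explicit permutation of an eightfold product replaces a long chain of interchanges of sums.
The order on the right is the one in which the trace formula for |Rm|² unfolds. -/
lemma sum_reorder_eight {κ : Type*} [Fintype κ] (f : κ → κ → κ → κ → κ → κ → κ → κ → ℝ) :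
    ∑ i, ∑ j, ∑ k, ∑ l, ∑ a, ∑ b, ∑ c, ∑ d, f i j k l a b c d
      = ∑ i, ∑ a, ∑ j, ∑ b, ∑ l, ∑ d, ∑ c, ∑ k, f i j k l a b c d := by
  let e : ((((((κ × κ) × κ) × κ) × κ) × κ) × κ) × κ ≃ ((((((κ × κ) × κ) × κ) × κ) × κ) × κ) × κ :=
    { toFun := fun x => (((((((x.1.1.1.1.1.1.1, x.1.1.1.2), x.1.1.1.1.1.1.2), x.1.1.2),
        x.1.1.1.1.2), x.2), x.1.2), x.1.1.1.1.1.2)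
      invFun := fun x => (((((((x.1.1.1.1.1.1.1, x.1.1.1.1.1.2), x.2), x.1.1.1.2),
        x.1.1.1.1.1.1.2), x.1.1.1.1.2), x.1.2), x.1.1.2)
      left_inv := fun _ => rfl
      right_inv := fun _ => rfl }
  have h := Equiv.sum_comp e fun x => f x.1.1.1.1.1.1.1 x.1.1.1.1.1.2 x.2 x.1.1.1.2
    x.1.1.1.1.1.1.2 x.1.1.1.1.2 x.1.2 x.1.1.2
  simp only [Fintype.sum_prod_type] at h
  exact h

/-- In this form a change of basis acts on the inner indices by conjugation, which the trace
absorbs, and only the two pairs of form indices remain to be contracted. -/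
lemma rmSq_eq_trace {G : (𝔼 n) → 𝕄 n} {y : 𝔼 n} (hG : (G y)ᵀ = G y) :
    rmSq G y = ∑ i, ∑ a, (G y)⁻¹ i a * ∑ j, ∑ b, (G y)⁻¹ j b *
      (curv G i j y * (G y)⁻¹ * (curv G a b y)ᵀ * G y).trace := by
  have hs : ∀ l d, G y l d = G y d l := fun l d => by
    conv_lhs => rw [← hG]
    rfl
  rw [rmSq, sum_reorder_eight]
  simp only [Matrix.trace, Matrix.diag_apply, Matrix.mul_apply, Matrix.transpose_apply, curv,
    Matrix.of_apply, Finset.mul_sum, Finset.sum_mul]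
  refine Finset.sum_congr rfl fun i _ => Finset.sum_congr rfl fun a _ =>
    Finset.sum_congr rfl fun j _ => Finset.sum_congr rfl fun b _ =>
    Finset.sum_congr rfl fun l _ => Finset.sum_congr rfl fun d _ =>
    Finset.sum_congr rfl fun c _ => Finset.sum_congr rfl fun k _ => ?_
  rw [hs l d]; ring

/-- Contraction with the inverse metric is natural under a change of coordinates. -/
lemma contract_pull {P P' J : 𝕄 n} (h : J * P' * Jᵀ = P) (X : Fin n → Fin n → ℝ) :
    ∑ i, ∑ j, P' i j * ∑ a, ∑ b, J a i * J b j * X a b = ∑ a, ∑ b, P a b * X a b := by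
  have hP : ∀ a b, P a b = ∑ i, ∑ j, P' i j * (J a i * J b j) := by
    intro a b
    simp only [← h, Matrix.mul_apply, Matrix.transpose_apply, Finset.sum_mul]
    rw [Finset.sum_comm]
    exact Finset.sum_congr rfl fun i _ => Finset.sum_congr rfl fun j _ => by ring
  simp only [hP, Finset.sum_mul, Finset.mul_sum]
  calc _ = ∑ i, ∑ a, ∑ j, ∑ b, P' i j * (J a i * J b j * X a b) :=
        Finset.sum_congr rfl fun i _ => Finset.sum_comm
    _ = ∑ a, ∑ i, ∑ j, ∑ b, P' i j * (J a i * J b j * X a b) := Finset.sum_comm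
    _ = ∑ a, ∑ i, ∑ b, ∑ j, P' i j * (J a i * J b j * X a b) :=
        Finset.sum_congr rfl fun a _ => Finset.sum_congr rfl fun i _ => Finset.sum_comm
    _ = ∑ a, ∑ b, ∑ i, ∑ j, P' i j * (J a i * J b j * X a b) :=
        Finset.sum_congr rfl fun a _ => Finset.sum_comm
    _ = _ := by
        refine Finset.sum_congr rfl fun a _ => Finset.sum_congr rfl fun b _ =>
          Finset.sum_congr rfl fun i _ => Finset.sum_congr rfl fun j _ => by ring

namespace IsCoordChange

variable {ψ : (𝔼 n) → 𝔼 n} {W V : Set (𝔼 n)} (hψ : IsCoordChange ψ W V)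
  {w : 𝔼 n} (hw : w ∈ W)
include hψ hw

lemma smooth_coord (a : Fin n) : ContDiffAt ℝ ∞ (fun z => ψ z a) w :=
  ((EuclideanSpace.proj a : (𝔼 n) →L[ℝ] ℝ).contDiff.contDiffAt).comp w (hψ.smooth w hw)

lemma smooth_jac : SmoothMAt (jac ψ) w := fun a _ => contDiffAt_pd (hψ.smooth_coord hw a)

lemma differentiableAt : DifferentiableAt ℝ ψ w := (hψ.smooth w hw).differentiableAt (by simp)

lemma dM_jac_symm (i j a : Fin n) : dM i (jac ψ) w a j = dM j (jac ψ) w a i :=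
  pd_comm (hψ.smooth_coord hw a)

lemma jac_mul_inv : jac ψ w * (jac ψ w)⁻¹ = 1 :=
  Matrix.mul_nonsing_inv _ (isUnit_iff_ne_zero.2 (hψ.det_ne w hw))

lemma inv_mul_jac : (jac ψ w)⁻¹ * jac ψ w = 1 :=
  Matrix.nonsing_inv_mul _ (isUnit_iff_ne_zero.2 (hψ.det_ne w hw))

lemma smoothMAt_comp {F : (𝔼 n) → 𝕄 n} (hF : SmoothMAt F (ψ w)) :
    SmoothMAt (fun z => F (ψ z)) w := fun k l => (hF k l).comp w (hψ.smooth w hw)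

lemma pd_comp {f : (𝔼 n) → ℝ} (hf : ContDiffAt ℝ ∞ f (ψ w)) (i : Fin n) :
    pd i (fun z => f (ψ z)) w = ∑ a, jac ψ w a i * pd a f (ψ w) :=
  Coord.pd_comp (hψ.differentiableAt hw) (hf.differentiableAt (by simp))

lemma dM_comp {F : (𝔼 n) → 𝕄 n} (hF : SmoothMAt F (ψ w)) (i : Fin n) :
    dM i (fun z => F (ψ z)) w = ∑ a, jac ψ w a i • dM a F (ψ w) :=
  Coord.dM_comp (hψ.differentiableAt hw) hF

end IsCoordChange

/-- `G'` is the pullback of the metric `G` on `V` by the change of coordinates `ψ : W → V`. -/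
structure IsPullback (ψ : (𝔼 n) → 𝔼 n) (W V : Set (𝔼 n)) (G G' : (𝔼 n) → 𝕄 n) : Prop where
  coord : IsCoordChange ψ W V
  metric : IsMetricOn G V
  eq : ∀ w ∈ W, G' w = (jac ψ w)ᵀ * G (ψ w) * jac ψ w

namespace IsPullback

variable {ψ : (𝔼 n) → 𝔼 n} {W V : Set (𝔼 n)} {G G' : (𝔼 n) → 𝕄 n}
  (h : IsPullback ψ W V G G')
include h

lemma metric' : IsMetricOn G' W where
  isOpen := h.coord.isOpen
  smooth w hw := by
    have := h.coord.smooth_jac hw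
    refine SmoothMAt.congr ((this.transpose.mul (h.coord.smoothMAt_comp hw
      (h.metric.smooth _ (h.coord.mapsTo w hw)))).mul this) ?_
    filter_upwards [h.coord.isOpen.mem_nhds hw] with z hz using h.eq z hz
  posDef w hw := by
    rw [h.eq w hw, ← Matrix.conjTranspose_eq_transpose_of_trivial]
    refine (h.metric.posDef _ (h.coord.mapsTo w hw)).conjTranspose_mul_mul_same ?_
    exact Matrix.mulVec_injective_of_isUnit
      ((Matrix.isUnit_iff_isUnit_det _).2 (isUnit_iff_ne_zero.2 (h.coord.det_ne w hw)))

variable {w : 𝔼 n} (hw : w ∈ W)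
include hw

lemma inv_eq : jac ψ w * (G' w)⁻¹ * (jac ψ w)ᵀ = (G (ψ w))⁻¹ := by
  have h1 : IsUnit (jac ψ w).det := isUnit_iff_ne_zero.2 (h.coord.det_ne w hw)
  have h2 : IsUnit ((jac ψ w)ᵀ).det := by rwa [Matrix.det_transpose]
  rw [h.eq w hw, Matrix.mul_inv_rev, Matrix.mul_inv_rev, ← mul_assoc, Matrix.mul_nonsing_inv _ h1,
    one_mul, mul_assoc, Matrix.nonsing_inv_mul _ h2, mul_one]

/-- The inhomogeneous transformation law of Γ. The matrices J⁻¹(∂_i J + C_i J), with C_i = J^a_i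
Γ_a, are symmetric in the lower indices and compatible with the pulled back metric, so `conn_unique`
identifies them with its connection. -/
lemma jac_mul_conn (i : Fin n) : jac ψ w * conn G' i w =
    dM i (jac ψ) w + (∑ a, jac ψ w a i • conn G a (ψ w)) * jac ψ w := by
  have hV := h.coord.mapsTo w hw
  set J := jac ψ w with hJ
  set C : Fin n → 𝕄 n := fun i => ∑ a, J a i • conn G a (ψ w) with hC
  have hJJ : J * J⁻¹ = 1 := h.coord.jac_mul_inv hw
  set B : Fin n → 𝕄 n := fun i => J⁻¹ * (dM i (jac ψ) w + C i * J) with hB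
  have hJB : ∀ i, J * B i = dM i (jac ψ) w + C i * J := fun i => by
    rw [hB]; simp only [← mul_assoc, hJJ, one_mul]
  suffices B i = conn G' i w by rw [← this, hJB]
  refine h.metric'.conn_unique hw ?_ ?_ i
  · intro i j k
    rw [hB]
    simp only [Matrix.mul_apply (M := J⁻¹)]
    refine Finset.sum_congr rfl fun a _ => ?_
    congr 1
    simp only [Matrix.add_apply, h.coord.dM_jac_symm hw i j a]
    congr 1
    simp only [hC, Matrix.mul_apply, Matrix.sum_apply, Matrix.smul_apply, smul_eq_mul,
      Finset.sum_mul]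
    rw [Finset.sum_comm]
    refine Finset.sum_congr rfl fun b _ => Finset.sum_congr rfl fun c _ => ?_
    rw [h.metric.conn_symm hV]; ring
  · intro i
    have hsm := h.coord.smooth_jac hw
    have hGs := h.coord.smoothMAt_comp hw (h.metric.smooth _ hV)
    rw [dM_congr (F := G') (H := fun z => (jac ψ z)ᵀ * G (ψ z) * jac ψ z)
      (by filter_upwards [h.coord.isOpen.mem_nhds hw] with z hz using h.eq z hz),
      dM_mul (hsm.transpose.mul hGs) hsm, dM_mul hsm.transpose hGs, dM_transpose,
      h.coord.dM_comp hw (h.metric.smooth _ hV), h.eq w hw]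
    have h1 : ∑ a, jac ψ w a i • dM a G (ψ w) = (C i)ᵀ * G (ψ w) + G (ψ w) * C i := by
      simp only [hC, Matrix.transpose_sum, Finset.sum_mul, Finset.mul_sum,
        ← Finset.sum_add_distrib, Matrix.transpose_smul]
      refine Finset.sum_congr rfl fun a _ => ?_
      rw [h.metric.dM_metric hV, smul_add, Matrix.smul_mul, Matrix.mul_smul]
    rw [h1]
    have h2 : Jᵀ * G (ψ w) * J * B i = Jᵀ * G (ψ w) * (dM i (jac ψ) w + C i * J) := by
      rw [mul_assoc _ J, hJB]
    have h3 : (B i)ᵀ * (Jᵀ * G (ψ w) * J) = (dM i (jac ψ) w + C i * J)ᵀ * G (ψ w) * J := by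
      simp only [← hJB, Matrix.transpose_mul (J), mul_assoc]
    rw [h2, h3, Matrix.transpose_add, Matrix.transpose_mul]
    noncomm_ring

/-- Differentiate the transformation law of the connection and antisymmetrise: ∂_i∂_j J is symmetric
and drops out, and the derivatives of J inside C_i cancel likewise, so the curvature transforms as a
tensor. -/
lemma jac_mul_curv (i j : Fin n) : jac ψ w * curv G' i j w =
    (∑ a, ∑ b, (jac ψ w a i * jac ψ w b j) • curv G a b (ψ w)) * jac ψ w := by
  have hV := h.coord.mapsTo w hw
  have hsm := h.coord.smooth_jac hw
  have hA := h.metric'.smooth_conn hw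
  set C : Fin n → (𝔼 n) → 𝕄 n := fun i z => ∑ a, jac ψ z a i • conn G a (ψ z) with hC
  have hCs1 : ∀ i, ∀ a ∈ Finset.univ, SmoothMAt (fun z => jac ψ z a i • conn G a (ψ z)) w :=
    fun i a _ => SmoothMAt.smul (hsm a i) (h.coord.smoothMAt_comp hw (h.metric.smooth_conn hV a))
  have hCs : ∀ i, SmoothMAt (C i) w := fun i => SmoothMAt.sum (hCs1 i)
  have key : ∀ i j, dM i (jac ψ) w * conn G' j w + jac ψ w * dM i (conn G' j) w =
      dM i (dM j (jac ψ)) w + (dM i (C j) w * jac ψ w + C j w * dM i (jac ψ) w) := by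
    intro i j
    rw [← dM_mul hsm (hA j), ← dM_mul (hCs j) hsm, ← dM_add hsm.dM ((hCs j).mul hsm)]
    refine dM_congr ?_
    filter_upwards [h.coord.isOpen.mem_nhds hw] with z hz using h.jac_mul_conn hz j
  have hJ : ∀ i, dM i (jac ψ) w = jac ψ w * conn G' i w - C i w * jac ψ w := fun i => by
    rw [h.jac_mul_conn hw]; simp [hC]
  have hdC : ∀ i j, dM i (C j) w = ∑ b, dM i (jac ψ) w b j • conn G b (ψ w)
      + ∑ a, ∑ b, (jac ψ w a i * jac ψ w b j) • dM a (conn G b) (ψ w) := by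
    intro i j
    rw [hC, dM_sum (hCs1 j), Finset.sum_comm, ← Finset.sum_add_distrib]
    refine Finset.sum_congr rfl fun b _ => ?_
    rw [dM_smul (hsm b j) (h.coord.smoothMAt_comp hw (h.metric.smooth_conn hV b)),
      h.coord.dM_comp hw (h.metric.smooth_conn hV b), Finset.smul_sum]
    congr 1
    exact Finset.sum_congr rfl fun a _ => by rw [smul_smul, mul_comm]
  have hcurv : dM i (C j) w - dM j (C i) w + (C i w * C j w - C j w * C i w) =
      ∑ a, ∑ b, (jac ψ w a i * jac ψ w b j) • curv G a b (ψ w) := by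
    have h2 : ∑ a, ∑ b, (jac ψ w a j * jac ψ w b i) • dM a (conn G b) (ψ w) =
        ∑ a, ∑ b, (jac ψ w a i * jac ψ w b j) • dM b (conn G a) (ψ w) := by
      rw [Finset.sum_comm]
      exact Finset.sum_congr rfl fun a _ => Finset.sum_congr rfl fun b _ => by rw [mul_comm]
    have h3 : C i w * C j w = ∑ a, ∑ b, (jac ψ w a i * jac ψ w b j) •
        (conn G a (ψ w) * conn G b (ψ w)) := by
      simp only [hC, Finset.sum_mul, Finset.mul_sum, Matrix.smul_mul, Matrix.mul_smul, smul_smul]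
      rw [Finset.sum_comm]
      exact Finset.sum_congr rfl fun a _ => Finset.sum_congr rfl fun b _ => by rw [mul_comm]
    have h4 : C j w * C i w = ∑ a, ∑ b, (jac ψ w a i * jac ψ w b j) •
        (conn G b (ψ w) * conn G a (ψ w)) := by
      simp only [hC, Finset.sum_mul, Finset.mul_sum, Matrix.smul_mul, Matrix.mul_smul, smul_smul]
    rw [hdC, hdC, h2, h3, h4]
    simp only [curv_eq, smul_add, smul_sub, Finset.sum_add_distrib, Finset.sum_sub_distrib,
      h.coord.dM_jac_symm hw i j]
    abel
  rw [← hcurv, curv_eq]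
  have k1 := key i j
  have k2 := key j i
  rw [dM_comm hsm] at k2
  have e1 : jac ψ w * dM i (conn G' j) w = dM i (dM j (jac ψ)) w + (dM i (C j) w * jac ψ w
      + C j w * dM i (jac ψ) w) - dM i (jac ψ) w * conn G' j w := by rw [← k1]; abel
  have e2 : jac ψ w * dM j (conn G' i) w = dM i (dM j (jac ψ)) w + (dM j (C i) w * jac ψ w
      + C i w * dM j (jac ψ) w) - dM j (jac ψ) w * conn G' i w := by rw [← k2]; abel
  rw [mul_add, mul_sub, e1, e2, hJ i, hJ j]
  noncomm_ring

lemma curv_eq_conj (i j : Fin n) : curv G' i j w = (jac ψ w)⁻¹ *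
    (∑ a, ∑ b, (jac ψ w a i * jac ψ w b j) • curv G a b (ψ w)) * jac ψ w := by
  rw [mul_assoc, ← h.jac_mul_curv hw, ← mul_assoc, h.coord.inv_mul_jac hw, one_mul]

lemma ricci_eq (j k : Fin n) : ricci G' j k w =
    ∑ b, ∑ c, jac ψ w b j * jac ψ w c k * ricci G b c (ψ w) := by
  have h1 : ∀ i, riem G' i j k i w = ∑ a, ∑ b, ∑ m, ∑ c, (jac ψ w)⁻¹ i m *
      (jac ψ w a i * jac ψ w b j) * curv G a b (ψ w) m c * jac ψ w c k := by
    intro i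
    have := congrFun (congrFun (h.curv_eq_conj hw i j) i) k
    change riem G' i j k i w = _ at this
    rw [this]
    simp only [Finset.mul_sum, Finset.sum_mul, Matrix.sum_apply]
    refine Finset.sum_congr rfl fun a _ => Finset.sum_congr rfl fun b _ => ?_
    simp only [Matrix.mul_apply, Matrix.smul_apply, Finset.sum_mul, smul_eq_mul]
    rw [Finset.sum_comm]
    refine Finset.sum_congr rfl fun m _ => Finset.sum_congr rfl fun c _ => by ring
  have h2 : ∀ a m, ∑ i, jac ψ w a i * (jac ψ w)⁻¹ i m = if a = m then 1 else 0 := by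
    intro a m
    have := congrFun (congrFun (h.coord.jac_mul_inv hw) a) m
    rwa [Matrix.mul_apply, Matrix.one_apply] at this
  calc ricci G' j k w = ∑ a, ∑ b, ∑ m, ∑ c, (∑ i, jac ψ w a i * (jac ψ w)⁻¹ i m) *
        (jac ψ w b j * curv G a b (ψ w) m c * jac ψ w c k) := by
        simp only [ricci, h1]
        rw [Finset.sum_comm]
        refine Finset.sum_congr rfl fun a _ => ?_
        rw [Finset.sum_comm]
        refine Finset.sum_congr rfl fun b _ => ?_
        rw [Finset.sum_comm]
        refine Finset.sum_congr rfl fun m _ => ?_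
        rw [Finset.sum_comm]
        refine Finset.sum_congr rfl fun c _ => ?_
        rw [Finset.sum_mul]
        exact Finset.sum_congr rfl fun i _ => by ring
    _ = ∑ a, ∑ b, ∑ c, jac ψ w b j * curv G a b (ψ w) a c * jac ψ w c k := by
        refine Finset.sum_congr rfl fun a _ => Finset.sum_congr rfl fun b _ => ?_
        rw [Finset.sum_comm]
        refine Finset.sum_congr rfl fun c _ => ?_
        simp [h2]
    _ = _ := by
        rw [Finset.sum_comm]
        refine Finset.sum_congr rfl fun b _ => ?_
        rw [Finset.sum_comm]
        refine Finset.sum_congr rfl fun c _ => ?_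
        simp only [ricci, Finset.mul_sum]
        refine Finset.sum_congr rfl fun a _ => ?_
        simp only [curv, Matrix.of_apply]; ring

/-- The Jacobians in the endomorphism indices cancel inside the trace; those in the form indices are
removed by two applications of `contract_pull`. -/
lemma rmSq_eq : rmSq G' w = rmSq G (ψ w) := by
  have hV := h.coord.mapsTo w hw
  rw [rmSq_eq_trace (h.metric'.transpose hw), rmSq_eq_trace (h.metric.transpose hV)]
  set J := jac ψ w with hJ
  set P := (G (ψ w))⁻¹ with hP
  set P' := (G' w)⁻¹ with hP'
  have hPP : J * P' * Jᵀ = P := h.inv_eq hw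
  have hJJ : J * J⁻¹ = 1 := h.coord.jac_mul_inv hw
  have hJJt : (J⁻¹)ᵀ * Jᵀ = 1 := by rw [← Matrix.transpose_mul, hJJ, Matrix.transpose_one]
  set q : (𝕄 n) → (𝕄 n) → ℝ := fun R S => (R * P * Sᵀ * G (ψ w)).trace with hq
  set S : Fin n → Fin n → 𝕄 n := fun i d => ∑ c, J c i • curv G c d (ψ w) with hS
  have hcurv : ∀ i j, curv G' i j w = J⁻¹ * (∑ d, J d j • S i d) * J := by
    intro i j
    rw [h.curv_eq_conj hw, Finset.sum_comm]
    simp only [hS, Finset.smul_sum, smul_smul, mul_comm]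
    rfl
  have htr : ∀ i j a b, (curv G' i j w * P' * (curv G' a b w)ᵀ * G' w).trace =
      q (∑ d, J d j • S i d) (∑ d, J d b • S a d) := by
    intro i j a b
    rw [hcurv, hcurv, h.eq w hw, Matrix.transpose_mul, Matrix.transpose_mul, hq, ← hJ]
    generalize (∑ d, J d j • S i d) = X
    generalize (∑ d, J d b • S a d) = Y
    calc _ = (J⁻¹ * (X * (J * P' * Jᵀ) * Yᵀ * ((J⁻¹)ᵀ * Jᵀ) * G (ψ w) * J)).trace := by
          simp only [mul_assoc]
      _ = (X * P * Yᵀ * G (ψ w) * (J * J⁻¹)).trace := by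
          rw [hPP, hJJt, mul_one, Matrix.trace_mul_comm]; simp only [mul_assoc]
      _ = _ := by rw [hJJ, mul_one]
  have hbil : ∀ (x z : Fin n → ℝ) (X Z : Fin n → 𝕄 n),
      q (∑ d, x d • X d) (∑ d, z d • Z d) = ∑ d, ∑ f, x d * z f * q (X d) (Z f) := by
    intro x z X Z
    simp only [hq, Matrix.transpose_sum, Finset.sum_mul, Finset.mul_sum, Matrix.trace_sum,
      Matrix.transpose_smul, Matrix.smul_mul, Matrix.mul_smul, Matrix.trace_smul, smul_eq_mul]
    rw [Finset.sum_comm]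
    exact Finset.sum_congr rfl fun a _ => Finset.sum_congr rfl fun b _ => by ring
  have step1 : ∀ i a, ∑ j, ∑ b, P' j b * (curv G' i j w * P' * (curv G' a b w)ᵀ * G' w).trace
      = ∑ c, ∑ e, J c i * J e a *
        ∑ d, ∑ f, P d f * q (curv G c d (ψ w)) (curv G e f (ψ w)) := by
    intro i a
    simp only [htr, hbil]
    rw [contract_pull hPP fun d f => q (S i d) (S a f)]
    simp only [hS, hbil, Finset.mul_sum]
    calc _ = ∑ d, ∑ c, ∑ f, ∑ e, P d f * (J c i * J e a *
          q (curv G c d (ψ w)) (curv G e f (ψ w))) :=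
          Finset.sum_congr rfl fun d _ => Finset.sum_comm
      _ = ∑ c, ∑ d, ∑ e, ∑ f, P d f * (J c i * J e a *
          q (curv G c d (ψ w)) (curv G e f (ψ w))) := by
          rw [Finset.sum_comm]
          exact Finset.sum_congr rfl fun c _ => Finset.sum_congr rfl fun d _ => Finset.sum_comm
      _ = _ := by
          refine Finset.sum_congr rfl fun c _ => ?_
          rw [Finset.sum_comm]
          refine Finset.sum_congr rfl fun e _ => Finset.sum_congr rfl fun d _ =>
            Finset.sum_congr rfl fun f _ => by ring
  simp only [step1]
  exact contract_pull hPP _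

lemma scal_eq : scal G' w = scal G (ψ w) := by
  simp only [scal, h.ricci_eq hw]
  exact contract_pull (h.inv_eq hw) _

lemma gradInner_eq {f k : (𝔼 n) → ℝ} (hf : ContDiffAt ℝ ∞ f (ψ w))
    (hk : ContDiffAt ℝ ∞ k (ψ w)) :
    gradInner G' (fun z => f (ψ z)) (fun z => k (ψ z)) w = gradInner G f k (ψ w) := by
  have h1 := contract_pull (h.inv_eq hw) fun a b => pd a f (ψ w) * pd b k (ψ w)
  simp only [gradInner, mul_assoc]
  rw [← h1]
  refine Finset.sum_congr rfl fun i _ => Finset.sum_congr rfl fun j _ => ?_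
  rw [h.coord.pd_comp hw hf, h.coord.pd_comp hw hk, Finset.sum_mul_sum]
  congr 1
  exact Finset.sum_congr rfl fun a _ => Finset.sum_congr rfl fun b _ => by ring

/-- The derivative of the Jacobian appearing in ∂_i∂_j(f ∘ ψ) is cancelled by the inhomogeneous term
in the transformation law of Γ; the Hessian is then a tensor, and its trace is invariant. -/
lemma laplacian_eq {f : (𝔼 n) → ℝ} (hf : ∀ v ∈ V, ContDiffAt ℝ ∞ f v) :
    laplacian G' (fun z => f (ψ z)) w = laplacian G f (ψ w) := by
  have hV := h.coord.mapsTo w hw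
  have hsm := h.coord.smooth_jac hw
  have h1 := contract_pull (h.inv_eq hw)
    fun a b => pd a (pd b f) (ψ w) - ∑ k, christoffel G k a b (ψ w) * pd k f (ψ w)
  simp only [laplacian]
  rw [← h1]
  refine Finset.sum_congr rfl fun i _ => Finset.sum_congr rfl fun j _ => ?_
  congr 1
  have hfb : ∀ b, ContDiffAt ℝ ∞ (fun z => pd b f (ψ z)) w := fun b =>
    (contDiffAt_pd (hf _ hV)).comp w (h.coord.smooth w hw)
  have e1 : pd i (pd j fun z => f (ψ z)) w = ∑ b, (dM i (jac ψ) w b j * pd b f (ψ w)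
      + jac ψ w b j * ∑ a, jac ψ w a i * pd a (pd b f) (ψ w)) := by
    rw [pd_congr (h := fun z => ∑ b, jac ψ z b j * pd b f (ψ z))
      (by filter_upwards [h.coord.isOpen.mem_nhds hw] with z hz using
        h.coord.pd_comp hz (hf _ (h.coord.mapsTo z hz)) j),
      pd_sum Finset.univ (F := fun b z => jac ψ z b j * pd b f (ψ z)) fun b _ =>
        (hsm.diff b j).fun_mul ((hfb b).differentiableAt (by simp))]
    refine Finset.sum_congr rfl fun b _ => ?_
    rw [pd_mul (hsm.diff b j) ((hfb b).differentiableAt (by simp)),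
      h.coord.pd_comp hw (contDiffAt_pd (hf _ hV))]
    rfl
  have e2 : ∑ k, christoffel G' k i j w * pd k (fun z => f (ψ z)) w =
      ∑ b, (dM i (jac ψ) w b j + ∑ a, jac ψ w a i * ∑ c, christoffel G b a c (ψ w) * jac ψ w c j)
        * pd b f (ψ w) := by
    have := fun b => congrFun (congrFun (h.jac_mul_conn hw i) b) j
    simp only [Matrix.mul_apply, Matrix.add_apply, Matrix.sum_apply, Matrix.smul_apply, conn,
      Matrix.of_apply, smul_eq_mul] at this
    calc _ = ∑ b, (∑ k, jac ψ w b k * christoffel G' k i j w) * pd b f (ψ w) := by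
          simp only [h.coord.pd_comp hw (hf _ hV), Finset.mul_sum, Finset.sum_mul]
          rw [Finset.sum_comm]
          exact Finset.sum_congr rfl fun b _ => Finset.sum_congr rfl fun k _ => by ring
      _ = _ := by
          refine Finset.sum_congr rfl fun b _ => ?_
          rw [this b]
          congr 2
          simp only [Finset.sum_mul, Finset.mul_sum]
          rw [Finset.sum_comm]
          exact Finset.sum_congr rfl fun a _ => Finset.sum_congr rfl fun k _ => by ring
  rw [e1, e2, ← Finset.sum_sub_distrib]
  simp only [mul_sub, Finset.sum_sub_distrib, add_mul, Finset.mul_sum,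
    Finset.sum_mul, add_sub_add_left_eq_sub]
  congr 1
  · rw [Finset.sum_comm]
    exact Finset.sum_congr rfl fun a _ => Finset.sum_congr rfl fun b _ => by ring
  · calc _ = ∑ a, ∑ b, ∑ c, jac ψ w a i * (christoffel G b a c (ψ w) * jac ψ w c j)
            * pd b f (ψ w) := Finset.sum_comm
      _ = _ := by
          refine Finset.sum_congr rfl fun a _ => ?_
          rw [Finset.sum_comm]
          exact Finset.sum_congr rfl fun c _ => Finset.sum_congr rfl fun b _ => by ring

end IsPullback

end Coord

end

/-! ### Algebra of curvature tensors: the reaction terms -/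

noncomputable section

namespace CurvatureAlgebra

variable {κ : Type*} [Fintype κ]

/-- The sum over all values of four indices. -/
def S4 (f : κ → κ → κ → κ → ℝ) : ℝ := ∑ i, ∑ j, ∑ k, ∑ l, f i j k l

lemma S4_swap12 (f : κ → κ → κ → κ → ℝ) : S4 f = S4 fun i j k l => f j i k l :=
  Finset.sum_comm

lemma S4_swap23 (f : κ → κ → κ → κ → ℝ) : S4 f = S4 fun i j k l => f i k j l :=
  Finset.sum_congr rfl fun _ _ => Finset.sum_comm

lemma S4_swap34 (f : κ → κ → κ → κ → ℝ) : S4 f = S4 fun i j k l => f i j l k :=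
  Finset.sum_congr rfl fun _ _ => Finset.sum_congr rfl fun _ _ => Finset.sum_comm

lemma S4_swap_pairs (f : κ → κ → κ → κ → ℝ) : S4 f = S4 fun i j k l => f k l i j := by
  rw [S4_swap23, S4_swap12, S4_swap34, S4_swap23]

lemma S4_add (f h : κ → κ → κ → κ → ℝ) : S4 (fun i j k l => f i j k l + h i j k l) = S4 f + S4 h := by
  simp only [S4, Finset.sum_add_distrib]

lemma S4_sub (f h : κ → κ → κ → κ → ℝ) : S4 (fun i j k l => f i j k l - h i j k l) = S4 f - S4 h := by
  simp only [S4, Finset.sum_sub_distrib]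

lemma S4_neg (f : κ → κ → κ → κ → ℝ) : S4 (fun i j k l => - f i j k l) = - S4 f := by
  simp only [S4, Finset.sum_neg_distrib]

lemma S4_congr {f h : κ → κ → κ → κ → ℝ} (e : ∀ i j k l, f i j k l = h i j k l) : S4 f = S4 h := by
  simp only [S4, e]

lemma S4_nonneg {f : κ → κ → κ → κ → ℝ} (e : ∀ i j k l, 0 ≤ f i j k l) : 0 ≤ S4 f :=
  Finset.sum_nonneg fun i _ => Finset.sum_nonneg fun j _ => Finset.sum_nonneg fun k _ =>
    Finset.sum_nonneg fun l _ => e i j k l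

lemma S4_sum {s : Finset κ} (f : κ → κ → κ → κ → κ → ℝ) :
    ∑ p ∈ s, S4 (f p) = S4 fun i j k l => ∑ p ∈ s, f p i j k l := by
  simp only [S4]
  rw [Finset.sum_comm]
  refine Finset.sum_congr rfl fun i _ => ?_
  rw [Finset.sum_comm]
  refine Finset.sum_congr rfl fun j _ => ?_
  rw [Finset.sum_comm]
  exact Finset.sum_congr rfl fun k _ => Finset.sum_comm

lemma S4_eq_prod (f : κ → κ → κ → κ → ℝ) :
    S4 f = ∑ x : (κ × κ) × (κ × κ), f x.1.1 x.1.2 x.2.1 x.2.2 := by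
  simp only [S4, Fintype.sum_prod_type]

lemma S4_mul_sq_le (f h : κ → κ → κ → κ → ℝ) : S4 (fun i j k l => f i j k l * h i j k l) ^ 2 ≤
    S4 (fun i j k l => f i j k l ^ 2) * S4 (fun i j k l => h i j k l ^ 2) := by
  simp only [S4_eq_prod]
  exact Finset.sum_mul_sq_le_sq_mul_sq _ _ _

/-- Cauchy–Schwarz twice for matrices: ⟨A, B Dᵀ⟩ ≤ |A| |B Dᵀ| and |B Dᵀ| ≤ |B| |D|. -/
lemma sum_triple_sq_le {α β γ : Type*} [Fintype α] [Fintype β] [Fintype γ]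
    (A : α → β → ℝ) (B : α → γ → ℝ) (D : β → γ → ℝ) :
    (∑ a, ∑ b, A a b * ∑ c, B a c * D b c) ^ 2 ≤
      (∑ a, ∑ b, A a b ^ 2) * ((∑ a, ∑ c, B a c ^ 2) * ∑ b, ∑ c, D b c ^ 2) := by
  have h1 := Finset.sum_mul_sq_le_sq_mul_sq (Finset.univ : Finset (α × β))
    (fun x => A x.1 x.2) fun x => ∑ c, B x.1 c * D x.2 c
  simp only [Fintype.sum_prod_type] at h1
  refine h1.trans (mul_le_mul_of_nonneg_left ?_ (Finset.sum_nonneg fun a _ =>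
    Finset.sum_nonneg fun b _ => sq_nonneg _))
  rw [Finset.sum_mul_sum]
  exact Finset.sum_le_sum fun a _ => Finset.sum_le_sum fun b _ =>
    Finset.sum_mul_sq_le_sq_mul_sq _ _ _

/-- Pairs of indices are treated as single matrix indices, so a full contraction of three 4-tensors
along pairs is bounded by the product of their norms. -/
lemma S4_triple_sq_le (A B D : κ → κ → κ → κ → ℝ) :
    S4 (fun i j k l => A i j k l * ∑ p, ∑ s, B i j p s * D k l p s) ^ 2 ≤
      S4 (fun i j k l => A i j k l ^ 2) * (S4 (fun i j k l => B i j k l ^ 2) *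
        S4 (fun i j k l => D i j k l ^ 2)) := by
  have := sum_triple_sq_le (fun a b : κ × κ => A a.1 a.2 b.1 b.2)
    (fun a b : κ × κ => B a.1 a.2 b.1 b.2) (fun a b : κ × κ => D a.1 a.2 b.1 b.2)
  simpa only [Fintype.sum_prod_type, S4] using this

/-- The algebraic symmetries of the curvature tensor `R_{ijkl}`. -/
structure CurvLike (R : κ → κ → κ → κ → ℝ) : Prop where
  swap12 : ∀ i j k l, R j i k l = - R i j k l
  swap34 : ∀ i j k l, R i j l k = - R i j k l
  bianchi : ∀ i j k l, R i j k l + R j k i l + R k i j l = 0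

/-- The classical octahedron argument: combine the four cyclic identities for (i,j,k,l) with the two
skew-symmetries. -/
lemma CurvLike.pair {κ : Type*} {R : κ → κ → κ → κ → ℝ} (h : CurvLike R) (i j k l : κ) :
    R i j k l = R k l i j := by
  have b1 := h.bianchi i j k l
  have b2 := h.bianchi j k l i
  have b3 := h.bianchi k l i j
  have b4 := h.bianchi l i j k
  have e1 := h.swap34 j k i l
  have e2 := h.swap34 k i j l
  have e3 := h.swap34 i j k l
  have e4 := h.swap34 k l i j
  have e5 := h.swap34 l i j k
  have e6 := h.swap34 j l k i
  have f1 := h.swap12 i l k j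
  have f2 := h.swap12 l j k i
  have f3 := h.swap12 l j i k
  have f4 := h.swap12 k i j l
  have f5 := h.swap12 k i l j
  have f6 := h.swap34 i l j k
  linarith

/-- The Ricci contraction in the last four indices of a second derivative of the curvature. -/
def ric2 (DD : κ → κ → κ → κ → κ → κ → ℝ) (p i j k : κ) : ℝ := ∑ m, DD p i m j k m

/-- The time derivative of `R_{ijk}^l` under Ricci flow. -/
def dtR (DD : κ → κ → κ → κ → κ → κ → ℝ) (i j k l : κ) : ℝ :=
  -(ric2 DD i j k l + ric2 DD i k j l - ric2 DD i l j k)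
    + (ric2 DD j i k l + ric2 DD j k i l - ric2 DD j l i k)

/-- The Ricci contraction. -/
def ric (R : κ → κ → κ → κ → ℝ) (j k : κ) : ℝ := ∑ m, R m j k m

/-- The contribution of the time derivative of the metric to that of `|Rm|²`. -/
def ricTerm (R : κ → κ → κ → κ → ℝ) : ℝ :=
  S4 fun i j k l => ∑ s, (ric R i s * R i j k l * R s j k l + ric R j s * R i j k l * R i s k l
    + ric R k s * R i j k l * R i j s l - ric R l s * R i j k l * R i j k s)

variable {R : κ → κ → κ → κ → ℝ} {DD : κ → κ → κ → κ → κ → κ → ℝ}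

lemma CurvLike.ric_symm (hR : CurvLike R) (j k : κ) : ric R j k = ric R k j := by
  refine Finset.sum_congr rfl fun m _ => ?_
  rw [hR.pair, hR.swap12, hR.swap34, neg_neg]

lemma ric2_symm (hD : ∀ p q, CurvLike (DD p q)) (p i j k : κ) :
    ric2 DD p i j k = ric2 DD p i k j := (hD p i).ric_symm j k

lemma S4_mul_ric2_swap (hR : CurvLike R) :
    S4 (fun i j k l => R i j k l * ric2 DD i l j k)
      = - S4 fun i j k l => R i j k l * ric2 DD i k j l := by
  rw [S4_swap34, ← S4_neg]; exact S4_congr fun i j k l => by rw [hR.swap34]; ring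

/-- Of the six terms of `dtR`, the two containing the Hessian of R_{kl} are symmetric in k, l and
vanish against R_{ijkl}. The other four become equal after renaming indices and using the
skew-symmetries. -/
lemma S4_mul_dtR (hR : CurvLike R) (hD : ∀ p q, CurvLike (DD p q)) :
    S4 (fun i j k l => R i j k l * dtR DD i j k l)
      = -4 * S4 fun i j k l => R i j k l * ric2 DD i k j l := by
  have e1 : S4 (fun i j k l => R i j k l * ric2 DD j i k l)
      = - S4 fun i j k l => R i j k l * ric2 DD i j k l := by
    rw [S4_swap12, ← S4_neg]; exact S4_congr fun i j k l => by rw [hR.swap12]; ring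
  have e2 : S4 (fun i j k l => R i j k l * ric2 DD j k i l)
      = - S4 fun i j k l => R i j k l * ric2 DD i k j l := by
    rw [S4_swap12, ← S4_neg]; exact S4_congr fun i j k l => by rw [hR.swap12]; ring
  have e3 : S4 (fun i j k l => R i j k l * ric2 DD j l i k)
      = S4 fun i j k l => R i j k l * ric2 DD i k j l := by
    rw [S4_swap12, S4_swap34]
    exact S4_congr fun i j k l => by rw [hR.swap12, hR.swap34]; ring
  have e5 : S4 (fun i j k l => R i j k l * ric2 DD i j k l)
      = - S4 fun i j k l => R i j k l * ric2 DD i j k l := by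
    conv_lhs => rw [S4_swap34]
    rw [← S4_neg]
    exact S4_congr fun i j k l => by rw [hR.swap34, ric2_symm hD]; ring
  have e : S4 (fun i j k l => R i j k l * dtR DD i j k l) =
      -(S4 (fun i j k l => R i j k l * ric2 DD i j k l)
        + S4 (fun i j k l => R i j k l * ric2 DD i k j l)
        - S4 (fun i j k l => R i j k l * ric2 DD i l j k))
      + (S4 (fun i j k l => R i j k l * ric2 DD j i k l)
        + S4 (fun i j k l => R i j k l * ric2 DD j k i l)
        - S4 (fun i j k l => R i j k l * ric2 DD j l i k)) := by
    rw [← S4_add, ← S4_sub, ← S4_neg, ← S4_add, ← S4_sub, ← S4_add]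
    exact S4_congr fun i j k l => by simp only [dtR]; ring
  rw [e, e1, e2, e3, S4_mul_ric2_swap hR]
  linarith

/-- The pair symmetry and skew-symmetries make the contraction of Ric into each of the four slots
the same. Three slots are contracted with the inverse metric and one with the metric, whence 3 − 1 =
2. -/
lemma ricTerm_eq (hR : CurvLike R) :
    ricTerm R = 2 * S4 fun i j k l => ∑ s, ric R i s * R i j k l * R s j k l := by
  have e2 : S4 (fun i j k l => ∑ s, ric R j s * R i j k l * R i s k l)
      = S4 fun i j k l => ∑ s, ric R i s * R i j k l * R s j k l := by
    rw [S4_swap12]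
    exact S4_congr fun i j k l => Finset.sum_congr rfl fun s _ => by
      rw [hR.swap12 i j, hR.swap12 s j]; ring
  have e3 : S4 (fun i j k l => ∑ s, ric R k s * R i j k l * R i j s l)
      = S4 fun i j k l => ∑ s, ric R i s * R i j k l * R s j k l := by
    rw [S4_swap_pairs]
    exact S4_congr fun i j k l => Finset.sum_congr rfl fun s _ => by
      rw [hR.pair k l i j, hR.pair k l s j]
  have e4 : S4 (fun i j k l => ∑ s, ric R l s * R i j k l * R i j k s)
      = S4 fun i j k l => ∑ s, ric R i s * R i j k l * R s j k l := by
    rw [← e3, S4_swap34]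
    exact S4_congr fun i j k l => Finset.sum_congr rfl fun s _ => by
      rw [hR.swap34 i j k l, hR.swap34 i j s l]; ring
  have e : ricTerm R = S4 (fun i j k l => ∑ s, ric R i s * R i j k l * R s j k l)
      + S4 (fun i j k l => ∑ s, ric R j s * R i j k l * R i s k l)
      + S4 (fun i j k l => ∑ s, ric R k s * R i j k l * R i j s l)
      - S4 (fun i j k l => ∑ s, ric R l s * R i j k l * R i j k s) := by
    rw [← S4_add, ← S4_add, ← S4_sub]
    exact S4_congr fun i j k l => by
      simp only [Finset.sum_add_distrib, Finset.sum_sub_distrib]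
  rw [e, e2, e3, e4]; ring

/-- The contracted commutator of covariant derivatives applied to the curvature. -/
def commTerm (R : κ → κ → κ → κ → ℝ) (p q j m k l : κ) : ℝ :=
  ∑ s, (R p q s l * R j m k s - R p q j s * R s m k l - R p q m s * R j s k l
    - R p q k s * R j m s l)

/-- The second Bianchi identity rewrites ∇_p∇_p R_{ijkl} as two terms with equal pairing against R,
namely ∇_p∇_i R_{jpkl} and its mirror image. Commuting ∇_p past ∇_i and using the contracted Bianchi
identity leaves ∇_i(∇_k R_{jl} − ∇_l R_{jk}) and a commutator. -/
lemma S4_mul_laplacian (hR : CurvLike R) (hD : ∀ p q, CurvLike (DD p q))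
    (hB : ∀ r p i j k l, DD r p i j k l + DD r i j p k l + DD r j p i k l = 0)
    (hC : ∀ p q j m k l, DD p q j m k l - DD q p j m k l = commTerm R p q j m k l) :
    ∑ p, S4 (fun i j k l => R i j k l * DD p p i j k l)
      = -4 * S4 (fun i j k l => R i j k l * ric2 DD i k j l)
        - 2 * S4 fun i j k l => R i j k l * ∑ p, commTerm R p i j p k l := by
  have e1 : ∀ p, S4 (fun i j k l => R i j k l * DD p p i j k l)
      = -2 * S4 fun i j k l => R i j k l * DD p i j p k l := by
    intro p
    have h1 : S4 (fun i j k l => R i j k l * DD p j p i k l)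
        = S4 fun i j k l => R i j k l * DD p i j p k l := by
      rw [S4_swap12]
      exact S4_congr fun i j k l => by rw [hR.swap12, (hD p i).swap12]; ring
    have h2 : S4 (fun i j k l => R i j k l * DD p p i j k l)
        = -(S4 (fun i j k l => R i j k l * DD p i j p k l)
          + S4 (fun i j k l => R i j k l * DD p j p i k l)) := by
      rw [← S4_add, ← S4_neg]
      refine S4_congr fun i j k l => ?_
      have := hB p p i j k l
      rw [show DD p p i j k l = -(DD p i j p k l + DD p j p i k l) by linarith]; ring
    rw [h2, h1]; ring
  have e2 : ∀ i j k l, ∑ p, DD p i j p k l =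
      ric2 DD i k j l - ric2 DD i l j k + ∑ p, commTerm R p i j p k l := by
    intro i j k l
    rw [ric2_symm hD i k, ric2_symm hD i l]
    simp only [ric2, ← Finset.sum_sub_distrib, ← Finset.sum_add_distrib]
    refine Finset.sum_congr rfl fun p _ => ?_
    have h1 := hC p i j p k l
    have h2 := (hD i p).pair j p k l
    have h3 := hB i p k l j p
    have h4 := (hD i k).swap12 p l j p
    linarith
  simp only [e1]
  rw [← Finset.mul_sum, S4_sum]
  have e3 : S4 (fun i j k l => ∑ p, R i j k l * DD p i j p k l) =
      S4 (fun i j k l => R i j k l * ric2 DD i k j l)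
        - S4 (fun i j k l => R i j k l * ric2 DD i l j k)
        + S4 fun i j k l => R i j k l * ∑ p, commTerm R p i j p k l := by
    rw [← S4_sub, ← S4_add]
    exact S4_congr fun i j k l => by rw [← Finset.mul_sum, e2]; ring
  rw [e3, S4_mul_ric2_swap hR]
  ring

lemma abs_le_mul_sqrt {u v : ℝ} (hu : 0 ≤ u) (h : v ^ 2 ≤ u * (u * u)) : |v| ≤ u * √u := by
  refine abs_le_of_sq_le_sq (h.trans_eq ?_) (mul_nonneg hu (Real.sqrt_nonneg _))
  rw [mul_pow, Real.sq_sqrt hu]; ring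

/-- One of the four terms of the commutator is a trace R_{pips} = −R_{is}, which cancels the Ricci
sum on the left. Each of the other three is a triple contraction bounded by |Rm|³. -/
lemma S4_mul_commTerm_le (hR : CurvLike R) :
    (S4 fun i j k l => R i j k l * ∑ p, commTerm R p i j p k l)
      + (S4 fun i j k l => ∑ s, ric R i s * R i j k l * R s j k l)
      ≤ 3 * (S4 (fun i j k l => R i j k l ^ 2) * √(S4 fun i j k l => R i j k l ^ 2)) := by
  set f : κ → κ → κ → κ → ℝ := fun i j k l => R i j k l ^ 2 with hf
  have hu : 0 ≤ S4 f := S4_nonneg fun i j k l => sq_nonneg _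
  have p23 : S4 (fun i j k l => f i k j l) = S4 f := by conv_rhs => rw [S4_swap23 f]
  have p342 : S4 (fun i j k l => f i k l j) = S4 f := by conv_rhs => rw [S4_swap34 f, S4_swap23]
  have p13 : S4 (fun i j k l => f k i l j) = S4 f := by conv_rhs => rw [S4_swap12 f, S4_swap34, S4_swap23]
  have p12 : S4 (fun i j k l => f k i j l) = S4 f := by conv_rhs => rw [S4_swap12 f, S4_swap23]
  have pp : S4 (fun i j k l => f l k i j) = S4 f := by conv_rhs => rw [S4_swap_pairs f, S4_swap34]
  have b1 : |S4 fun i j k l => R i j k l * ∑ p, ∑ s, R p i s l * R j p k s| ≤ S4 f * √(S4 f) := by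
    refine abs_le_mul_sqrt hu ?_
    rw [S4_swap34, S4_swap23]
    have := S4_triple_sq_le (fun i l j k => R i j k l) (fun i l p s => R p i s l)
      fun j k p s => R j p k s
    rwa [show S4 (fun i l j k => R i j k l ^ 2) = S4 f from p342,
      show S4 (fun i l p s => R p i s l ^ 2) = S4 f from p13,
      show S4 (fun j k p s => R j p k s ^ 2) = S4 f from p23] at this
  have b2 : |S4 fun i j k l => R i j k l * ∑ p, ∑ s, R p i j s * R s p k l| ≤ S4 f * √(S4 f) := by
    refine abs_le_mul_sqrt hu ?_
    have := S4_triple_sq_le (fun i j k l => R i j k l) (fun i j p s => R p i j s)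
      fun k l p s => R s p k l
    rwa [show S4 (fun i j p s => R p i j s ^ 2) = S4 f from p12,
      show S4 (fun k l p s => R s p k l ^ 2) = S4 f from pp] at this
  have b4 : |S4 fun i j k l => R i j k l * ∑ p, ∑ s, R p i k s * R j p s l| ≤ S4 f * √(S4 f) := by
    refine abs_le_mul_sqrt hu ?_
    rw [S4_swap23]
    have := S4_triple_sq_le (fun i k j l => R i j k l) (fun i k p s => R p i k s)
      fun j l p s => R j p s l
    rwa [show S4 (fun i k j l => R i j k l ^ 2) = S4 f from p23,
      show S4 (fun i k p s => R p i k s ^ 2) = S4 f from p12,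
      show S4 (fun j l p s => R j p s l ^ 2) = S4 f from p342] at this
  have e3 : ∀ i j k l, ∑ p, ∑ s, R p i p s * R j s k l = ∑ s, ric R i s * R s j k l := by
    intro i j k l
    rw [Finset.sum_comm]
    refine Finset.sum_congr rfl fun s _ => ?_
    rw [ric, Finset.sum_mul]
    refine Finset.sum_congr rfl fun p _ => ?_
    rw [hR.swap34 p i s p, hR.swap12 s j]; ring
  have e : (S4 fun i j k l => R i j k l * ∑ p, commTerm R p i j p k l)
      + (S4 fun i j k l => ∑ s, ric R i s * R i j k l * R s j k l)
      = (S4 fun i j k l => R i j k l * ∑ p, ∑ s, R p i s l * R j p k s)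
      - (S4 fun i j k l => R i j k l * ∑ p, ∑ s, R p i j s * R s p k l)
      - S4 fun i j k l => R i j k l * ∑ p, ∑ s, R p i k s * R j p s l := by
    rw [← S4_add, ← S4_sub, ← S4_sub]
    refine S4_congr fun i j k l => ?_
    simp only [commTerm, Finset.sum_sub_distrib, e3]
    have : ∑ s, ric R i s * R i j k l * R s j k l = R i j k l * ∑ s, ric R i s * R s j k l := by
      rw [Finset.mul_sum]; exact Finset.sum_congr rfl fun s _ => by ring
    rw [this]; ring
  rw [e]
  linarith [(abs_le.1 b1).2, (abs_le.1 b2).1, (abs_le.1 b4).1]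

/-- The reaction terms in the evolution of `|Rm|²` under Ricci flow are bounded by `16 |Rm|³`. -/
theorem evolution_le (hR : CurvLike R) (hD : ∀ p q, CurvLike (DD p q))
    (hB : ∀ r p i j k l, DD r p i j k l + DD r i j p k l + DD r j p i k l = 0)
    (hC : ∀ p q j m k l, DD p q j m k l - DD q p j m k l = commTerm R p q j m k l) :
    2 * S4 (fun i j k l => R i j k l * dtR DD i j k l) + 2 * ricTerm R ≤
      2 * ∑ p, S4 (fun i j k l => R i j k l * DD p p i j k l)
      + 16 * (S4 (fun i j k l => R i j k l ^ 2) * √(S4 fun i j k l => R i j k l ^ 2)) := by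
  have h0 : 0 ≤ S4 (fun i j k l => R i j k l ^ 2) * √(S4 fun i j k l => R i j k l ^ 2) :=
    mul_nonneg (S4_nonneg fun i j k l => sq_nonneg _) (Real.sqrt_nonneg _)
  rw [S4_mul_dtR hR hD, ricTerm_eq hR, S4_mul_laplacian hR hD hB hC]
  -- The terms ∇∇Ric cancel and four times the previous bound remains, that is 12|Rm|³; the constant
  -- 16 leaves room to spare.
  linarith [S4_mul_commTerm_le hR]

end CurvatureAlgebra

end

/-! ### Smoothness in space and time, and Ricci flows in coordinates -/

noncomputable section

namespace Coord

open scoped Matrix Topology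

variable {n : ℕ}

local notation "𝔼" n => EuclideanSpace ℝ (Fin n)
local notation "𝕄" n => Matrix (Fin n) (Fin n) ℝ

/-- `F` is smooth in space and time on `[0,T] × V`. -/
def TS (T : ℝ) (V : Set (𝔼 n)) (F : ℝ → (𝔼 n) → ℝ) : Prop :=
  ContDiffOn ℝ ∞ (fun z : ℝ × (𝔼 n) => F z.1 z.2) (Icc 0 T ×ˢ V)

/-- The time derivative on `[0,T]`, one-sided at the end points. -/
def dt (T : ℝ) (F : ℝ → (𝔼 n) → ℝ) (t : ℝ) (y : 𝔼 n) : ℝ :=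
  derivWithin (fun s => F s y) (Icc 0 T) t

namespace TS

variable {T : ℝ} {V : Set (𝔼 n)} {F H : ℝ → (𝔼 n) → ℝ}

lemma add (hF : TS T V F) (hH : TS T V H) : TS T V fun t y => F t y + H t y :=
  ContDiffOn.add hF hH

lemma sub (hF : TS T V F) (hH : TS T V H) : TS T V fun t y => F t y - H t y :=
  ContDiffOn.sub hF hH

lemma mul (hF : TS T V F) (hH : TS T V H) : TS T V fun t y => F t y * H t y :=
  ContDiffOn.mul hF hH

lemma const (c : ℝ) : TS T V fun _ _ => c := contDiffOn_const

lemma sum {κ : Type*} {s : Finset κ} {F : κ → ℝ → (𝔼 n) → ℝ} (hF : ∀ k ∈ s, TS T V (F k)) :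
    TS T V fun t y => ∑ k ∈ s, F k t y := ContDiffOn.sum hF

lemma congr (hF : TS T V F) (h : ∀ t ∈ Icc 0 T, ∀ y ∈ V, H t y = F t y) : TS T V H :=
  ContDiffOn.congr hF fun z hz => h z.1 hz.1 z.2 hz.2

lemma comp {W : Set (𝔼 n)} {ψ : (𝔼 n) → 𝔼 n} (hF : TS T V F) (hψ : ContDiffOn ℝ ∞ ψ W)
    (h : MapsTo ψ W V) : TS T W fun t w => F t (ψ w) := by
  refine ContDiffOn.comp (g := fun z : ℝ × (𝔼 n) => F z.1 z.2)
    (f := fun z : ℝ × (𝔼 n) => (z.1, ψ z.2)) hF ?_ ?_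
  · exact contDiffOn_fst.prodMk (hψ.comp contDiffOn_snd fun z hz => hz.2)
  · exact fun z hz => ⟨hz.1, h hz.2⟩

lemma of_space {f : (𝔼 n) → ℝ} (hf : ContDiffOn ℝ ∞ f V) : TS T V fun _ y => f y :=
  hf.comp contDiffOn_snd fun _ hz => hz.2

variable (hT : 0 < T) (hV : IsOpen V)

lemma uniqueDiffOn (hT : 0 < T) (hV : IsOpen V) : UniqueDiffOn ℝ (Icc 0 T ×ˢ V) :=
  (uniqueDiffOn_Icc hT).prod hV.uniqueDiffOn

variable {t : ℝ} (ht : t ∈ Icc 0 T) {y : 𝔼 n} (hy : y ∈ V)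

include hV ht hy in
lemma contDiffAt (hF : TS T V F) : ContDiffAt ℝ ∞ (F t) y := by
  have : ContDiffOn ℝ ∞ (F t) V := ContDiffOn.comp (g := fun z : ℝ × (𝔼 n) => F z.1 z.2)
    (f := fun z : 𝔼 n => (t, z)) hF (by fun_prop) fun z hz => ⟨ht, hz⟩
  exact this.contDiffAt (hV.mem_nhds hy)

include hV ht hy in
-- Restricting to a time slice, which is open in space, recovers genuine partial derivatives from
-- the derivative within the slab, also at t = 0 and t = T.
lemma pd_of_hasFDerivWithinAt {L : ℝ × (𝔼 n) →L[ℝ] ℝ}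
    (hF : HasFDerivWithinAt (fun z : ℝ × (𝔼 n) => F z.1 z.2) L (Icc 0 T ×ˢ V) (t, y)) (i : Fin n) :
    pd i (F t) y = L (0, EuclideanSpace.single i 1) := by
  have h1 : HasFDerivAt (fun z : 𝔼 n => (t, z)) (ContinuousLinearMap.inr ℝ ℝ (𝔼 n)) y :=
    hasFDerivAt_prodMk_right t y
  have h2 : HasFDerivWithinAt (F t) (L.comp (ContinuousLinearMap.inr ℝ ℝ (𝔼 n))) V y :=
    HasFDerivWithinAt.comp (g := fun z : ℝ × (𝔼 n) => F z.1 z.2) y hF h1.hasFDerivWithinAt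
      fun z hz => ⟨ht, hz⟩
  rw [pd, (h2.hasFDerivAt (hV.mem_nhds hy)).fderiv]
  simp

include hy in
lemma hasDerivWithinAt_of_hasFDerivWithinAt {L : ℝ × (𝔼 n) →L[ℝ] ℝ}
    (hF : HasFDerivWithinAt (fun z : ℝ × (𝔼 n) => F z.1 z.2) L (Icc 0 T ×ˢ V) (t, y)) :
    HasDerivWithinAt (fun s => F s y) (L (1, 0)) (Icc 0 T) t := by
  have h1 : HasFDerivAt (fun s : ℝ => (s, y)) (ContinuousLinearMap.inl ℝ ℝ (𝔼 n)) t :=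
    hasFDerivAt_prodMk_left t y
  have h2 : HasFDerivWithinAt (fun s => F s y) (L.comp (ContinuousLinearMap.inl ℝ ℝ (𝔼 n)))
      (Icc 0 T) t :=
    HasFDerivWithinAt.comp (g := fun z : ℝ × (𝔼 n) => F z.1 z.2) t hF h1.hasFDerivWithinAt
      (show MapsTo (fun s : ℝ => (s, y)) (Icc 0 T) (Icc 0 T ×ˢ V) from fun s hs => ⟨hs, hy⟩)
  exact h2.hasDerivWithinAt.congr_deriv (by simp)

include ht hy in
lemma hasFDerivWithinAt (hF : TS T V F) :
    HasFDerivWithinAt (fun z : ℝ × (𝔼 n) => F z.1 z.2)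
      (fderivWithin ℝ (fun z : ℝ × (𝔼 n) => F z.1 z.2) (Icc 0 T ×ˢ V) (t, y))
      (Icc 0 T ×ˢ V) (t, y) :=
  (hF.differentiableOn (by simp) (t, y) ⟨ht, hy⟩).hasFDerivWithinAt

include hT ht hy in
lemma dt_of_hasFDerivWithinAt {L : ℝ × (𝔼 n) →L[ℝ] ℝ}
    (hF : HasFDerivWithinAt (fun z : ℝ × (𝔼 n) => F z.1 z.2) L (Icc 0 T ×ˢ V) (t, y)) :
    dt T F t y = L (1, 0) :=
  (hasDerivWithinAt_of_hasFDerivWithinAt hy hF).derivWithin (uniqueDiffOn_Icc hT t ht)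

include ht hy in
lemma hasDerivWithinAt (hF : TS T V F) :
    HasDerivWithinAt (fun s => F s y) (dt T F t y) (Icc 0 T) t :=
  (hasDerivWithinAt_of_hasFDerivWithinAt hy
    (hF.hasFDerivWithinAt ht hy)).differentiableWithinAt.hasDerivWithinAt

include hT hV in
lemma contDiffOn_fderivWithin (hF : TS T V F) :
    ContDiffOn ℝ ∞ (fderivWithin ℝ (fun z : ℝ × (𝔼 n) => F z.1 z.2) (Icc 0 T ×ˢ V))
      (Icc 0 T ×ˢ V) :=
  ContDiffOn.fderivWithin hF (uniqueDiffOn hT hV) (by simp)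

include hT hV in
lemma pd (hF : TS T V F) (i : Fin n) : TS T V fun t => pd i (F t) := by
  have h : TS T V fun t y => fderivWithin ℝ (fun z : ℝ × (𝔼 n) => F z.1 z.2) (Icc 0 T ×ˢ V) (t, y)
      (0, EuclideanSpace.single i 1) :=
    (hF.contDiffOn_fderivWithin hT hV).clm_apply contDiffOn_const
  exact h.congr fun t ht y hy => pd_of_hasFDerivWithinAt hV ht hy (hF.hasFDerivWithinAt ht hy) i

include hT hV in
lemma dt (hF : TS T V F) : TS T V (dt T F) := by
  have h : TS T V fun t y => fderivWithin ℝ (fun z : ℝ × (𝔼 n) => F z.1 z.2) (Icc 0 T ×ˢ V) (t, y)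
      (1, 0) :=
    (hF.contDiffOn_fderivWithin hT hV).clm_apply contDiffOn_const
  exact h.congr fun t ht y hy => dt_of_hasFDerivWithinAt hT ht hy (hF.hasFDerivWithinAt ht hy)

include hT hV ht hy in
-- Symmetry of the second derivative within the slab [0,T] × V, applied to a time and a space
-- direction. It holds up to the end times because the slab is contained in the closure of its
-- interior.
lemma dt_pd (hF : TS T V F) (i : Fin n) :
    Coord.dt T (fun s => Coord.pd i (F s)) t y = Coord.pd i (Coord.dt T F t) y := by
  set D := fderivWithin ℝ (fun z : ℝ × (𝔼 n) => F z.1 z.2) (Icc 0 T ×ˢ V) with hD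
  have hDs : ContDiffOn ℝ ∞ D (Icc 0 T ×ˢ V) := hF.contDiffOn_fderivWithin hT hV
  have hDd : HasFDerivWithinAt D (fderivWithin ℝ D (Icc 0 T ×ˢ V) (t, y)) (Icc 0 T ×ˢ V) (t, y) :=
    (hDs.differentiableOn (by simp) (t, y) ⟨ht, hy⟩).hasFDerivWithinAt
  have happ : ∀ v : ℝ × (𝔼 n), HasFDerivWithinAt (fun z : ℝ × (𝔼 n) => D (z.1, z.2) v)
      ((fderivWithin ℝ D (Icc 0 T ×ˢ V) (t, y)).flip v) (Icc 0 T ×ˢ V) (t, y) := by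
    intro v
    have := hDd.clm_apply (hasFDerivWithinAt_const v (t, y) (Icc 0 T ×ˢ V))
    simpa using this
  have hsymm : IsSymmSndFDerivWithinAt ℝ (fun z : ℝ × (𝔼 n) => F z.1 z.2) (Icc 0 T ×ˢ V) (t, y) := by
    refine ContDiffWithinAt.isSymmSndFDerivWithinAt (hF (t, y) ⟨ht, hy⟩)
      (by simp only [minSmoothness_of_isRCLikeNormedField]; exact WithTop.coe_le_coe.2 le_top)
      (uniqueDiffOn hT hV) ?_ ⟨ht, hy⟩
    rw [interior_prod_eq, hV.interior_eq, interior_Icc, closure_prod_eq, closure_Ioo hT.ne]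
    exact ⟨ht, subset_closure hy⟩
  have e1 : Coord.dt T (fun s => Coord.pd i (F s)) t y =
      Coord.dt T (fun s y => D (s, y) (0, EuclideanSpace.single i 1)) t y := by
    refine derivWithin_congr (fun s hs => ?_) ?_
    · exact pd_of_hasFDerivWithinAt hV hs hy (hF.hasFDerivWithinAt hs hy) i
    · exact pd_of_hasFDerivWithinAt hV ht hy (hF.hasFDerivWithinAt ht hy) i
  have e2 : Coord.pd i (Coord.dt T F t) y = Coord.pd i (fun y => D (t, y) (1, 0)) y := by
    refine pd_congr ?_
    filter_upwards [hV.mem_nhds hy] with z hz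
    exact dt_of_hasFDerivWithinAt hT ht hz (hF.hasFDerivWithinAt ht hz)
  rw [e1, e2, dt_of_hasFDerivWithinAt hT ht hy (happ _),
    pd_of_hasFDerivWithinAt (F := fun s y => D (s, y) (1, 0)) hV ht hy (happ _) i]
  exact hsymm.eq _ _

end TS

/-- Smoothness in space and time of a time dependent matrix field. -/
def TSM (T : ℝ) (V : Set (𝔼 n)) (F : ℝ → (𝔼 n) → 𝕄 n) : Prop :=
  ∀ k l, TS T V fun t y => F t y k l

/-- The entrywise time derivative of a matrix field. -/
def dtM (T : ℝ) (F : ℝ → (𝔼 n) → 𝕄 n) (t : ℝ) (y : 𝔼 n) : 𝕄 n :=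
  Matrix.of fun k l => dt T (fun s z => F s z k l) t y

lemma TSM.inv {T : ℝ} {V : Set (𝔼 n)} {F : ℝ → (𝔼 n) → 𝕄 n} (hF : TSM T V F)
    (h : ∀ t ∈ Icc 0 T, ∀ y ∈ V, (F t y).det ≠ 0) : TSM T V fun t y => (F t y)⁻¹ := by
  intro k l z hz
  exact contDiffWithinAt_inv (F := fun z : ℝ × (𝔼 n) => F z.1 z.2)
    (fun k l => hF k l z hz) (h z.1 hz.1 z.2 hz.2) k l

lemma TSM.det {T : ℝ} {V : Set (𝔼 n)} {F : ℝ → (𝔼 n) → 𝕄 n} (hF : TSM T V F) :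
    TS T V fun t y => (F t y).det := by
  intro z hz
  exact contDiffWithinAt_det (F := fun z : ℝ × (𝔼 n) => F z.1 z.2) (fun k l => hF k l z hz)

/-- A Ricci flow `g_{ij}(t)`, `t ∈ [0,T]`, on the open set `V` of `ℝⁿ`. -/
structure IsCoordFlow (G : ℝ → (𝔼 n) → 𝕄 n) (T : ℝ) (V : Set (𝔼 n)) : Prop where
  pos : 0 < T
  isOpen : IsOpen V
  smooth : TSM T V G
  posDef : ∀ t ∈ Icc 0 T, ∀ y ∈ V, (G t y).PosDef
  flow : ∀ t ∈ Icc 0 T, ∀ y ∈ V, ∀ i j,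
    HasDerivWithinAt (fun s => G s y i j) (-2 * ricci (G t) i j y) (Icc 0 T) t

namespace IsCoordFlow

variable {G : ℝ → (𝔼 n) → 𝕄 n} {T : ℝ} {V : Set (𝔼 n)} (hG : IsCoordFlow G T V)
include hG

lemma metric {t : ℝ} (ht : t ∈ Icc 0 T) : IsMetricOn (G t) V where
  isOpen := hG.isOpen
  smooth _ hy k l := (hG.smooth k l).contDiffAt hG.isOpen ht hy
  posDef := hG.posDef t ht

lemma ts_inv (k l : Fin n) : TS T V fun t y => (G t y)⁻¹ k l :=
  hG.smooth.inv (fun _ ht _ hy => (hG.metric ht).det_ne hy) k l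

lemma ts_christoffel (k i j : Fin n) : TS T V fun t => christoffel (G t) k i j := by
  refine (TS.const _).mul (TS.sum fun l _ => (hG.ts_inv k l).mul ?_)
  exact (((hG.smooth j l).pd hG.pos hG.isOpen i).add ((hG.smooth i l).pd hG.pos hG.isOpen j)).sub
    ((hG.smooth i j).pd hG.pos hG.isOpen l)

lemma ts_riem (i j k l : Fin n) : TS T V fun t => riem (G t) i j k l := by
  refine (((hG.ts_christoffel l j k).pd hG.pos hG.isOpen i).sub
    ((hG.ts_christoffel l i k).pd hG.pos hG.isOpen j)).add (TS.sum fun m _ => ?_)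
  exact ((hG.ts_christoffel l i m).mul (hG.ts_christoffel m j k)).sub
    ((hG.ts_christoffel l j m).mul (hG.ts_christoffel m i k))

lemma ts_ricci (j k : Fin n) : TS T V fun t => ricci (G t) j k :=
  TS.sum fun i _ => hG.ts_riem i j k i

lemma ts_scal : TS T V fun t => scal (G t) :=
  TS.sum fun j _ => TS.sum fun k _ => (hG.ts_inv j k).mul (hG.ts_ricci j k)

lemma ts_rmSq : TS T V fun t => rmSq (G t) :=
  TS.sum fun i _ => TS.sum fun j _ => TS.sum fun k _ => TS.sum fun l _ =>
    TS.sum fun a _ => TS.sum fun b _ => TS.sum fun c _ => TS.sum fun d _ =>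
    (((((hG.ts_inv i a).mul (hG.ts_inv j b)).mul (hG.ts_inv k c)).mul (hG.smooth l d)).mul
      (hG.ts_riem i j k l)).mul (hG.ts_riem a b c d)

/-- The pullback of a Ricci flow by a time independent change of coordinates. -/
lemma pullback {ψ : (𝔼 n) → 𝔼 n} {W : Set (𝔼 n)} (hψ : IsCoordChange ψ W V)
    {G' : ℝ → (𝔼 n) → 𝕄 n}
    (h : ∀ t ∈ Icc 0 T, ∀ w ∈ W, G' t w = (jac ψ w)ᵀ * G t (ψ w) * jac ψ w) :
    IsCoordFlow G' T W := by
  have hpb : ∀ t ∈ Icc 0 T, IsPullback ψ W V (G t) (G' t) := fun t ht =>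
    ⟨hψ, hG.metric ht, h t ht⟩
  have hent : ∀ t ∈ Icc 0 T, ∀ w ∈ W, ∀ i j, G' t w i j =
      ∑ a, ∑ b, jac ψ w a i * jac ψ w b j * G t (ψ w) a b := by
    intro t ht w hw i j
    rw [h t ht w hw]
    simp only [Matrix.mul_apply, Matrix.transpose_apply, Finset.sum_mul]
    rw [Finset.sum_comm]
    exact Finset.sum_congr rfl fun a _ => Finset.sum_congr rfl fun b _ => by ring
  refine ⟨hG.pos, hψ.isOpen, fun i j => ?_, fun t ht w hw => (hpb t ht).metric'.posDef w hw, ?_⟩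
  · have hj : ∀ a i, TS T W fun _ w => jac ψ w a i := fun a i =>
      TS.of_space fun w hw => (hψ.smooth_jac hw a i).contDiffWithinAt
    refine TS.congr (TS.sum fun a _ => TS.sum fun b _ => ((hj a i).mul (hj b j)).mul
      ((hG.smooth a b).comp (fun w hw => (hψ.smooth w hw).contDiffWithinAt) hψ.mapsTo))
      fun t ht w hw => hent t ht w hw i j
  · intro t ht w hw i j
    have hd : HasDerivWithinAt (fun s => ∑ a, ∑ b, jac ψ w a i * jac ψ w b j * G s (ψ w) a b)
        (∑ a, ∑ b, jac ψ w a i * jac ψ w b j * (-2 * ricci (G t) a b (ψ w))) (Icc 0 T) t :=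
      HasDerivWithinAt.fun_sum fun a _ => HasDerivWithinAt.fun_sum fun b _ =>
        (hG.flow t ht _ (hψ.mapsTo w hw) a b).const_mul _
    rw [(hpb t ht).ricci_eq hw]
    refine (hd.congr (fun s hs => hent s hs w hw i j) (hent t ht w hw i j)).congr_deriv ?_
    simp only [Finset.mul_sum]
    exact Finset.sum_congr rfl fun a _ => Finset.sum_congr rfl fun b _ => by ring

end IsCoordFlow

end Coord

end

/-! ### Two-jets and second covariant derivatives of the curvature -/

noncomputable section

namespace Coord

open scoped Matrix Topology
open CurvatureAlgebra

variable {n : ℕ}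

local notation "𝔼" n => EuclideanSpace ℝ (Fin n)
local notation "𝕄" n => Matrix (Fin n) (Fin n) ℝ

/-- The nested form contracts one index at a time, so that derivatives of |Rm|² can be computed slot
by slot. -/
lemma rmSq_eq_S4 (G : (𝔼 n) → 𝕄 n) (y : 𝔼 n) : rmSq G y = S4 fun i j k l =>
    riem G i j k l y * ∑ a, (G y)⁻¹ i a * ∑ b, (G y)⁻¹ j b * ∑ c, (G y)⁻¹ k c *
      ∑ d, G y l d * riem G a b c d y := by
  simp only [rmSq, S4, Finset.mul_sum]
  refine Finset.sum_congr rfl fun i _ => Finset.sum_congr rfl fun j _ =>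
    Finset.sum_congr rfl fun k _ => Finset.sum_congr rfl fun l _ =>
    Finset.sum_congr rfl fun a _ => Finset.sum_congr rfl fun b _ =>
    Finset.sum_congr rfl fun c _ => Finset.sum_congr rfl fun d _ => by ring

lemma rmSq_of_eq_one {G : (𝔼 n) → 𝕄 n} {y : 𝔼 n} (h : G y = 1) :
    rmSq G y = S4 fun i j k l => riem G i j k l y ^ 2 := by
  rw [rmSq_eq_S4, h]
  simp [Matrix.one_apply, sq]

/-- The `2`-jet of a function in the direction `∂_p` at the point `y`. -/
structure HasJet (V : Set (𝔼 n)) (p : Fin n) (y : 𝔼 n) (f : (𝔼 n) → ℝ) (v d₁ d₂ : ℝ) : Prop where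
  smooth : ∀ z ∈ V, ContDiffAt ℝ ∞ f z
  val : f y = v
  fst : pd p f y = d₁
  snd : pd p (pd p f) y = d₂

namespace HasJet

variable {V : Set (𝔼 n)} {p : Fin n} {y : 𝔼 n} {f h : (𝔼 n) → ℝ} {v d₁ d₂ w e₁ e₂ : ℝ}
  (hV : IsOpen V) (hy : y ∈ V)

include hV hy in
lemma mul (hf : HasJet V p y f v d₁ d₂) (hh : HasJet V p y h w e₁ e₂) :
    HasJet V p y (fun z => f z * h z) (v * w) (d₁ * w + v * e₁)
      (d₂ * w + 2 * (d₁ * e₁) + v * e₂) where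
  smooth z hz := (hf.smooth z hz).mul (hh.smooth z hz)
  val := by rw [hf.val, hh.val]
  fst := by
    rw [pd_mul ((hf.smooth y hy).differentiableAt (by simp))
      ((hh.smooth y hy).differentiableAt (by simp)), hf.val, hh.val, hf.fst, hh.fst]
  snd := by
    have d : ∀ {k : (𝔼 n) → ℝ} {z}, ContDiffAt ℝ ∞ k z → DifferentiableAt ℝ k z :=
      fun hk => hk.differentiableAt (by simp)
    have hf' := hf.smooth y hy
    have hh' := hh.smooth y hy
    rw [pd_congr (h := fun z => pd p f z * h z + f z * pd p h z)
      (by filter_upwards [hV.mem_nhds hy] with z hz using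
        pd_mul (d (hf.smooth z hz)) (d (hh.smooth z hz))),
      pd_add ((d (contDiffAt_pd hf')).fun_mul (d hh')) ((d hf').fun_mul (d (contDiffAt_pd hh'))),
      pd_mul (d (contDiffAt_pd hf')) (d hh'), pd_mul (d hf') (d (contDiffAt_pd hh')),
      hf.val, hh.val, hf.fst, hh.fst, hf.snd, hh.snd]
    ring

include hV hy in
lemma sum {κ : Type*} {s : Finset κ} {f : κ → (𝔼 n) → ℝ} {v d₁ d₂ : κ → ℝ}
    (hf : ∀ k ∈ s, HasJet V p y (f k) (v k) (d₁ k) (d₂ k)) :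
    HasJet V p y (fun z => ∑ k ∈ s, f k z) (∑ k ∈ s, v k) (∑ k ∈ s, d₁ k) (∑ k ∈ s, d₂ k) where
  smooth z hz := ContDiffAt.sum fun k hk => (hf k hk).smooth z hz
  val := Finset.sum_congr rfl fun k hk => (hf k hk).val
  fst := by
    rw [pd_sum s fun k hk => ((hf k hk).smooth y hy).differentiableAt (by simp)]
    exact Finset.sum_congr rfl fun k hk => (hf k hk).fst
  snd := by
    rw [pd_congr (h := fun z => ∑ k ∈ s, pd p (f k) z)
      (by filter_upwards [hV.mem_nhds hy] with z hz using
        pd_sum s fun k hk => ((hf k hk).smooth z hz).differentiableAt (by simp)),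
      pd_sum s fun k hk => (contDiffAt_pd ((hf k hk).smooth y hy)).differentiableAt (by simp)]
    exact Finset.sum_congr rfl fun k hk => (hf k hk).snd

include hV hy in
-- Since P agrees with the identity to first order, the contraction leaves the value and the first
-- derivative unchanged and adds only P₂ v to the second.
lemma contract {P : (𝔼 n) → 𝕄 n} {P₂ : 𝕄 n} {X : Fin n → (𝔼 n) → ℝ} {v d₁ d₂ : Fin n → ℝ}
    {i : Fin n} (hP : ∀ a, HasJet V p y (fun z => P z i a) ((1 : 𝕄 n) i a) 0 (P₂ i a))
    (hX : ∀ a, HasJet V p y (X a) (v a) (d₁ a) (d₂ a)) :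
    HasJet V p y (fun z => ∑ a, P z i a * X a z) (v i) (d₁ i) (∑ a, P₂ i a * v a + d₂ i) := by
  have := sum hV hy (s := Finset.univ) fun a _ => (hP a).mul hV hy (hX a)
  simpa [Matrix.one_apply, Finset.sum_add_distrib] using this

end HasJet

lemma hasDerivWithinAt_contract {I : Set ℝ} {t : ℝ} {P : ℝ → 𝕄 n} {P₁ : 𝕄 n}
    {X : Fin n → ℝ → ℝ} {v d₁ : Fin n → ℝ} {i : Fin n} (hP1 : P t = 1)
    (hP : ∀ a, HasDerivWithinAt (fun s => P s i a) (P₁ i a) I t)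
    (hv : ∀ a, X a t = v a)
    (hX : ∀ a, HasDerivWithinAt (X a) (d₁ a) I t) :
    HasDerivWithinAt (fun s => ∑ a, P s i a * X a s) (∑ a, P₁ i a * v a + d₁ i) I t := by
  have := HasDerivWithinAt.fun_sum (u := Finset.univ) fun a _ => (hP a).mul (hX a)
  refine this.congr_deriv ?_
  simp [hP1, hv, Matrix.one_apply, Finset.sum_add_distrib]

/-! ### Second order expansions at a point where `g_{ij} = δ_{ij}` and `Γ^k_{ij} = 0` -/

/-- The components `∇_p ∇_q R_{ijk}^l` of the second covariant derivative of the curvature at a point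
where the Christoffel symbols vanish. -/
def ddCurv (G : (𝔼 n) → 𝕄 n) (y : 𝔼 n) (p q i j k l : Fin n) : ℝ :=
  pd p (pd q (riem G i j k l)) y
    + ∑ s, (dM p (conn G q) y l s * riem G i j k s y - dM p (conn G q) y s i * riem G s j k l y
      - dM p (conn G q) y s j * riem G i s k l y - dM p (conn G q) y s k * riem G i j s l y)

lemma riem_antisymm {G : (𝔼 n) → 𝕄 n} {y : 𝔼 n} (i j k l : Fin n) : riem G j i k l y = - riem G i j k l y :=
  congrFun (congrFun (curv_antisymm (G := G) (y := y) i j) l) k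

namespace IsMetricOn

variable {G : (𝔼 n) → 𝕄 n} {V : Set (𝔼 n)} (hG : IsMetricOn G V) {y : 𝔼 n} (hy : y ∈ V)
include hG hy

lemma smooth_riem (i j k l : Fin n) : ContDiffAt ℝ ∞ (riem G i j k l) y := hG.smooth_curv hy i j l k

lemma riem_bianchi (i j k l : Fin n) :
    riem G i j k l y + riem G j k i l y + riem G k i j l y = 0 := hG.bianchi_first hy i j k l

lemma curvLike_riem (h1 : G y = 1) : CurvLike fun i j k l => riem G i j k l y where
  swap12 i j k l := riem_antisymm i j k l
  swap34 i j k l := by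
    have := congrFun (congrFun (hG.curv_metric hy i j) l) k
    rw [h1, mul_one, one_mul] at this
    simp only [curv, Matrix.add_apply, Matrix.transpose_apply, Matrix.of_apply,
      Matrix.zero_apply] at this
    linarith
  bianchi i j k l := hG.riem_bianchi hy i j k l

variable (h0 : ∀ i, conn G i y = 0)
include h0

lemma dM_eq_zero (i : Fin n) : dM i G y = 0 := by
  rw [hG.dM_metric hy, h0]; simp

/-- Differentiate the matrix Bianchi identity at a point where Γ = 0. The corrections for the form
indices, absent from the matrix version, cancel in the cyclic sum because ∂_r Γ^s_{pi} is symmetric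
in p and i. -/
lemma ddCurv_bianchi (r p i j k l : Fin n) : ddCurv G y r p i j k l + ddCurv G y r i j p k l
    + ddCurv G y r j p i k l = 0 := by
  have hA := hG.smooth_conn hy
  have hs : ∀ p i j, SmoothMAt (fun z => conn G p z * curv G i j z - curv G i j z * conn G p z) y :=
    fun p i j => ((hA p).mul (hG.smooth_curv hy i j)).sub ((hG.smooth_curv hy i j).mul (hA p))
  have hd : ∀ p i j, dM r (fun z => dM p (curv G i j) z
      + (conn G p z * curv G i j z - curv G i j z * conn G p z)) y = dM r (dM p (curv G i j)) y
      + (dM r (conn G p) y * curv G i j y - curv G i j y * dM r (conn G p) y) := by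
    intro p i j
    have hc := hG.smooth_curv hy i j
    rw [dM_add hc.dM (hs p i j), dM_sub ((hA p).mul hc) (hc.mul (hA p)), dM_mul (hA p) hc,
      dM_mul hc (hA p), h0]
    simp
  have e := dM_congr (i := r) ((hG.eventually_mem hy).mono fun z hz => hG.bianchi_second hz p i j)
  rw [dM_const, dM_add (((hG.smooth_curv hy i j).dM.add (hs p i j)).add
      ((hG.smooth_curv hy j p).dM.add (hs i j p))) ((hG.smooth_curv hy p i).dM.add (hs j p i)),
    dM_add ((hG.smooth_curv hy i j).dM.add (hs p i j)) ((hG.smooth_curv hy j p).dM.add (hs i j p)),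
    hd, hd, hd] at e
  have e1 := congrFun (congrFun e l) k
  simp only [Matrix.add_apply, Matrix.sub_apply, Matrix.mul_apply, Matrix.zero_apply] at e1
  change pd r (pd p (riem G i j k l)) y + (∑ s, _ * riem G i j k s y - ∑ s, riem G i j s l y * _)
    + (pd r (pd i (riem G j p k l)) y + (∑ s, _ * riem G j p k s y - ∑ s, riem G j p s l y * _))
    + (pd r (pd j (riem G p i k l)) y + (∑ s, _ * riem G p i k s y - ∑ s, riem G p i s l y * _))
    = 0 at e1
  have ha : ∀ p i s, dM r (conn G p) y s i = dM r (conn G i) y s p := fun p i s =>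
    pd_congr ((hG.eventually_mem hy).mono fun z hz => hG.conn_symm hz p i s)
  have f : ∀ p i j : Fin n, ddCurv G y r p i j k l = pd r (pd p (riem G i j k l)) y
      + (∑ s, dM r (conn G p) y l s * riem G i j k s y
        - ∑ s, riem G i j s l y * dM r (conn G p) y s k)
      - ∑ s, dM r (conn G p) y s i * riem G s j k l y
      + ∑ s, dM r (conn G j) y s p * riem G s i k l y := by
    intro p i j
    rw [ddCurv, ← Finset.sum_sub_distrib, add_sub_assoc, ← Finset.sum_sub_distrib, add_assoc,
      ← Finset.sum_add_distrib]
    congr 1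
    refine Finset.sum_congr rfl fun s _ => ?_
    rw [ha j p, riem_antisymm s i]; ring
  rw [f, f, f]
  linarith

/-- The Ricci identity: the second partial derivatives commute, and where Γ = 0 the curvature is ∂_p
Γ_q − ∂_q Γ_p. -/
lemma ddCurv_comm (p q j m k l : Fin n) : ddCurv G y p q j m k l - ddCurv G y q p j m k l =
    commTerm (fun i j k l => riem G i j k l y) p q j m k l := by
  have hc : ∀ a b, riem G p q a b y = dM p (conn G q) y b a - dM q (conn G p) y b a := by
    intro a b
    have := congrFun (congrFun (curv_eq (G := G) (y := y) p q) b) a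
    rw [h0, h0] at this
    simpa [curv] using this
  simp only [ddCurv, commTerm, hc, pd_comm (hG.smooth_riem hy j m k l) (i := p) (j := q)]
  rw [add_sub_add_left_eq_sub, ← Finset.sum_sub_distrib]
  exact Finset.sum_congr rfl fun s _ => by ring

lemma dM_inv_eq_zero (i : Fin n) : dM i (fun z => (G z)⁻¹) y = 0 := by
  rw [dM_inv (hG.smooth y hy) (hG.det_ne hy), hG.dM_eq_zero hy h0]; simp

variable (h1 : G y = 1)
include h1

lemma ddM_metric (p q : Fin n) :
    dM p (dM q G) y = (dM p (conn G q) y)ᵀ + dM p (conn G q) y := by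
  rw [dM_congr ((hG.eventually_mem hy).mono fun z hz => hG.dM_metric hz q),
    dM_add ((hG.smooth_conn hy q).transpose.mul (hG.smooth y hy))
      ((hG.smooth y hy).mul (hG.smooth_conn hy q)),
    dM_mul (hG.smooth_conn hy q).transpose (hG.smooth y hy),
    dM_mul (hG.smooth y hy) (hG.smooth_conn hy q), dM_transpose, h0, h1]
  simp

/-- Where g = 1 and ∂g = 0, the second derivatives of g⁻¹ are minus those of g; all other terms
contain a first derivative. -/
lemma ddM_inv (p q : Fin n) : dM p (dM q fun z => (G z)⁻¹) y =
    -((dM p (conn G q) y)ᵀ + dM p (conn G q) y) := by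
  have hP := hG.smooth_inv hy
  have hd := (hG.smooth y hy).dM (i := q)
  have e : dM q (fun z => (G z)⁻¹) =ᶠ[𝓝 y] fun z => 0 - (G z)⁻¹ * dM q G z * (G z)⁻¹ :=
    (hG.eventually_mem hy).mono fun z hz => by
      simp only [dM_inv (hG.smooth z hz) (hG.det_ne hz), zero_sub]
  have hc : SmoothMAt (fun _ : 𝔼 n => (0 : 𝕄 n)) y := fun _ _ => contDiffAt_const
  rw [dM_congr e, dM_sub hc ((hP.mul hd).mul hP), dM_mul (hP.mul hd) hP, dM_mul hP hd,
    dM_const, hG.dM_inv_eq_zero hy h0, hG.dM_eq_zero hy h0, hG.ddM_metric hy h0 h1, h1]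
  simp

/-- Covariant differentiation preserves the curvature symmetries. In coordinates each symmetry is
differentiated twice. Skew-symmetry in k, l holds nearby only after lowering with g, so there the
second derivatives of g enter and are matched with the ∂Γ terms of `ddCurv`. -/
lemma curvLike_ddCurv (p q : Fin n) : CurvLike (ddCurv G y p q) where
  swap12 i j k l := by
    have e1 : pd p (pd q (riem G j i k l)) y = - pd p (pd q (riem G i j k l)) y := by
      have h : ∀ z ∈ V, pd q (riem G j i k l) z = - pd q (riem G i j k l) z := fun z hz => by
        rw [← pd_neg]
        exact pd_congr ((hG.eventually_mem hz).mono fun w hw => riem_antisymm i j k l)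
      rw [← pd_neg]
      exact pd_congr ((hG.eventually_mem hy).mono h)
    simp only [ddCurv, e1, neg_add, ← Finset.sum_neg_distrib]
    congr 1
    refine Finset.sum_congr rfl fun s _ => ?_
    rw [riem_antisymm i j, riem_antisymm i s, riem_antisymm s j,
      riem_antisymm i j s l]
    ring
  swap34 i j k l := by
    have hR := hG.curvLike_riem hy h1
    have hsm := fun z hz => hG.smooth_curv (y := z) hz i j
    have e : dM q (fun z => (curv G i j z)ᵀ * G z + G z * curv G i j z) =ᶠ[𝓝 y] fun _ => 0 := by
      filter_upwards [hG.eventually_mem hy] with z hz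
      rw [dM_congr ((hG.eventually_mem hz).mono fun w hw => hG.curv_metric hw i j), dM_const]
    have e' : dM q (fun z => (curv G i j z)ᵀ * G z + G z * curv G i j z) =ᶠ[𝓝 y]
        fun z => ((dM q (curv G i j) z)ᵀ * G z + (curv G i j z)ᵀ * dM q G z)
          + (dM q G z * curv G i j z + G z * dM q (curv G i j) z) := by
      filter_upwards [hG.eventually_mem hy] with z hz
      rw [dM_add ((hsm z hz).transpose.mul (hG.smooth z hz)) ((hG.smooth z hz).mul (hsm z hz)),
        dM_mul (hsm z hz).transpose (hG.smooth z hz), dM_mul (hG.smooth z hz) (hsm z hz),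
        dM_transpose]
    have hs := hsm y hy
    have hg := hG.smooth y hy
    have e2 := dM_congr (i := p) (e'.symm.trans e)
    rw [dM_const, dM_add ((hs.dM.transpose.mul hg).add (hs.transpose.mul hg.dM))
      ((hg.dM.mul hs).add (hg.mul hs.dM)), dM_add (hs.dM.transpose.mul hg) (hs.transpose.mul hg.dM),
      dM_add (hg.dM.mul hs) (hg.mul hs.dM), dM_mul hs.dM.transpose hg, dM_mul hs.transpose hg.dM,
      dM_mul hg.dM hs, dM_mul hg hs.dM, hG.ddM_metric hy h0 h1, hG.dM_eq_zero hy h0,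
      hG.dM_eq_zero hy h0, h1] at e2
    have e3 := congrFun (congrFun e2 l) k
    simp only [dM_transpose, mul_one, mul_zero, zero_mul, one_mul, add_zero, zero_add,
      Matrix.add_apply, Matrix.transpose_apply, Matrix.mul_apply, Matrix.zero_apply] at e3
    change pd p (pd q (riem G i j l k)) y + ∑ s, riem G i j l s y * _
      + (∑ s, _ * riem G i j k s y + pd p (pd q (riem G i j k l)) y) = 0 at e3
    have f : ∑ s, riem G i j l s y * (dM p (conn G q) y k s + dM p (conn G q) y s k)
        + ∑ s, (dM p (conn G q) y s l + dM p (conn G q) y l s) * riem G i j k s y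
        = ∑ s, (dM p (conn G q) y k s * riem G i j l s y - dM p (conn G q) y s i * riem G s j l k y
          - dM p (conn G q) y s j * riem G i s l k y - dM p (conn G q) y s l * riem G i j s k y)
        + ∑ s, (dM p (conn G q) y l s * riem G i j k s y - dM p (conn G q) y s i * riem G s j k l y
          - dM p (conn G q) y s j * riem G i s k l y
          - dM p (conn G q) y s k * riem G i j s l y) := by
      rw [← Finset.sum_add_distrib, ← Finset.sum_add_distrib]
      refine Finset.sum_congr rfl fun s _ => ?_
      rw [hR.swap34 i j k s, hR.swap34 i j l s, hR.swap34 s j k l, hR.swap34 i s k l]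
      ring
    simp only [ddCurv]
    linarith
  bianchi i j k l := by
    have hb : pd p (pd q (riem G i j k l)) y + pd p (pd q (riem G j k i l)) y
        + pd p (pd q (riem G k i j l)) y = 0 := by
      have hd : ∀ z ∈ V, ∀ i j k l, DifferentiableAt ℝ (riem G i j k l) z := fun z hz i j k l =>
        (hG.smooth_riem hz i j k l).differentiableAt (by simp)
      have hdd : ∀ i j k l, DifferentiableAt ℝ (pd q (riem G i j k l)) y := fun i j k l =>
        (contDiffAt_pd (hG.smooth_riem hy i j k l)).differentiableAt (by simp)
      have h : ∀ z ∈ V, pd q (riem G i j k l) z + pd q (riem G j k i l) z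
          + pd q (riem G k i j l) z = 0 := fun z hz => by
        rw [← pd_add (hd z hz _ _ _ _) (hd z hz _ _ _ _), ← pd_add
          ((hd z hz _ _ _ _).fun_add (hd z hz _ _ _ _)) (hd z hz _ _ _ _),
          pd_congr ((hG.eventually_mem hz).mono fun w hw => hG.riem_bianchi hw i j k l), pd_const]
      rw [← pd_add (hdd _ _ _ _) (hdd _ _ _ _), ← pd_add ((hdd _ _ _ _).fun_add (hdd _ _ _ _))
        (hdd _ _ _ _), pd_congr ((hG.eventually_mem hy).mono h), pd_const]
    have hs : ∑ s, ((dM p (conn G q) y l s * riem G i j k s y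
          - dM p (conn G q) y s i * riem G s j k l y
          - dM p (conn G q) y s j * riem G i s k l y - dM p (conn G q) y s k * riem G i j s l y)
        + (dM p (conn G q) y l s * riem G j k i s y
          - dM p (conn G q) y s j * riem G s k i l y
          - dM p (conn G q) y s k * riem G j s i l y - dM p (conn G q) y s i * riem G j k s l y)
        + (dM p (conn G q) y l s * riem G k i j s y
          - dM p (conn G q) y s k * riem G s i j l y
          - dM p (conn G q) y s i * riem G k s j l y
          - dM p (conn G q) y s j * riem G k i s l y)) = 0 := by
      refine Finset.sum_eq_zero fun s _ => ?_
      have b0 := hG.riem_bianchi hy i j k s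
      have b1 := hG.riem_bianchi hy s j k l
      have b2 := hG.riem_bianchi hy i s k l
      have b3 := hG.riem_bianchi hy i j s l
      linear_combination (dM p (conn G q) y l s) * b0 - (dM p (conn G q) y s i) * b1
        - (dM p (conn G q) y s j) * b2 - (dM p (conn G q) y s k) * b3
    rw [Finset.sum_add_distrib, Finset.sum_add_distrib] at hs
    simp only [ddCurv]
    linarith

end IsMetricOn

end Coord

end

/-! ### Gradient and Laplacian of |Rm|² at the centre of normal coordinates -/

noncomputable section

namespace Coord

open scoped Matrix Topology
open CurvatureAlgebra

variable {n : ℕ}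

local notation "𝔼" n => EuclideanSpace ℝ (Fin n)
local notation "𝕄" n => Matrix (Fin n) (Fin n) ℝ

/-- The contraction R_{ijkl} R_{sjkl} is symmetric in i and s, so it sees only the symmetric part of
a. -/
lemma S4_slot_one {κ : Type*} [Fintype κ] (R : κ → κ → κ → κ → ℝ) (a : κ → κ → ℝ) :
    S4 (fun i j k l => R i j k l * ∑ s, a i s * R s j k l)
      = S4 fun i j k l => R i j k l * ∑ s, a s i * R s j k l := by
  have h : ∀ b : κ → κ → ℝ, S4 (fun i j k l => R i j k l * ∑ s, b i s * R s j k l)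
      = ∑ i, ∑ s, b i s * ∑ j, ∑ k, ∑ l, R i j k l * R s j k l := by
    intro b
    simp only [S4, Finset.mul_sum]
    refine Finset.sum_congr rfl fun i _ => ?_
    calc _ = ∑ j, ∑ k, ∑ s, ∑ l, R i j k l * (b i s * R s j k l) :=
          Finset.sum_congr rfl fun j _ => Finset.sum_congr rfl fun k _ => Finset.sum_comm
      _ = ∑ j, ∑ s, ∑ k, ∑ l, R i j k l * (b i s * R s j k l) :=
          Finset.sum_congr rfl fun j _ => Finset.sum_comm
      _ = ∑ s, ∑ j, ∑ k, ∑ l, R i j k l * (b i s * R s j k l) := Finset.sum_comm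
      _ = _ := Finset.sum_congr rfl fun s _ => Finset.sum_congr rfl fun j _ =>
          Finset.sum_congr rfl fun k _ => Finset.sum_congr rfl fun l _ => by ring
  rw [h, h fun i s => a s i, Finset.sum_comm]
  refine Finset.sum_congr rfl fun i _ => Finset.sum_congr rfl fun s _ => ?_
  congr 1
  exact Finset.sum_congr rfl fun j _ => Finset.sum_congr rfl fun k _ =>
    Finset.sum_congr rfl fun l _ => mul_comm _ _

/-- Apply `S4_slot_one` in each slot, with a the matrix ∂_p Γ_p. On the left are the contributions
of the second derivatives of the metric factors in |Rm|²; on the right are exactly the terms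
completing 2 R · ∂_p∂_p R to 2 R · ∇_p∇_p R. -/
lemma S4_slots {κ : Type*} [Fintype κ] (R : κ → κ → κ → κ → ℝ) (a : κ → κ → ℝ) :
    S4 (fun i j k l => R i j k l * (∑ s, -(a s i + a i s) * R s j k l
      + (∑ s, -(a s j + a j s) * R i s k l + (∑ s, -(a s k + a k s) * R i j s l
        + ∑ s, (a s l + a l s) * R i j k s))))
      = 2 * S4 fun i j k l => R i j k l * ∑ s, (a l s * R i j k s - a s i * R s j k l
        - a s j * R i s k l - a s k * R i j s l) := by
  have e1 := S4_slot_one R a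
  have e2 : S4 (fun i j k l => R i j k l * ∑ s, a j s * R i s k l)
      = S4 fun i j k l => R i j k l * ∑ s, a s j * R i s k l := by
    rw [S4_swap12, S4_slot_one (fun i j k l => R j i k l) a, S4_swap12]
  have e3 : S4 (fun i j k l => R i j k l * ∑ s, a k s * R i j s l)
      = S4 fun i j k l => R i j k l * ∑ s, a s k * R i j s l := by
    rw [S4_swap_pairs, S4_slot_one (fun i j k l => R k l i j) a, S4_swap_pairs]
  have e4 : S4 (fun i j k l => R i j k l * ∑ s, a s l * R i j k s)
      = S4 fun i j k l => R i j k l * ∑ s, a l s * R i j k s := by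
    rw [S4_swap34, S4_swap_pairs, S4_slot_one (fun i j k l => R k l j i) fun i s => a s i,
      S4_swap_pairs, S4_swap34]
  have l : S4 (fun i j k l => R i j k l * (∑ s, -(a s i + a i s) * R s j k l
      + (∑ s, -(a s j + a j s) * R i s k l + (∑ s, -(a s k + a k s) * R i j s l
        + ∑ s, (a s l + a l s) * R i j k s)))) =
      - S4 (fun i j k l => R i j k l * ∑ s, a s i * R s j k l)
      - S4 (fun i j k l => R i j k l * ∑ s, a i s * R s j k l)
      - S4 (fun i j k l => R i j k l * ∑ s, a s j * R i s k l)
      - S4 (fun i j k l => R i j k l * ∑ s, a j s * R i s k l)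
      - S4 (fun i j k l => R i j k l * ∑ s, a s k * R i j s l)
      - S4 (fun i j k l => R i j k l * ∑ s, a k s * R i j s l)
      + S4 (fun i j k l => R i j k l * ∑ s, a s l * R i j k s)
      + S4 (fun i j k l => R i j k l * ∑ s, a l s * R i j k s) := by
    rw [← S4_neg, ← S4_sub, ← S4_sub, ← S4_sub, ← S4_sub, ← S4_sub, ← S4_add, ← S4_add]
    refine S4_congr fun i j k l => ?_
    simp only [neg_mul, add_mul, Finset.sum_neg_distrib, Finset.sum_add_distrib]
    ring
  have r : S4 (fun i j k l => R i j k l * ∑ s, (a l s * R i j k s - a s i * R s j k l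
        - a s j * R i s k l - a s k * R i j s l)) =
      S4 (fun i j k l => R i j k l * ∑ s, a l s * R i j k s)
      - S4 (fun i j k l => R i j k l * ∑ s, a s i * R s j k l)
      - S4 (fun i j k l => R i j k l * ∑ s, a s j * R i s k l)
      - S4 (fun i j k l => R i j k l * ∑ s, a s k * R i j s l) := by
    rw [← S4_sub, ← S4_sub, ← S4_sub]
    refine S4_congr fun i j k l => ?_
    simp only [Finset.sum_sub_distrib]
    ring
  rw [l, r, e1, e2, e3, e4]
  ring

lemma hasJet_S4 {V : Set (𝔼 n)} (hV : IsOpen V) {y : 𝔼 n} (hy : y ∈ V) {p : Fin n}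
    {f : Fin n → Fin n → Fin n → Fin n → (𝔼 n) → ℝ} {v d₁ d₂ : Fin n → Fin n → Fin n → Fin n → ℝ}
    (h : ∀ i j k l, HasJet V p y (f i j k l) (v i j k l) (d₁ i j k l) (d₂ i j k l)) :
    HasJet V p y (fun z => S4 fun i j k l => f i j k l z) (S4 v) (S4 d₁) (S4 d₂) :=
  HasJet.sum hV hy fun i _ => HasJet.sum hV hy fun j _ => HasJet.sum hV hy fun k _ =>
    HasJet.sum hV hy fun l _ => h i j k l

/-- The bound `|Scal| ≤ n |Rm|`. -/
lemma scal_sq_le {G : (𝔼 n) → 𝕄 n} {y : 𝔼 n} (h1 : G y = 1) : scal G y ^ 2 ≤ n ^ 2 * rmSq G y := by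
  have e : scal G y = ∑ x : Fin n × Fin n, 1 * riem G x.2 x.1 x.1 x.2 y := by
    simp [scal, h1, Matrix.one_apply, ricci, Fintype.sum_prod_type]
  rw [e]
  refine (Finset.sum_mul_sq_le_sq_mul_sq _ _ _).trans ?_
  simp only [one_pow, Finset.sum_const, Finset.card_univ, Fintype.card_prod, Fintype.card_fin,
    nsmul_eq_mul, mul_one, Nat.cast_mul]
  rw [← sq]
  refine mul_le_mul_of_nonneg_left ?_ (by positivity)
  rw [rmSq_of_eq_one h1, S4, Finset.sum_comm, Fintype.sum_prod_type]
  refine Finset.sum_le_sum fun j _ => Finset.sum_le_sum fun i _ => ?_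
  refine le_trans ?_ (Finset.single_le_sum (f := fun k => ∑ l, riem G i j k l y ^ 2)
    (fun k _ => Finset.sum_nonneg fun l _ => sq_nonneg _) (Finset.mem_univ j))
  exact Finset.single_le_sum (f := fun l => riem G i j j l y ^ 2) (fun l _ => sq_nonneg _)
    (Finset.mem_univ i)

namespace IsMetricOn

variable {G : (𝔼 n) → 𝕄 n} {V : Set (𝔼 n)} (hG : IsMetricOn G V) {y : 𝔼 n} (hy : y ∈ V)
  (h0 : ∀ i, conn G i y = 0) (h1 : G y = 1)
include hG hy h0 h1

/-- This is ∂_p∂_p |Rm|² = 2⟨Rm, ∇_p∇_p Rm⟩ + 2|∇_p Rm|². At this point ∇_p Rm = ∂_p Rm, and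
`S4_slots` accounts for the second derivatives of the metric. -/
lemma hasJet_rmSq (p : Fin n) : HasJet V p y (rmSq G) (rmSq G y)
    (2 * S4 fun i j k l => riem G i j k l y * pd p (riem G i j k l) y)
    (2 * S4 (fun i j k l => riem G i j k l y * ddCurv G y p p i j k l)
      + 2 * S4 fun i j k l => pd p (riem G i j k l) y ^ 2) := by
  have hR : ∀ i j k l, HasJet V p y (riem G i j k l) (riem G i j k l y)
      (pd p (riem G i j k l) y) (pd p (pd p (riem G i j k l)) y) := fun i j k l =>
    ⟨fun z hz => hG.smooth_riem hz i j k l, rfl, rfl, rfl⟩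
  have hGj : ∀ i a, HasJet V p y (fun z => G z i a) ((1 : 𝕄 n) i a) 0
      (dM p (dM p G) y i a) := fun i a =>
    ⟨fun z hz => hG.smooth z hz i a, by rw [h1],
      congrFun (congrFun (hG.dM_eq_zero hy h0 p) i) a, rfl⟩
  have hPj : ∀ i a, HasJet V p y (fun z => (G z)⁻¹ i a) ((1 : 𝕄 n) i a) 0
      (dM p (dM p fun z => (G z)⁻¹) y i a) := fun i a =>
    ⟨fun z hz => hG.smooth_inv hz i a, by simp [h1],
      congrFun (congrFun (hG.dM_inv_eq_zero hy h0 p) i) a, rfl⟩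
  have hV := hG.isOpen
  have key := hasJet_S4 hV hy fun i j k l => (hR i j k l).mul hV hy
    (HasJet.contract hV hy (hPj i) fun a => HasJet.contract hV hy (hPj j) fun b =>
      HasJet.contract hV hy (hPj k) fun c => HasJet.contract hV hy (hGj l) fun d => hR a b c d)
  refine ⟨fun z hz => (key.smooth z hz).congr_of_eventuallyEq
    (Eventually.of_forall fun z => rmSq_eq_S4 G z), rfl, ?_, ?_⟩
  · rw [funext (rmSq_eq_S4 G), key.fst, two_mul, ← S4_add]
    exact S4_congr fun i j k l => by ring
  · rw [funext (rmSq_eq_S4 G), key.snd, hG.ddM_inv hy h0 h1, hG.ddM_metric hy h0 h1]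
    have hs := S4_slots (fun i j k l => riem G i j k l y) (dM p (conn G p) y)
    have e : S4 (fun i j k l => riem G i j k l y * ddCurv G y p p i j k l)
        = S4 (fun i j k l => riem G i j k l y * pd p (pd p (riem G i j k l)) y)
        + S4 fun i j k l => riem G i j k l y * ∑ s, (dM p (conn G p) y l s * riem G i j k s y
          - dM p (conn G p) y s i * riem G s j k l y - dM p (conn G p) y s j * riem G i s k l y
          - dM p (conn G p) y s k * riem G i j s l y) := by
      rw [← S4_add]
      exact S4_congr fun i j k l => by rw [ddCurv]; ring
    rw [e, mul_add, ← hs, two_mul, two_mul, ← S4_add, ← S4_add, ← S4_add, ← S4_add]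
    refine S4_congr fun i j k l => ?_
    simp only [Matrix.neg_apply, Matrix.add_apply, Matrix.transpose_apply]
    ring

lemma laplacian_rmSq : laplacian G (rmSq G) y =
    2 * ∑ p, S4 (fun i j k l => riem G i j k l y * ddCurv G y p p i j k l)
      + 2 * ∑ p, S4 fun i j k l => pd p (riem G i j k l) y ^ 2 := by
  have hc : ∀ k i j, christoffel G k i j y = 0 := fun k i j =>
    congrFun (congrFun (h0 i) k) j
  simp only [laplacian, h1, inv_one, hc, zero_mul, Finset.sum_const_zero, sub_zero,
    Matrix.one_apply, ite_mul, one_mul, Finset.sum_ite_eq, Finset.mem_univ, if_true]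
  rw [Finset.mul_sum, Finset.mul_sum, ← Finset.sum_add_distrib]
  exact Finset.sum_congr rfl fun p _ => (hG.hasJet_rmSq hy h0 h1 p).snd

/-- Kato's inequality `|∇|Rm|²|² ≤ 4 |Rm|² |∇Rm|²`. -/
lemma gradSq_rmSq_le : gradSq G (rmSq G) y ≤
    2 * rmSq G y * (2 * ∑ p, S4 fun i j k l => pd p (riem G i j k l) y ^ 2) := by
  simp only [gradSq, h1, inv_one, Matrix.one_apply, ite_mul, one_mul, zero_mul,
    Finset.sum_ite_eq, Finset.mem_univ, if_true]
  rw [rmSq_of_eq_one h1, Finset.mul_sum, Finset.mul_sum]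
  refine Finset.sum_le_sum fun p _ => ?_
  rw [(hG.hasJet_rmSq hy h0 h1 p).fst]
  have := S4_mul_sq_le (fun i j k l => riem G i j k l y) fun i j k l => pd p (riem G i j k l) y
  linarith

end IsMetricOn

end Coord

end

/-! ### Time derivative of the curvature under Ricci flow -/

noncomputable section

namespace Coord

open scoped Matrix Topology
open CurvatureAlgebra

variable {n : ℕ}

local notation "𝔼" n => EuclideanSpace ℝ (Fin n)
local notation "𝕄" n => Matrix (Fin n) (Fin n) ℝ

section TimeDerivative

variable {T : ℝ} {V : Set (𝔼 n)} {F H : ℝ → (𝔼 n) → 𝕄 n} {t : ℝ} {y : 𝔼 n}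

lemma TSM.mul (hF : TSM T V F) (hH : TSM T V H) : TSM T V fun t y => F t y * H t y := by
  intro k l
  simp only [Matrix.mul_apply]
  exact TS.sum fun m _ => (hF k m).mul (hH m l)

lemma TSM.sub (hF : TSM T V F) (hH : TSM T V H) : TSM T V fun t y => F t y - H t y :=
  fun k l => (hF k l).sub (hH k l)

lemma TSM.transpose (hF : TSM T V F) : TSM T V fun t y => (F t y)ᵀ := fun k l => hF l k

lemma dtM_transpose : dtM T (fun t y => (F t y)ᵀ) t y = (dtM T F t y)ᵀ := rfl

variable (hT : 0 < T) (hV : IsOpen V) (ht : t ∈ Icc 0 T) (hy : y ∈ V)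

include hT hV in
lemma TSM.dM (hF : TSM T V F) (i : Fin n) : TSM T V fun t => dM i (F t) :=
  fun k l => (hF k l).pd hT hV i

include hT hV in
lemma TSM.dtM (hF : TSM T V F) : TSM T V (dtM T F) := fun k l => (hF k l).dt hT hV

include hV ht hy in
lemma TSM.smoothMAt (hF : TSM T V F) : SmoothMAt (F t) y :=
  fun k l => (hF k l).contDiffAt hV ht hy

include hT ht in
lemma dt_eq_of_hasDerivWithinAt {f : ℝ → (𝔼 n) → ℝ} {d : ℝ}
    (h : HasDerivWithinAt (fun s => f s y) d (Icc 0 T) t) : dt T f t y = d :=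
  h.derivWithin (uniqueDiffOn_Icc hT t ht)

include hT ht hy in
lemma dtM_mul (hF : TSM T V F) (hH : TSM T V H) :
    dtM T (fun t y => F t y * H t y) t y = dtM T F t y * H t y + F t y * dtM T H t y := by
  ext k l
  simp only [dtM, Matrix.of_apply, Matrix.add_apply, Matrix.mul_apply, ← Finset.sum_add_distrib]
  exact dt_eq_of_hasDerivWithinAt hT ht (HasDerivWithinAt.fun_sum fun m _ =>
    ((hF k m).hasDerivWithinAt ht hy).mul ((hH m l).hasDerivWithinAt ht hy))

include hT ht hy in
lemma dtM_add (hF : TSM T V F) (hH : TSM T V H) :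
    dtM T (fun t y => F t y + H t y) t y = dtM T F t y + dtM T H t y := by
  ext k l
  exact dt_eq_of_hasDerivWithinAt (f := fun t y => F t y k l + H t y k l) hT ht
    (((hF k l).hasDerivWithinAt ht hy).add ((hH k l).hasDerivWithinAt ht hy))

include hT ht hy in
lemma dtM_sub (hF : TSM T V F) (hH : TSM T V H) :
    dtM T (fun t y => F t y - H t y) t y = dtM T F t y - dtM T H t y := by
  ext k l
  exact dt_eq_of_hasDerivWithinAt (f := fun t y => F t y k l - H t y k l) hT ht
    (((hF k l).hasDerivWithinAt ht hy).sub ((hH k l).hasDerivWithinAt ht hy))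

include hT hV ht hy in
lemma dtM_dM (hF : TSM T V F) (i : Fin n) :
    dtM T (fun t => dM i (F t)) t y = dM i (dtM T F t) y := by
  ext k l
  exact (hF k l).dt_pd hT hV ht hy i

include ht in
lemma dtM_congr (h : ∀ s ∈ Icc 0 T, F s y = H s y) : dtM T F t y = dtM T H t y := by
  ext k l
  exact derivWithin_congr (fun s hs => congrFun (congrFun (h s hs) k) l)
    (congrFun (congrFun (h t ht) k) l)

end TimeDerivative

namespace IsCoordFlow

variable {G : ℝ → (𝔼 n) → 𝕄 n} {T : ℝ} {V : Set (𝔼 n)} (hG : IsCoordFlow G T V)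
include hG

lemma tsm_conn (i : Fin n) : TSM T V fun t => conn (G t) i := fun k j => hG.ts_christoffel k i j

variable {t : ℝ} (ht : t ∈ Icc 0 T) {y : 𝔼 n} (hy : y ∈ V)
include ht hy

lemma dtM_metric : dtM T G t y = Matrix.of fun j k => -2 * ricci (G t) j k y := by
  ext j k
  exact dt_eq_of_hasDerivWithinAt (f := fun t y => G t y j k) hG.pos ht (hG.flow t ht y hy j k)

/-- The time derivative of metric compatibility, after exchanging ∂_t and ∂_i. It determines ∂_t Γ
implicitly from ∂_t g. -/
lemma dM_dtM_metric (i : Fin n) : dM i (dtM T G t) y =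
    ((dtM T (fun t => conn (G t) i) t y)ᵀ * G t y + (conn (G t) i y)ᵀ * dtM T G t y)
    + (dtM T G t y * conn (G t) i y + G t y * dtM T (fun t => conn (G t) i) t y) := by
  rw [← dtM_dM hG.pos hG.isOpen ht hy hG.smooth,
    dtM_congr (H := fun s y => (conn (G s) i y)ᵀ * G s y + G s y * conn (G s) i y) ht
      fun s hs => (hG.metric hs).dM_metric hy i,
    dtM_add hG.pos ht hy ((hG.tsm_conn i).transpose.mul hG.smooth)
      (hG.smooth.mul (hG.tsm_conn i)),
    dtM_mul hG.pos ht hy (hG.tsm_conn i).transpose hG.smooth,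
    dtM_mul hG.pos ht hy hG.smooth (hG.tsm_conn i), dtM_transpose]

lemma dtM_inv (h1 : G t y = 1) : dtM T (fun t y => (G t y)⁻¹) t y = - dtM T G t y := by
  have hP : TSM T V fun t y => (G t y)⁻¹ := hG.ts_inv
  have e := dtM_mul hG.pos ht hy hP hG.smooth
  rw [dtM_congr (H := fun _ _ => 1) ht fun s hs =>
    Matrix.nonsing_inv_mul _ ((hG.metric hs).isUnit_det hy)] at e
  have : dtM T (fun _ _ => (1 : 𝕄 n)) t y = 0 := by
    ext k l
    simp [dtM, dt]
  rw [this, h1, inv_one, mul_one, one_mul] at e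
  exact eq_neg_of_add_eq_zero_left e.symm

variable (h0 : ∀ i, conn (G t) i y = 0)
include h0

/-- The Palatini identity: the quadratic terms of the structure equation are killed by Γ = 0, and
∂_t commutes with the space derivatives. -/
lemma dtM_curv (i j : Fin n) : dtM T (fun t => curv (G t) i j) t y =
    dM i (dtM T (fun t => conn (G t) j) t) y - dM j (dtM T (fun t => conn (G t) i) t) y := by
  have hA := hG.tsm_conn
  have hd : ∀ i j, TSM T V fun t => dM i (conn (G t) j) := fun i j =>
    (hA j).dM hG.pos hG.isOpen i
  rw [dtM_congr (H := fun s y => dM i (conn (G s) j) y - dM j (conn (G s) i) y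
      + (conn (G s) i y * conn (G s) j y - conn (G s) j y * conn (G s) i y)) ht
      fun s _ => curv_eq i j,
    dtM_add hG.pos ht hy ((hd i j).sub (hd j i)) (((hA i).mul (hA j)).sub ((hA j).mul (hA i))),
    dtM_sub hG.pos ht hy (hd i j) (hd j i),
    dtM_sub hG.pos ht hy ((hA i).mul (hA j)) ((hA j).mul (hA i)),
    dtM_mul hG.pos ht hy (hA i) (hA j), dtM_mul hG.pos ht hy (hA j) (hA i),
    dtM_dM hG.pos hG.isOpen ht hy (hA j), dtM_dM hG.pos hG.isOpen ht hy (hA i), h0, h0]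
  simp

variable (h1 : G t y = 1)
include h1

/-- Differentiate the time derivative of metric compatibility in space at a point with Γ = 0. The
terms with ∂Γ combine with −2∂_p∂_i R_{jk} to −2∇_p∇_i R_{jk}. -/
lemma ddM_dtM_metric (p i : Fin n) :
    (dM p (dtM T (fun t => conn (G t) i) t) y)ᵀ + dM p (dtM T (fun t => conn (G t) i) t) y =
    Matrix.of fun j k => -2 * ric2 (ddCurv (G t) y) p i j k := by
  have hm := hG.metric ht
  have hB : SmoothMAt (dtM T (fun t => conn (G t) i) t) y :=
    ((hG.tsm_conn i).dtM hG.pos hG.isOpen).smoothMAt hG.isOpen ht hy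
  have hA := hm.smooth_conn hy i
  have hg := hm.smooth y hy
  have hh : SmoothMAt (dtM T G t) y := (hG.smooth.dtM hG.pos hG.isOpen).smoothMAt hG.isOpen ht hy
  have e := dM_congr (i := p) ((hm.eventually_mem hy).mono fun z hz => hG.dM_dtM_metric ht hz i)
  rw [dM_add ((hB.transpose.mul hg).add (hA.transpose.mul hh)) ((hh.mul hA).add (hg.mul hB)),
    dM_add (hB.transpose.mul hg) (hA.transpose.mul hh), dM_add (hh.mul hA) (hg.mul hB),
    dM_mul hB.transpose hg, dM_mul hA.transpose hh, dM_mul hh hA, dM_mul hg hB,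
    hm.dM_eq_zero hy h0, h0, h1, hG.dtM_metric ht hy] at e
  simp only [dM_transpose, Matrix.transpose_zero, mul_one, mul_zero, zero_mul, one_mul, add_zero,
    zero_add] at e
  have e2 : (dM p (dtM T (fun t => conn (G t) i) t) y)ᵀ
      + dM p (dtM T (fun t => conn (G t) i) t) y = dM p (dM i (dtM T G t)) y
      - (dM p (conn (G t) i) y)ᵀ * (Matrix.of fun j k => -2 * ricci (G t) j k y)
      - (Matrix.of fun j k => -2 * ricci (G t) j k y) * dM p (conn (G t) i) y := by
    rw [e]; abel
  rw [e2]
  ext j k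
  have hr : ∀ m j k, ContDiffAt ℝ ∞ (riem (G t) m j k m) y := fun m j k => hm.smooth_riem hy m j k m
  have e3 : dM p (dM i (dtM T G t)) y j k = -2 * ∑ m, pd p (pd i (riem (G t) m j k m)) y := by
    have h2 : ∀ z ∈ V, dM i (dtM T G t) z j k = -2 * ∑ m, pd i (riem (G t) m j k m) z := by
      intro z hz
      have hr' : ∀ m, DifferentiableAt ℝ (riem (G t) m j k m) z := fun m =>
        (hm.smooth_riem hz m j k m).differentiableAt (by simp)
      rw [dM_congr ((hm.eventually_mem hz).mono fun w hw => hG.dtM_metric ht hw),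
        ← pd_sum _ fun m _ => hr' m,
        ← pd_const_mul _ (DifferentiableAt.fun_sum fun m _ => hr' m)]
      rfl
    have hr' : ∀ m, DifferentiableAt ℝ (pd i (riem (G t) m j k m)) y := fun m =>
      (contDiffAt_pd (hr m j k)).differentiableAt (by simp)
    rw [← pd_sum _ fun m _ => hr' m, ← pd_const_mul _ (DifferentiableAt.fun_sum fun m _ => hr' m)]
    exact pd_congr ((hm.eventually_mem hy).mono h2)
  rw [Matrix.sub_apply, Matrix.sub_apply, e3]
  simp only [Matrix.mul_apply, Matrix.of_apply, Matrix.transpose_apply, ric2, ddCurv, ricci,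
    Finset.sum_add_distrib, Finset.sum_sub_distrib, Finset.mul_sum, Finset.sum_mul, mul_add,
    mul_sub]
  -- The connection terms for the traced pair of indices of R_{mjk}^m cancel each other, which is
  -- why contraction commutes with covariant differentiation.
  have c1 : ∑ m, ∑ s, -2 * (dM p (conn (G t) i) y m s * riem (G t) m j k s y)
      = ∑ m, ∑ s, -2 * (dM p (conn (G t) i) y s m * riem (G t) s j k m y) := Finset.sum_comm
  have c2 : ∑ s, ∑ m, dM p (conn (G t) i) y s j * (-2 * riem (G t) m s k m y)
      = ∑ m, ∑ s, -2 * (dM p (conn (G t) i) y s j * riem (G t) m s k m y) := by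
    rw [Finset.sum_comm]
    exact Finset.sum_congr rfl fun m _ => Finset.sum_congr rfl fun s _ => by ring
  have c3 : ∑ s, ∑ m, -2 * riem (G t) m j s m y * dM p (conn (G t) i) y s k
      = ∑ m, ∑ s, -2 * (dM p (conn (G t) i) y s k * riem (G t) m j s m y) := by
    rw [Finset.sum_comm]
    exact Finset.sum_congr rfl fun m _ => Finset.sum_congr rfl fun s _ => by ring
  rw [c1, c2, c3]
  ring

/-- Koszul's alternating sum solves `ddM_dtM_metric` for ∂_p ∂_t Γ^k_{ij}, using the symmetry in i,
j. Substituting in the Palatini identity gives the six Hessian terms of `dtR`. -/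
lemma dt_riem (i j k l : Fin n) : dt T (fun t => riem (G t) i j k l) t y =
    dtR (ddCurv (G t) y) i j k l := by
  have hm := hG.metric ht
  have hs : ∀ p i j k, dM p (dtM T (fun t => conn (G t) i) t) y k j
      = dM p (dtM T (fun t => conn (G t) j) t) y k i := fun p i j k =>
    pd_congr ((hm.eventually_mem hy).mono fun z hz =>
      derivWithin_congr (fun s hs => (hG.metric hs).conn_symm hz i j k) (hm.conn_symm hz i j k))
  have he : ∀ p i j k, dM p (dtM T (fun t => conn (G t) i) t) y k j
      + dM p (dtM T (fun t => conn (G t) i) t) y j k = -2 * ric2 (ddCurv (G t) y) p i j k :=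
    fun p i j k => congrFun (congrFun (hG.ddM_dtM_metric ht hy h0 h1 p i) j) k
  have hb : ∀ p i j k, dM p (dtM T (fun t => conn (G t) i) t) y k j =
      -(ric2 (ddCurv (G t) y) p i j k + ric2 (ddCurv (G t) y) p j i k
        - ric2 (ddCurv (G t) y) p k i j) := by
    intro p i j k
    have a1 := he p i j k
    have a2 := he p j i k
    have a3 := he p k i j
    rw [hs p k i j, hs p k j i] at a3
    rw [hs p j i k] at a2
    linarith
  have e := congrFun (congrFun (hG.dtM_curv ht hy h0 i j) l) k
  rw [Matrix.sub_apply, hb, hb] at e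
  rw [dtR]
  calc _ = dtM T (fun t => curv (G t) i j) t y l k := rfl
    _ = _ := by rw [e]; ring

/-- Product rule in the nested contraction: the two curvature factors give 2⟨Rm, ∂_t Rm⟩. The metric
factors, with ∂_t g = −2 Ric and ∂_t g⁻¹ = 2 Ric at this point, give `ricTerm`. -/
lemma dt_rmSq : dt T (fun t => rmSq (G t)) t y =
    2 * S4 (fun i j k l => riem (G t) i j k l y * dtR (ddCurv (G t) y) i j k l)
      + 2 * ricTerm fun i j k l => riem (G t) i j k l y := by
  have hR : ∀ i j k l, HasDerivWithinAt (fun s => riem (G s) i j k l y)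
      (dtR (ddCurv (G t) y) i j k l) (Icc 0 T) t := fun i j k l => by
    rw [← hG.dt_riem ht hy h0 h1]
    exact (hG.ts_riem i j k l).hasDerivWithinAt ht hy
  have hGd : ∀ i a, HasDerivWithinAt (fun s => G s y i a) (dtM T G t y i a) (Icc 0 T) t :=
    fun i a => (hG.smooth i a).hasDerivWithinAt ht hy
  have hPd : ∀ i a, HasDerivWithinAt (fun s => (G s y)⁻¹ i a) ((-dtM T G t y) i a) (Icc 0 T) t :=
    fun i a => by
      rw [← hG.dtM_inv ht hy h1]
      exact (hG.ts_inv i a).hasDerivWithinAt ht hy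
  have hP1 : (G t y)⁻¹ = 1 := by rw [h1, inv_one]
  have v1 : ∀ (P : 𝕄 n) (_ : P = 1) (X : Fin n → ℝ) i, ∑ a, P i a * X a = X i := by
    rintro P rfl X i; simp [Matrix.one_apply]
  have key := HasDerivWithinAt.fun_sum (u := Finset.univ) fun i _ =>
    HasDerivWithinAt.fun_sum (u := Finset.univ) fun j _ =>
    HasDerivWithinAt.fun_sum (u := Finset.univ) fun k _ =>
    HasDerivWithinAt.fun_sum (u := Finset.univ) fun l _ => (hR i j k l).mul
      (hasDerivWithinAt_contract hP1 (hPd i) (fun a => by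
        rw [v1 _ hP1, v1 _ hP1, v1 _ h1]) fun a =>
      hasDerivWithinAt_contract hP1 (hPd j) (fun b => by rw [v1 _ hP1, v1 _ h1]) fun b =>
      hasDerivWithinAt_contract hP1 (hPd k) (fun c => by rw [v1 _ h1]) fun c =>
      hasDerivWithinAt_contract h1 (hGd l) (fun d => rfl) fun d => hR a b c d)
  have key2 : HasDerivWithinAt (fun s => rmSq (G s) y) _ (Icc 0 T) t :=
    key.congr (fun s _ => rmSq_eq_S4 (G s) y) (rmSq_eq_S4 (G t) y)
  rw [dt_eq_of_hasDerivWithinAt hG.pos ht key2]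
  rw [ricTerm, two_mul, two_mul, ← S4_add, ← S4_add, ← S4_add]
  refine S4_congr fun i j k l => ?_
  simp only [v1 _ hP1, v1 _ h1, hG.dtM_metric ht hy, Matrix.neg_apply, Matrix.of_apply]
  have hric : ∀ a b, ricci (G t) a b y = ric (fun i j k l => riem (G t) i j k l y) a b :=
    fun _ _ => rfl
  simp only [hric, Finset.sum_add_distrib, Finset.sum_sub_distrib]
  generalize ric (fun i j k l => riem (G t) i j k l y) = Q
  have c : ∀ (q : Fin n → ℝ) (X : Fin n → ℝ) (r : ℝ), ∑ s, q s * r * X s = r * ∑ s, q s * X s := by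
    intro q X r
    rw [Finset.mul_sum]; exact Finset.sum_congr rfl fun s _ => by ring
  have d : ∀ (q : Fin n → ℝ) (X : Fin n → ℝ), ∑ s, -2 * q s * X s = -2 * ∑ s, q s * X s := by
    intro q X
    rw [Finset.mul_sum]; exact Finset.sum_congr rfl fun s _ => by ring
  have d' : ∀ (q : Fin n → ℝ) (X : Fin n → ℝ), ∑ s, -(-2 * q s) * X s = 2 * ∑ s, q s * X s := by
    intro q X
    rw [Finset.mul_sum]; exact Finset.sum_congr rfl fun s _ => by ring
  simp only [c, d, d']
  ring

end IsCoordFlow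

end Coord

end

/-! ### Volume density and the Laplacian in divergence form -/

noncomputable section

namespace Coord

open scoped Matrix Topology
open CurvatureAlgebra

variable {n : ℕ}

local notation "𝔼" n => EuclideanSpace ℝ (Fin n)
local notation "𝕄" n => Matrix (Fin n) (Fin n) ℝ

/-! ### Derivative of the volume density -/

lemma hasDerivWithinAt_det_of_eq_one {M : ℝ → 𝕄 n} {M' : 𝕄 n} {I : Set ℝ} {t : ℝ} (h1 : M t = 1)
    (h : ∀ i j, HasDerivWithinAt (fun s => M s i j) (M' i j) I t) :
    HasDerivWithinAt (fun s => (M s).det) M'.trace I t := by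
  simp only [Matrix.det_apply']
  have key := HasDerivWithinAt.fun_sum (u := Finset.univ) fun (σ : Equiv.Perm (Fin n)) _ =>
    (HasDerivWithinAt.fun_finsetProd (u := Finset.univ) fun i _ => h (σ i) i).const_mul
      ((Equiv.Perm.sign σ : ℤ) : ℝ)
  refine key.congr_deriv ?_
  rw [Finset.sum_eq_single (1 : Equiv.Perm (Fin n))]
  · simp [h1, Matrix.trace]
  -- A permutation other than the identity moves at least two indices, so after one factor is
  -- differentiated another off-diagonal entry of the identity matrix still makes the product zero.
  · intro σ _ hσ
    rw [Finset.sum_eq_zero, mul_zero]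
    intro i _
    obtain ⟨j, hj⟩ : ∃ j, j ≠ i ∧ σ j ≠ j := by
      by_contra! hc
      refine hσ (Equiv.ext fun j => ?_)
      by_cases hji : j = i
      · subst hji
        by_contra hne
        have := hc (σ j) hne
        exact hne (σ.injective this)
      · exact hc j hji
    rw [Finset.prod_eq_zero (i := j) (by simp [hj.1]) (by simp [h1, hj.2]), zero_smul]
  · simp

/-- Jacobi's formula for the derivative of a determinant. -/
lemma hasDerivWithinAt_det {M : ℝ → 𝕄 n} {M' : 𝕄 n} {I : Set ℝ} {t : ℝ} (hM : (M t).det ≠ 0)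
    (h : ∀ i j, HasDerivWithinAt (fun s => M s i j) (M' i j) I t) :
    HasDerivWithinAt (fun s => (M s).det) ((M t).det * ((M t)⁻¹ * M').trace) I t := by
  have hu := isUnit_iff_ne_zero.2 hM
  have h1 := hasDerivWithinAt_det_of_eq_one (M := fun s => (M t)⁻¹ * M s) (M' := (M t)⁻¹ * M')
    (Matrix.nonsing_inv_mul _ hu) (I := I) fun i j => by
      simp only [Matrix.mul_apply]
      exact HasDerivWithinAt.fun_sum fun k _ => (h k j).const_mul _
  refine (h1.const_mul (M t).det).congr (fun s _ => ?_) ?_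
  · rw [← Matrix.det_mul, ← mul_assoc, Matrix.mul_nonsing_inv _ hu, one_mul]
  · rw [← Matrix.det_mul, ← mul_assoc, Matrix.mul_nonsing_inv _ hu, one_mul]

/-- The Riemannian volume density `√(det g_{ij})`. -/
def density (G : (𝔼 n) → 𝕄 n) (y : 𝔼 n) : ℝ := √(G y).det

lemma hasDerivWithinAt_sqrt_det {M : ℝ → 𝕄 n} {M' : 𝕄 n} {I : Set ℝ} {t : ℝ} (hM : 0 < (M t).det)
    (h : ∀ i j, HasDerivWithinAt (fun s => M s i j) (M' i j) I t) :
    HasDerivWithinAt (fun s => √(M s).det) (√(M t).det * (1 / 2 * ((M t)⁻¹ * M').trace)) I t := by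
  refine ((hasDerivWithinAt_det hM.ne' h).sqrt hM.ne').congr_deriv ?_
  have h2 := Real.sq_sqrt hM.le
  have h3 := (Real.sqrt_pos.2 hM).ne'
  field_simp
  linear_combination (-((M t)⁻¹ * M').trace) * h2

lemma hasDerivAt_line {f : (𝔼 n) → ℝ} {y : 𝔼 n} (hf : DifferentiableAt ℝ f y) (i : Fin n) :
    HasDerivAt (fun s : ℝ => f (y + s • EuclideanSpace.single i (1 : ℝ))) (pd i f y) 0 :=
  hf.hasFDerivAt.hasLineDerivAt _

namespace IsMetricOn

variable {G : (𝔼 n) → 𝕄 n} {V : Set (𝔼 n)} (hG : IsMetricOn G V) {y : 𝔼 n} (hy : y ∈ V)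
include hG hy

lemma smooth_density : ContDiffAt ℝ ∞ (density G) y :=
  (hG.smooth y hy).det.sqrt (hG.det_ne hy)

lemma pd_density (i : Fin n) : pd i (density G) y = density G y * (conn G i y).trace := by
  have h1 := hasDerivAt_line ((hG.smooth_density hy).differentiableAt (by simp)) i
  have h2 := hasDerivWithinAt_sqrt_det (M := fun s : ℝ => G (y + s • EuclideanSpace.single i (1 : ℝ)))
    (M' := dM i G y) (I := univ) (t := 0)
    (by simpa using (hG.posDef y hy).det_pos) fun k l => by
      rw [hasDerivWithinAt_univ]
      exact hasDerivAt_line ((hG.smooth y hy).diff k l) i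
  rw [hasDerivWithinAt_univ] at h2
  have := h1.unique h2
  simp only [zero_smul, add_zero] at this
  have e1 : ((G y)⁻¹ * ((conn G i y)ᵀ * G y)).trace = (conn G i y).trace := by
    rw [Matrix.trace_mul_comm, mul_assoc, Matrix.mul_nonsing_inv _ (hG.isUnit_det hy), mul_one,
      Matrix.trace_transpose]
  have e2 : (G y)⁻¹ * (G y * conn G i y) = conn G i y := by
    rw [← mul_assoc, Matrix.nonsing_inv_mul _ (hG.isUnit_det hy), one_mul]
  rw [this, hG.dM_metric hy, density, mul_add (G y)⁻¹, Matrix.trace_add, e1, e2]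
  ring

lemma dM_inverse (i : Fin n) : dM i (fun z => (G z)⁻¹) y =
    -(conn G i y * (G y)⁻¹ + (G y)⁻¹ * (conn G i y)ᵀ) := by
  have h1 := Matrix.mul_nonsing_inv _ (hG.isUnit_det hy)
  have h2 := Matrix.nonsing_inv_mul _ (hG.isUnit_det hy)
  rw [dM_inv (hG.smooth y hy) (hG.det_ne hy), hG.dM_metric hy]
  congr 1
  calc _ = (G y)⁻¹ * (conn G i y)ᵀ * (G y * (G y)⁻¹) + (G y)⁻¹ * G y * conn G i y * (G y)⁻¹ := by
        noncomm_ring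
    _ = _ := by rw [h1, h2]; noncomm_ring

/-- The Laplacian in divergence form. -/
lemma div_eq {f h : (𝔼 n) → ℝ} (hf : ContDiffAt ℝ ∞ f y) (hh : ContDiffAt ℝ ∞ h y) :
    ∑ i, pd i (fun z => f z * (density G z * ∑ j, (G z)⁻¹ i j * pd j h z)) y =
      density G y * (gradInner G f h y + f y * laplacian G h y) := by
  have d : ∀ {k : (𝔼 n) → ℝ}, ContDiffAt ℝ ∞ k y → DifferentiableAt ℝ k y :=
    fun hk => hk.differentiableAt (by simp)
  have hP := hG.smooth_inv hy
  have hρ := hG.smooth_density hy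
  have hs : ∀ i j, ContDiffAt ℝ ∞ (fun z => (G z)⁻¹ i j * pd j h z) y := fun i j =>
    (hP i j).mul (contDiffAt_pd hh)
  have hS : ∀ i, ContDiffAt ℝ ∞ (fun z => ∑ j, (G z)⁻¹ i j * pd j h z) y := fun i =>
    ContDiffAt.sum fun j _ => hs i j
  have e1 : ∀ i, pd i (fun z => f z * (density G z * ∑ j, (G z)⁻¹ i j * pd j h z)) y =
      density G y * ((∑ j, (G y)⁻¹ i j * pd i f y * pd j h y) + f y * (
        ∑ j, (conn G i y).trace * ((G y)⁻¹ i j * pd j h y) +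
        ∑ j, ((dM i (fun z => (G z)⁻¹) y) i j * pd j h y + (G y)⁻¹ i j * pd i (pd j h) y))) := by
    intro i
    rw [pd_mul (d hf) (d (hρ.mul (hS i))), pd_mul (d hρ) (d (hS i)), hG.pd_density hy,
      pd_sum _ fun j _ => d (hs i j)]
    have : ∀ j, pd i (fun z => (G z)⁻¹ i j * pd j h z) y = dM i (fun z => (G z)⁻¹) y i j * pd j h y
        + (G y)⁻¹ i j * pd i (pd j h) y := fun j => pd_mul (d (hP i j)) (d (contDiffAt_pd hh))
    simp only [this, ← Finset.mul_sum]
    have e : ∑ j, (G y)⁻¹ i j * pd i f y * pd j h y = pd i f y * ∑ j, (G y)⁻¹ i j * pd j h y := by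
      rw [Finset.mul_sum]; exact Finset.sum_congr rfl fun j _ => by ring
    rw [e]; ring
  have ht : ∀ m, ∑ i, conn G i y i m = (conn G m y).trace := fun m =>
    Finset.sum_congr rfl fun i _ => hG.conn_symm hy i m i
  -- The divergence of g^{ij} produces minus the trace Γ^m_{im}, which cancels the derivative of the
  -- density, and the term −g^{ij} Γ^k_{ij} ∂_k h of the Laplacian.
  have e2 : ∑ i, ∑ j, (dM i (fun z => (G z)⁻¹) y) i j * pd j h y =
      - ∑ i, ∑ j, (conn G i y).trace * ((G y)⁻¹ i j * pd j h y)
      - ∑ i, ∑ j, (G y)⁻¹ i j * ∑ k, christoffel G k i j y * pd k h y := by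
    have a1 : ∑ i, ∑ j, (conn G i y * (G y)⁻¹) i j * pd j h y
        = ∑ i, ∑ j, (conn G i y).trace * ((G y)⁻¹ i j * pd j h y) := by
      simp only [Matrix.mul_apply, Finset.sum_mul]
      calc _ = ∑ i, ∑ m, ∑ j, conn G i y i m * (G y)⁻¹ m j * pd j h y :=
            Finset.sum_congr rfl fun i _ => Finset.sum_comm
        _ = ∑ m, ∑ i, ∑ j, conn G i y i m * (G y)⁻¹ m j * pd j h y := Finset.sum_comm
        _ = ∑ m, ∑ j, ∑ i, conn G i y i m * (G y)⁻¹ m j * pd j h y :=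
            Finset.sum_congr rfl fun i _ => Finset.sum_comm
        _ = _ := by
            refine Finset.sum_congr rfl fun m _ => Finset.sum_congr rfl fun j _ => ?_
            rw [← ht, Finset.sum_mul]
            exact Finset.sum_congr rfl fun i _ => by ring
    have a2 : ∑ i, ∑ j, ((G y)⁻¹ * (conn G i y)ᵀ) i j * pd j h y
        = ∑ i, ∑ j, (G y)⁻¹ i j * ∑ k, christoffel G k i j y * pd k h y := by
      refine Finset.sum_congr rfl fun i _ => ?_
      simp only [Matrix.mul_apply, Finset.sum_mul, Finset.mul_sum]
      rw [Finset.sum_comm]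
      refine Finset.sum_congr rfl fun j _ => Finset.sum_congr rfl fun k _ => ?_
      simp only [Matrix.transpose_apply, conn, Matrix.of_apply]; ring
    rw [← a1, ← a2, ← Finset.sum_neg_distrib, ← Finset.sum_sub_distrib]
    refine Finset.sum_congr rfl fun i _ => ?_
    rw [← Finset.sum_neg_distrib, ← Finset.sum_sub_distrib]
    refine Finset.sum_congr rfl fun j _ => ?_
    rw [hG.dM_inverse hy, Matrix.neg_apply, Matrix.add_apply]; ring
  simp only [e1, ← Finset.mul_sum, Finset.sum_add_distrib]
  simp only [Finset.mul_sum] at e2 ⊢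
  simp only [← Finset.mul_sum] at e2 ⊢
  rw [e2]
  simp only [gradInner, laplacian, mul_sub, Finset.sum_sub_distrib, Finset.mul_sum]
  simp only [← Finset.mul_sum]
  ring

end IsMetricOn

lemma IsCoordFlow.dt_density {G : ℝ → (𝔼 n) → 𝕄 n} {T : ℝ} {V : Set (𝔼 n)} (hG : IsCoordFlow G T V)
    {t : ℝ} (ht : t ∈ Icc 0 T) {y : 𝔼 n} (hy : y ∈ V) :
    HasDerivWithinAt (fun s => density (G s) y) (- (density (G t) y * scal (G t) y)) (Icc 0 T) t := by
  refine (hasDerivWithinAt_sqrt_det ((hG.posDef t ht y hy).det_pos)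
    (M' := Matrix.of fun i j => -2 * ricci (G t) i j y) (hG.flow t ht y hy)).congr_deriv ?_
  have : ((G t y)⁻¹ * Matrix.of fun i j => -2 * ricci (G t) i j y).trace = -2 * scal (G t) y := by
    simp only [Matrix.trace, Matrix.diag_apply, Matrix.mul_apply, Matrix.of_apply, scal,
      Finset.mul_sum]
    rw [Finset.sum_comm]
    refine Finset.sum_congr rfl fun i _ => Finset.sum_congr rfl fun j _ => ?_
    rw [(hG.metric ht).inv_symm hy]; ring
  rw [this, density]; ring

end Coord

end

/-! ### First-order normal coordinates and the evolution inequality in a chart -/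

noncomputable section

namespace Coord

open scoped Matrix Topology
open CurvatureAlgebra

variable {n : ℕ}

local notation "𝔼" n => EuclideanSpace ℝ (Fin n)
local notation "𝕄" n => Matrix (Fin n) (Fin n) ℝ

/-! ### Normal coordinates to first order -/

open scoped MatrixOrder in
-- Factor the positive definite matrix as BᵀB and take L = B⁻¹.
lemma exists_transpose_mul_mul_eq_one {G₀ : 𝕄 n} (h : G₀.PosDef) :
    ∃ L : 𝕄 n, L.det ≠ 0 ∧ Lᵀ * G₀ * L = 1 := by
  obtain ⟨B, rfl⟩ := CStarAlgebra.nonneg_iff_eq_star_mul_self.mp h.posSemidef.nonneg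
  rw [Matrix.star_eq_conjTranspose, Matrix.conjTranspose_eq_transpose_of_trivial] at *
  have hB : B.det ≠ 0 := by
    intro h0
    have := h.det_pos
    rw [Matrix.det_mul, h0, mul_zero] at this
    exact lt_irrefl _ this
  have hu := isUnit_iff_ne_zero.2 hB
  refine ⟨B⁻¹, ?_, ?_⟩
  · rw [Matrix.det_nonsing_inv, Ring.inverse_eq_inv']; exact inv_ne_zero hB
  · have h1 := Matrix.mul_nonsing_inv _ hu
    have h2 : (B⁻¹)ᵀ * Bᵀ = 1 := by rw [← Matrix.transpose_mul, h1, Matrix.transpose_one]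
    calc _ = ((B⁻¹)ᵀ * Bᵀ) * (B * B⁻¹) := by simp only [mul_assoc]
      _ = 1 := by rw [h1, h2, one_mul]

/-- The quadratic map `z ↦ y + L z - S(z,z) / 2`. -/
def quadMap (y : 𝔼 n) (L : 𝕄 n) (S : Fin n → Fin n → Fin n → ℝ) (z : 𝔼 n) : 𝔼 n :=
  WithLp.toLp 2 fun c => y c + ∑ i, L c i * z i - 1 / 2 * ∑ i, ∑ j, S c i j * (z i * z j)

section QuadMap

variable (y : 𝔼 n) (L : 𝕄 n) {S : Fin n → Fin n → Fin n → ℝ}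

lemma contDiff_quadMap : ContDiff ℝ ∞ (quadMap y L S) := by
  rw [contDiff_euclidean]
  intro c
  have hz : ∀ i : Fin n, ContDiff ℝ ∞ fun z : 𝔼 n => z i := fun i =>
    (EuclideanSpace.proj i : (𝔼 n) →L[ℝ] ℝ).contDiff
  change ContDiff ℝ ∞ fun z : 𝔼 n =>
    y c + ∑ i, L c i * z i - 1 / 2 * ∑ i, ∑ j, S c i j * (z i * z j)
  exact (contDiff_const.add (ContDiff.sum fun i _ => contDiff_const.mul (hz i))).sub
    (contDiff_const.mul (ContDiff.sum fun i _ => ContDiff.sum fun j _ =>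
      contDiff_const.mul ((hz i).mul (hz j))))

lemma quadMap_zero : quadMap y L S 0 = y := by
  ext c; simp [quadMap]

lemma pd_coord (k i : Fin n) (z : 𝔼 n) : pd k (fun z : 𝔼 n => z i) z = if i = k then 1 else 0 := by
  have : (fun z : 𝔼 n => z i) = (EuclideanSpace.proj i : (𝔼 n) →L[ℝ] ℝ) := rfl
  rw [pd, this, ContinuousLinearMap.fderiv]
  simp

lemma jac_quadMap (hS : ∀ c i j, S c i j = S c j i) (z : 𝔼 n) (c k : Fin n) :
    jac (quadMap y L S) z c k = L c k - ∑ j, S c k j * z j := by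
  have hz : ∀ i : Fin n, DifferentiableAt ℝ (fun z : 𝔼 n => z i) z := fun i =>
    (EuclideanSpace.proj i : (𝔼 n) →L[ℝ] ℝ).differentiableAt
  change pd k (fun z : 𝔼 n =>
    y c + ∑ i, L c i * z i - 1 / 2 * ∑ i, ∑ j, S c i j * (z i * z j)) z = _
  have h1 : ∀ i, DifferentiableAt ℝ (fun z : 𝔼 n => L c i * z i) z := fun i => (hz i).const_mul _
  have h2 : ∀ i j, DifferentiableAt ℝ (fun z : 𝔼 n => S c i j * (z i * z j)) z := fun i j =>
    ((hz i).fun_mul (hz j)).const_mul _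
  have h3 : ∀ i, DifferentiableAt ℝ (fun z : 𝔼 n => ∑ j, S c i j * (z i * z j)) z := fun i =>
    DifferentiableAt.fun_sum fun j _ => h2 i j
  have h4 : DifferentiableAt ℝ (fun z : 𝔼 n => ∑ i, ∑ j, S c i j * (z i * z j)) z :=
    DifferentiableAt.fun_sum fun i _ => h3 i
  have h5 : DifferentiableAt ℝ (fun z : 𝔼 n => ∑ i, L c i * z i) z :=
    DifferentiableAt.fun_sum fun i _ => h1 i
  rw [pd_sub (h5.const_add _) (h4.const_mul _), pd_add (by fun_prop) h5, pd_const,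
    pd_sum _ fun i _ => h1 i, pd_const_mul _ h4, pd_sum _ fun i _ => h3 i]
  have e1 : ∀ i, pd k (fun z : 𝔼 n => L c i * z i) z = L c i * if i = k then 1 else 0 := fun i => by
    rw [pd_const_mul _ (hz i), pd_coord]
  have e2 : ∀ i, pd k (fun z : 𝔼 n => ∑ j, S c i j * (z i * z j)) z =
      ∑ j, S c i j * ((if i = k then 1 else 0) * z j + z i * if j = k then 1 else 0) := fun i => by
    rw [pd_sum _ fun j _ => h2 i j]
    exact Finset.sum_congr rfl fun j _ => by
      rw [pd_const_mul _ ((hz i).fun_mul (hz j)), pd_mul (hz i) (hz j), pd_coord, pd_coord]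
  simp only [e1, e2, mul_add, Finset.sum_add_distrib, mul_ite, mul_one, mul_zero, ite_mul, one_mul,
    zero_mul, Finset.sum_ite_eq', Finset.mem_univ, if_true, zero_add]
  have e3 : ∑ i, ∑ j, (if i = k then S c i j * z j else 0) = ∑ j, S c k j * z j := by
    rw [Finset.sum_comm]; simp
  have e4 : ∑ i, S c i k * z i = ∑ j, S c k j * z j :=
    Finset.sum_congr rfl fun i _ => by rw [hS]
  rw [e3, e4]; ring

end QuadMap

/-- Around any point there are coordinates with `g_{ij} = δ_{ij}` and `Γ^k_{ij} = 0` at the point. -/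
lemma IsMetricOn.exists_normal {G : (𝔼 n) → 𝕄 n} {V : Set (𝔼 n)} (hG : IsMetricOn G V) {y : 𝔼 n}
    (hy : y ∈ V) : ∃ (ψ : (𝔼 n) → 𝔼 n) (W : Set (𝔼 n)), IsCoordChange ψ W V ∧ 0 ∈ W ∧ ψ 0 = y ∧
      ∀ G' : (𝔼 n) → 𝕄 n, (∀ w ∈ W, G' w = (jac ψ w)ᵀ * G (ψ w) * jac ψ w) →
        G' 0 = 1 ∧ ∀ i, conn G' i 0 = 0 := by
  obtain ⟨L, hL, hL1⟩ := exists_transpose_mul_mul_eq_one (hG.posDef y hy)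
  -- The quadratic part is Γ at y evaluated on the columns of L. Then ∂_i J = −S at the origin,
  -- which cancels the term Γ L L in the transformation law of the connection.
  set S : Fin n → Fin n → Fin n → ℝ := fun c i j =>
    ∑ a, ∑ b, christoffel G c a b y * (L a i * L b j) with hSdef
  have hS : ∀ c i j, S c i j = S c j i := by
    intro c i j
    simp only [hSdef]
    rw [Finset.sum_comm]
    refine Finset.sum_congr rfl fun a _ => Finset.sum_congr rfl fun b _ => ?_
    have : christoffel G c b a y = christoffel G c a b y := hG.conn_symm hy b a c
    rw [this]; ring
  set ψ := quadMap y L S with hψ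
  have hψs : ContDiff ℝ ∞ ψ := contDiff_quadMap y L
  have hψ0 : ψ 0 = y := quadMap_zero y L
  have hj0 : jac ψ 0 = L := by
    ext c k
    rw [jac_quadMap y L hS]; simp
  have hjc : Continuous fun z => (jac ψ z).det := by
    refine Continuous.matrix_det (continuous_matrix fun c k => ?_)
    simp only [hψ, jac_quadMap y L hS]
    exact continuous_const.sub (continuous_finsetSum _ fun j _ =>
      continuous_const.mul (EuclideanSpace.proj j : (𝔼 n) →L[ℝ] ℝ).continuous)
  -- Only an invertible differential is needed, not injectivity of ψ, so no inverse function theorem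
  -- is invoked.
  set W := ψ ⁻¹' V ∩ {z | (jac ψ z).det ≠ 0} with hW
  have hc : IsCoordChange ψ W V :=
    { isOpen := (hG.isOpen.preimage hψs.continuous).inter (isOpen_ne_fun hjc continuous_const)
      smooth := fun w _ => hψs.contDiffAt
      mapsTo := fun w hw => hw.1
      det_ne := fun w hw => hw.2 }
  have h0W : (0 : 𝔼 n) ∈ W := ⟨by simpa [hψ0] using hy, by simpa [hj0] using hL⟩
  refine ⟨ψ, W, hc, h0W, hψ0, fun G' hG' => ⟨by rw [hG' 0 h0W, hψ0, hj0, hL1], fun i => ?_⟩⟩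
  have hp : IsPullback ψ W V G G' := ⟨hc, hG, hG'⟩
  have e := hp.jac_mul_conn h0W i
  rw [hψ0, hj0] at e
  have hz : dM i (jac ψ) 0 + (∑ a, L a i • conn G a y) * L = 0 := by
    ext c j
    have h1 : dM i (jac ψ) 0 c j = - S c j i := by
      have hz : ∀ i : Fin n, DifferentiableAt ℝ (fun z : 𝔼 n => z i) 0 := fun i =>
        (EuclideanSpace.proj i : (𝔼 n) →L[ℝ] ℝ).differentiableAt
      change pd i (fun z => jac ψ z c j) 0 = _
      simp only [hψ, jac_quadMap y L hS]
      have h2 : ∀ k, DifferentiableAt ℝ (fun z : 𝔼 n => S c j k * z k) 0 := fun k =>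
        (hz k).const_mul _
      rw [pd_sub (by fun_prop) (DifferentiableAt.fun_sum fun k _ => h2 k), pd_const,
        pd_sum _ fun k _ => h2 k]
      simp only [pd_const_mul _ (hz _), pd_coord]
      simp
    rw [Matrix.add_apply, h1, hS c j i]
    simp only [hSdef, Matrix.mul_apply, Matrix.sum_apply, Matrix.smul_apply, smul_eq_mul, conn,
      Matrix.of_apply, Finset.sum_mul, Matrix.zero_apply]
    rw [Finset.sum_comm, neg_add_eq_zero]
    refine Finset.sum_congr rfl fun b _ => Finset.sum_congr rfl fun a _ => by ring
  rw [hz] at e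
  calc conn G' i 0 = L⁻¹ * (L * conn G' i 0) := by
        rw [← mul_assoc, Matrix.nonsing_inv_mul _ (isUnit_iff_ne_zero.2 hL), one_mul]
    _ = 0 := by rw [e, mul_zero]

lemma laplacian_congr {G : (𝔼 n) → 𝕄 n} {f h : (𝔼 n) → ℝ} {y : 𝔼 n} (e : f =ᶠ[𝓝 y] h) :
    laplacian G f y = laplacian G h y := by
  have e1 : ∀ j, pd j f =ᶠ[𝓝 y] pd j h := fun j => e.eventuallyEq_nhds.mono fun z hz => pd_congr hz
  simp only [laplacian, fun i j => pd_congr (i := i) (e1 j), fun k => pd_congr (i := k) e]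

lemma gradInner_congr {G : (𝔼 n) → 𝕄 n} {f f' h h' : (𝔼 n) → ℝ} {y : 𝔼 n} (e : f =ᶠ[𝓝 y] f')
    (e' : h =ᶠ[𝓝 y] h') : gradInner G f h y = gradInner G f' h' y := by
  simp only [gradInner, fun i => pd_congr (i := i) e, fun i => pd_congr (i := i) e']

lemma gradSq_eq_gradInner (G : (𝔼 n) → 𝕄 n) (f : (𝔼 n) → ℝ) : gradSq G f = gradInner G f f := rfl

namespace IsCoordFlow

variable {G : ℝ → (𝔼 n) → 𝕄 n} {T : ℝ} {V : Set (𝔼 n)} (hG : IsCoordFlow G T V)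
  {t : ℝ} (ht : t ∈ Icc 0 T) {y : 𝔼 n} (hy : y ∈ V)
include hG ht hy

/-- The evolution of `|Rm|²` at a point where `g_{ij} = δ_{ij}` and `Γ^k_{ij} = 0`. -/
lemma evolution_of_normal (h1 : G t y = 1) (h0 : ∀ i, conn (G t) i y = 0) :
    0 ≤ rmSq (G t) y ∧ scal (G t) y ^ 2 ≤ n ^ 2 * rmSq (G t) y ∧ ∃ N, 0 ≤ N ∧
      gradSq (G t) (rmSq (G t)) y ≤ 2 * rmSq (G t) y * N ∧
      dt T (fun s => rmSq (G s)) t y ≤ laplacian (G t) (rmSq (G t)) y - N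
        + 16 * (rmSq (G t) y * √(rmSq (G t) y)) := by
  have hm := hG.metric ht
  refine ⟨?_, scal_sq_le h1, 2 * ∑ p, S4 fun i j k l => pd p (riem (G t) i j k l) y ^ 2, ?_,
    hm.gradSq_rmSq_le hy h0 h1, ?_⟩
  · rw [rmSq_of_eq_one h1]; exact S4_nonneg fun i j k l => sq_nonneg _
  · exact mul_nonneg zero_le_two (Finset.sum_nonneg fun p _ => S4_nonneg fun i j k l => sq_nonneg _)
  · rw [hG.dt_rmSq ht hy h0 h1, hm.laplacian_rmSq hy h0 h1, rmSq_of_eq_one h1]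
    have := evolution_le (hm.curvLike_riem hy h1) (hm.curvLike_ddCurv hy h0 h1)
      (fun r p i j k l => hm.ddCurv_bianchi hy h0 r p i j k l)
      (fun p q j m k l => hm.ddCurv_comm hy h0 p q j m k l)
    linarith

/-- The evolution inequality for `|Rm|²` under Ricci flow. -/
theorem evolution :
    0 ≤ rmSq (G t) y ∧ scal (G t) y ^ 2 ≤ n ^ 2 * rmSq (G t) y ∧ ∃ N, 0 ≤ N ∧
      gradSq (G t) (rmSq (G t)) y ≤ 2 * rmSq (G t) y * N ∧
      dt T (fun s => rmSq (G s)) t y ≤ laplacian (G t) (rmSq (G t)) y - N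
        + 16 * (rmSq (G t) y * √(rmSq (G t) y)) := by
  -- The coordinates are normal for the metric at the chosen time t but are kept fixed in time, so
  -- the whole pulled back family is again a Ricci flow and ∂_t is unaffected. The quantity N needs
  -- no transformation law, since only its existence at the point is asserted.
  obtain ⟨ψ, W, hψ, h0W, hψ0, hn⟩ := (hG.metric ht).exists_normal hy
  set G' : ℝ → (𝔼 n) → 𝕄 n := fun s w => (jac ψ w)ᵀ * G s (ψ w) * jac ψ w with hG'
  have hflow : IsCoordFlow G' T W := hG.pullback hψ fun s _ w _ => rfl
  have hp : ∀ s ∈ Icc 0 T, IsPullback ψ W V (G s) (G' s) := fun s hs =>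
    ⟨hψ, hG.metric hs, fun w _ => rfl⟩
  obtain ⟨h1, h0⟩ := hn (G' t) fun w _ => rfl
  have key := hflow.evolution_of_normal ht h0W h1 h0
  have hev : rmSq (G' t) =ᶠ[𝓝 0] fun z => rmSq (G t) (ψ z) := by
    filter_upwards [hψ.isOpen.mem_nhds h0W] with z hz using (hp t ht).rmSq_eq hz
  have hsm : ∀ v ∈ V, ContDiffAt ℝ ∞ (rmSq (G t)) v := fun v hv =>
    hG.ts_rmSq.contDiffAt hG.isOpen ht hv
  have e1 : rmSq (G' t) 0 = rmSq (G t) y := by rw [(hp t ht).rmSq_eq h0W, hψ0]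
  have e2 : scal (G' t) 0 = scal (G t) y := by rw [(hp t ht).scal_eq h0W, hψ0]
  have e3 : gradSq (G' t) (rmSq (G' t)) 0 = gradSq (G t) (rmSq (G t)) y := by
    rw [gradSq_eq_gradInner, gradInner_congr hev hev, (hp t ht).gradInner_eq h0W
      (hsm _ (by rwa [hψ0])) (hsm _ (by rwa [hψ0])), hψ0, gradSq_eq_gradInner]
  have e4 : laplacian (G' t) (rmSq (G' t)) 0 = laplacian (G t) (rmSq (G t)) y := by
    rw [laplacian_congr hev, (hp t ht).laplacian_eq h0W hsm, hψ0]
  have e5 : dt T (fun s => rmSq (G' s)) t 0 = dt T (fun s => rmSq (G s)) t y := by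
    refine derivWithin_congr (fun s hs => ?_) ?_
    · change rmSq (G' s) 0 = rmSq (G s) y
      rw [(hp s hs).rmSq_eq h0W, hψ0]
    · exact e1
  rwa [e1, e2, e3, e4, e5] at key

end IsCoordFlow

end Coord

end

/-! ### From charts to the manifold: transition maps and independence of the chart -/

noncomputable section

open scoped Matrix Topology

namespace Coord

variable {n : ℕ}

local notation "𝔼" n => EuclideanSpace ℝ (Fin n)
local notation "𝕄" n => Matrix (Fin n) (Fin n) ℝ

namespace IsMetricOn

variable {G : (𝔼 n) → 𝕄 n} {V : Set (𝔼 n)} {f h : (𝔼 n) → ℝ} {y : 𝔼 n}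

lemma contDiffAt_gradInner (hG : IsMetricOn G V) (hy : y ∈ V) (hf : ∀ v ∈ V, ContDiffAt ℝ ∞ f v)
    (hh : ∀ v ∈ V, ContDiffAt ℝ ∞ h v) : ContDiffAt ℝ ∞ (gradInner G f h) y := by
  unfold gradInner
  exact ContDiffAt.sum fun i _ => ContDiffAt.sum fun j _ => ((hG.smooth_inv hy i j).mul
    (contDiffAt_pd (hf y hy))).mul (contDiffAt_pd (hh y hy))

lemma contDiffAt_laplacian (hG : IsMetricOn G V) (hy : y ∈ V)
    (hf : ∀ v ∈ V, ContDiffAt ℝ ∞ f v) : ContDiffAt ℝ ∞ (laplacian G f) y := by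
  unfold laplacian
  exact ContDiffAt.sum fun i _ => ContDiffAt.sum fun j _ => (hG.smooth_inv hy i j).mul
    ((contDiffAt_pd (contDiffAt_pd (hf y hy))).sub
      (ContDiffAt.sum fun k _ => (hG.smooth_conn hy i k j).mul (contDiffAt_pd (hf y hy))))

end IsMetricOn

end Coord

section ManifoldCoordinates

variable {n : ℕ} {M : Type*} [TopologicalSpace M] [ChartedSpace (EuclideanSpace ℝ (Fin n)) M]
  [IsManifold (𝓡 n) ∞ M]

local notation "𝔼" n => EuclideanSpace ℝ (Fin n)
local notation "𝕄" n => Matrix (Fin n) (Fin n) ℝ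

namespace RMetric

/-- The inner product of `g` on the tangent space at `x`, identified with `ℝⁿ`. -/
def ip (g : RMetric n M) (x : M) (v w : 𝔼 n) : ℝ := g.inner x v w

/-- The differential of the inverse chart at `p`. -/
def dsymm (p : M) (y : 𝔼 n) : (𝔼 n) →L[ℝ] (𝔼 n) :=
  mfderiv 𝓘(ℝ, 𝔼 n) (𝓡 n) (extChartAt (𝓡 n) p).symm y

lemma coeff_eq (g : RMetric n M) (p : M) (y : 𝔼 n) (i j : Fin n) : g.coeff p y i j =
    g.ip ((extChartAt (𝓡 n) p).symm y) (dsymm p y (EuclideanSpace.single i 1))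
      (dsymm p y (EuclideanSpace.single j 1)) := rfl

lemma ip_add_left (g : RMetric n M) (x : M) (u v w : 𝔼 n) :
    g.ip x (u + v) w = g.ip x u w + g.ip x v w := by
  have := (g.inner x).map_add u v
  exact DFunLike.congr_fun this w

lemma ip_smul_left (g : RMetric n M) (x : M) (c : ℝ) (v w : 𝔼 n) :
    g.ip x (c • v) w = c * g.ip x v w := by
  have := (g.inner x).map_smul c v
  exact DFunLike.congr_fun this w

lemma ip_symm (g : RMetric n M) (x : M) (v w : 𝔼 n) : g.ip x v w = g.ip x w v := g.symm x v w

lemma ip_sum_left (g : RMetric n M) (x : M) {κ : Type*} (s : Finset κ) (c : κ → ℝ) (v : κ → 𝔼 n)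
    (w : 𝔼 n) : g.ip x (∑ k ∈ s, c k • v k) w = ∑ k ∈ s, c k * g.ip x (v k) w := by
  classical
  induction s using Finset.induction_on with
  | empty =>
    have := g.ip_smul_left x 0 0 w
    simpa using this
  | insert a s ha ih => rw [Finset.sum_insert ha, Finset.sum_insert ha, ip_add_left, ip_smul_left, ih]

lemma ip_sum_sum (g : RMetric n M) (x : M) (c d : Fin n → ℝ) (v w : Fin n → 𝔼 n) :
    g.ip x (∑ a, c a • v a) (∑ b, d b • w b) = ∑ a, ∑ b, c a * d b * g.ip x (v a) (w b) := by
  rw [ip_sum_left]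
  refine Finset.sum_congr rfl fun a _ => ?_
  rw [ip_symm, ip_sum_left, Finset.mul_sum]
  exact Finset.sum_congr rfl fun b _ => by rw [ip_symm]; ring

lemma clm_eq_sum (A : (𝔼 n) →L[ℝ] (𝔼 n)) (v : 𝔼 n) :
    A v = ∑ i, v i • A (EuclideanSpace.single i 1) := by
  conv_lhs => rw [show v = ∑ a, v a • EuclideanSpace.single a (1 : ℝ) by
    ext k; simp [Finset.sum_apply, Pi.single_apply]]
  simp

lemma dsymm_injective {p : M} {y : 𝔼 n} (hy : y ∈ (extChartAt (𝓡 n) p).target) :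
    Function.Injective (dsymm (M := M) p y) := by
  have h := isInvertible_mfderivWithin_extChartAt_symm hy
  rw [ModelWithCorners.range_eq_univ, mfderivWithin_univ] at h
  exact h.injective

/-- The coefficients of a metric are positive definite in each chart. -/
lemma coeff_posDef (g : RMetric n M) {p : M} {y : 𝔼 n} (hy : y ∈ (extChartAt (𝓡 n) p).target) :
    (g.coeff p y).PosDef := by
  refine Matrix.PosDef.of_dotProduct_mulVec_pos ?_ fun x hx => ?_
  · ext i j
    simp only [Matrix.conjTranspose_apply, star_trivial, coeff_eq]
    rw [ip_symm]
  · have h1 : star x ⬝ᵥ (g.coeff p y).mulVec x = g.ip ((extChartAt (𝓡 n) p).symm y)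
        (dsymm p y (WithLp.toLp 2 x)) (dsymm p y (WithLp.toLp 2 x)) := by
      rw [clm_eq_sum, ip_sum_sum]
      simp only [dotProduct, Matrix.mulVec, Finset.mul_sum, star_trivial, coeff_eq]
      exact Finset.sum_congr rfl fun i _ => Finset.sum_congr rfl fun j _ => by simp; ring
    rw [h1]
    refine g.pos _ _ fun h => hx ?_
    have := dsymm_injective hy (h.trans (map_zero (dsymm p y)).symm)
    simpa using congrArg WithLp.ofLp this

/-- The coefficients of `g` are smooth in each chart. -/
def SmoothCoeff (g : RMetric n M) : Prop :=
  ∀ p, Coord.IsMetricOn (g.coeff p) (extChartAt (𝓡 n) p).target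

/-- The transition map from the chart at `p` to the chart at `q`. -/
def trans (p q : M) (y : 𝔼 n) : 𝔼 n := extChartAt (𝓡 n) q ((extChartAt (𝓡 n) p).symm y)

/-- The domain of the transition map from the chart at `p` to the chart at `q`. -/
def transDom (p q : M) : Set (𝔼 n) :=
  (extChartAt (𝓡 n) p).target ∩ (extChartAt (𝓡 n) p).symm ⁻¹' (extChartAt (𝓡 n) q).source

omit [IsManifold (𝓡 n) ∞ M] in
lemma isOpen_transDom (p q : M) : IsOpen (transDom (n := n) p q) :=
  (continuousOn_extChartAt_symm p).isOpen_inter_preimage (isOpen_extChartAt_target p)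
    (isOpen_extChartAt_source q)

lemma contDiffAt_trans {p q : M} {y : 𝔼 n} (hy : y ∈ transDom p q) :
    ContDiffAt ℝ ∞ (trans (n := n) p q) y := by
  refine (contDiffOn_ext_coord_change q p).contDiffAt ?_
  rw [PartialEquiv.trans_source, PartialEquiv.symm_source]
  exact (isOpen_transDom p q).mem_nhds hy

lemma contMDiffAt_symm {p : M} {y : 𝔼 n} (hy : y ∈ (extChartAt (𝓡 n) p).target) :
    ContMDiffAt 𝓘(ℝ, 𝔼 n) (𝓡 n) ∞ (extChartAt (𝓡 n) p).symm y :=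
  (contMDiffOn_extChartAt_symm p).contMDiffAt ((isOpen_extChartAt_target p).mem_nhds hy)

lemma dsymm_trans {p q : M} {y : 𝔼 n} (hy : y ∈ transDom p q) (v : 𝔼 n) :
    dsymm p y v = dsymm q (trans p q y) (fderiv ℝ (trans p q) y v) := by
  have h1 : (extChartAt (𝓡 n) p).symm =ᶠ[𝓝 y] (extChartAt (𝓡 n) q).symm ∘ trans p q := by
    filter_upwards [(isOpen_transDom p q).mem_nhds hy] with z hz
    exact ((extChartAt (𝓡 n) q).left_inv hz.2).symm
  have h2 : trans p q y ∈ (extChartAt (𝓡 n) q).target := (extChartAt (𝓡 n) q).map_source hy.2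
  have h3 := mfderiv_comp y ((contMDiffAt_symm h2).mdifferentiableAt (by simp))
    ((contDiffAt_trans hy).contMDiffAt.mdifferentiableAt (by simp))
  rw [← h1.mfderiv_eq, mfderiv_eq_fderiv] at h3
  exact DFunLike.congr_fun h3 v

/-- The chain rule for the inverse charts: the coordinate vectors of one chart are combinations of
those of the other, with the Jacobian of the transition map as coefficients. -/
lemma coeff_trans (g : RMetric n M) {p q : M} {y : 𝔼 n} (hy : y ∈ transDom p q) :
    g.coeff p y = (Coord.jac (trans p q) y)ᵀ * g.coeff q (trans p q y) * Coord.jac (trans p q) y := by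
  ext i j
  have h2 : (extChartAt (𝓡 n) q).symm (trans p q y) = (extChartAt (𝓡 n) p).symm y :=
    (extChartAt (𝓡 n) q).left_inv hy.2
  rw [coeff_eq, dsymm_trans hy, dsymm_trans hy, clm_eq_sum, clm_eq_sum (dsymm q _) (fderiv ℝ _ y _),
    ip_sum_sum, ← h2]
  simp only [← coeff_eq, Matrix.mul_apply, Finset.sum_mul, Matrix.transpose_apply]
  rw [Finset.sum_comm]
  refine Finset.sum_congr rfl fun a _ => Finset.sum_congr rfl fun b _ => ?_
  have h3 : ∀ c k, fderiv ℝ (trans p q) y (EuclideanSpace.single k 1) c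
      = Coord.jac (trans p q) y c k := fun c k => by
    have h4 := ((EuclideanSpace.proj c : (𝔼 n) →L[ℝ] ℝ).hasFDerivAt.comp y
      ((contDiffAt_trans hy).differentiableAt (by simp)).hasFDerivAt).fderiv
    exact (DFunLike.congr_fun h4 (EuclideanSpace.single k 1)).symm
  rw [h3, h3]
  ring

lemma SmoothCoeff.isPullback {g : RMetric n M} (hg : g.SmoothCoeff) (p q : M) :
    Coord.IsPullback (trans p q) (transDom p q) (extChartAt (𝓡 n) q).target
      (g.coeff q) (g.coeff p) where
  coord :=
    { isOpen := isOpen_transDom p q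
      smooth := fun w hw => contDiffAt_trans hw
      mapsTo := fun w hw => (extChartAt (𝓡 n) q).map_source hw.2
      -- A vanishing Jacobian determinant would give det g_{ij} = 0 in the chart at p, contradicting
      -- positivity.
      det_ne := fun w hw h => by
        have h1 := (g.coeff_posDef hw.1).det_pos
        rw [g.coeff_trans hw, Matrix.det_mul, h, mul_zero] at h1
        exact lt_irrefl _ h1 }
  metric := hg q
  eq := fun w hw => g.coeff_trans hw

omit [IsManifold (𝓡 n) ∞ M] in
lemma mem_transDom {p q : M} (h : p ∈ (extChartAt (𝓡 n) q).source) :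
    extChartAt (𝓡 n) p p ∈ transDom p q :=
  ⟨mem_extChartAt_target p, by simpa using h⟩

omit [IsManifold (𝓡 n) ∞ M] in
lemma trans_self (p q : M) : trans p q (extChartAt (𝓡 n) p p) = extChartAt (𝓡 n) q p := by
  simp [trans]

/-- The inner product of gradients `⟨∇f, ∇h⟩_g`. -/
def gradInner (g : RMetric n M) (f h : M → ℝ) (x : M) : ℝ :=
  Coord.gradInner (g.coeff x) (fun y => f ((extChartAt (𝓡 n) x).symm y))
    (fun y => h ((extChartAt (𝓡 n) x).symm y)) (extChartAt (𝓡 n) x x)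

lemma contDiffAt_comp_symm {f : M → ℝ} {q : M} {y : 𝔼 n} (hy : y ∈ (extChartAt (𝓡 n) q).target)
    (hf : ContMDiffAt (𝓡 n) 𝓘(ℝ) ∞ f ((extChartAt (𝓡 n) q).symm y)) :
    ContDiffAt ℝ ∞ (fun z => f ((extChartAt (𝓡 n) q).symm z)) y :=
  (hf.comp y (contMDiffAt_symm hy)).contDiffAt

lemma contMDiffAt_comp_chart {F : (𝔼 n) → ℝ} {q x : M} (hx : x ∈ (extChartAt (𝓡 n) q).source)
    (hF : ContDiffAt ℝ ∞ F (extChartAt (𝓡 n) q x)) :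
    ContMDiffAt (𝓡 n) 𝓘(ℝ) ∞ (fun z => F (extChartAt (𝓡 n) q z)) x :=
  hF.contMDiffAt.comp x (contMDiffAt_extChartAt' (by rwa [← extChartAt_source (𝓡 n)]))

omit [IsManifold (𝓡 n) ∞ M] in
-- The representatives of f in two charts differ near the point by the transition map; this is what
-- feeds the coordinate invariance of gradient and Laplacian.
lemma eventuallyEq_trans (f : M → ℝ) {x q : M} (hx : x ∈ (extChartAt (𝓡 n) q).source) :
    (fun y => f ((extChartAt (𝓡 n) x).symm y)) =ᶠ[𝓝 (extChartAt (𝓡 n) x x)]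
      fun y => (fun z => f ((extChartAt (𝓡 n) q).symm z)) (trans x q y) := by
  filter_upwards [(isOpen_transDom x q).mem_nhds (mem_transDom hx)] with y hy
  simp only [trans]
  rw [(extChartAt (𝓡 n) q).left_inv hy.2]

namespace SmoothCoeff

variable {g : RMetric n M} (hg : g.SmoothCoeff) {q x : M}
  (hx : x ∈ (extChartAt (𝓡 n) q).source)
include hg

include hx in
-- On M the value at x is computed in the chart at x, so moving x changes the chart. Fixing one
-- chart for all nearby points is what gives access to derivatives of |Rm|².
lemma rmSq_eq : g.rmSq x = Coord.rmSq (g.coeff q) (extChartAt (𝓡 n) q x) := by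
  rw [RMetric.rmSq, (hg.isPullback x q).rmSq_eq (mem_transDom hx), trans_self]

include hx in
lemma gradInner_eq {f h : M → ℝ} (hf : ContMDiffAt (𝓡 n) 𝓘(ℝ) ∞ f x)
    (hh : ContMDiffAt (𝓡 n) 𝓘(ℝ) ∞ h x) : g.gradInner f h x =
    Coord.gradInner (g.coeff q) (fun y => f ((extChartAt (𝓡 n) q).symm y))
      (fun y => h ((extChartAt (𝓡 n) q).symm y)) (extChartAt (𝓡 n) q x) := by
  have ht := (extChartAt (𝓡 n) q).map_source hx
  have hi := (extChartAt (𝓡 n) q).left_inv hx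
  rw [gradInner, Coord.gradInner_congr (eventuallyEq_trans f hx) (eventuallyEq_trans h hx),
    (hg.isPullback x q).gradInner_eq (f := fun z => f ((extChartAt (𝓡 n) q).symm z))
      (k := fun z => h ((extChartAt (𝓡 n) q).symm z)) (mem_transDom hx)
      (by rw [trans_self]; exact contDiffAt_comp_symm ht (by rwa [hi]))
      (by rw [trans_self]; exact contDiffAt_comp_symm ht (by rwa [hi])), trans_self]

include hx in
lemma laplacian_eq {f : M → ℝ} (hf : ContMDiff (𝓡 n) 𝓘(ℝ) ∞ f) : g.laplacian f x =
    Coord.laplacian (g.coeff q) (fun y => f ((extChartAt (𝓡 n) q).symm y))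
      (extChartAt (𝓡 n) q x) := by
  rw [laplacian, Coord.laplacian_congr (eventuallyEq_trans f hx),
    (hg.isPullback x q).laplacian_eq (f := fun z => f ((extChartAt (𝓡 n) q).symm z)) (mem_transDom hx)
      (fun v hv => contDiffAt_comp_symm hv hf.contMDiffAt), trans_self]

lemma contMDiff_gradInner {f h : M → ℝ} (hf : ContMDiff (𝓡 n) 𝓘(ℝ) ∞ f)
    (hh : ContMDiff (𝓡 n) 𝓘(ℝ) ∞ h) : ContMDiff (𝓡 n) 𝓘(ℝ) ∞ (g.gradInner f h) := by
  intro q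
  refine (contMDiffAt_comp_chart (mem_extChartAt_source q) ((hg q).contDiffAt_gradInner
    (mem_extChartAt_target q) (fun y hy => contDiffAt_comp_symm hy hf.contMDiffAt)
    (fun y hy => contDiffAt_comp_symm hy hh.contMDiffAt))).congr_of_eventuallyEq ?_
  filter_upwards [extChartAt_source_mem_nhds (I := 𝓡 n) q] with x hx using
    hg.gradInner_eq hx hf.contMDiffAt hh.contMDiffAt

lemma contMDiff_laplacian {f : M → ℝ} (hf : ContMDiff (𝓡 n) 𝓘(ℝ) ∞ f) :
    ContMDiff (𝓡 n) 𝓘(ℝ) ∞ (g.laplacian f) := by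
  intro q
  refine (contMDiffAt_comp_chart (mem_extChartAt_source q) ((hg q).contDiffAt_laplacian
    (mem_extChartAt_target q)
    (fun y hy => contDiffAt_comp_symm hy hf.contMDiffAt))).congr_of_eventuallyEq ?_
  filter_upwards [extChartAt_source_mem_nhds (I := 𝓡 n) q] with x hx using hg.laplacian_eq hx hf

end SmoothCoeff

end RMetric

namespace IsCompleteRicciFlow

variable {g : ℝ → RMetric n M} {T : ℝ}

lemma isCoordFlow (hg : IsCompleteRicciFlow g T) (hT : 0 < T) (p : M) :
    Coord.IsCoordFlow (fun t => (g t).coeff p) T (extChartAt (𝓡 n) p).target where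
  pos := hT
  isOpen := isOpen_extChartAt_target p
  smooth := hg.smooth p
  posDef := fun t _ _ hy => (g t).coeff_posDef hy
  flow := fun t ht y hy => hg.flow p y hy t ht

lemma smoothCoeff (hg : IsCompleteRicciFlow g T) (hT : 0 < T) {t : ℝ} (ht : t ∈ Icc 0 T) :
    (g t).SmoothCoeff := fun p => (hg.isCoordFlow hT p).metric ht

end IsCompleteRicciFlow

end ManifoldCoordinates

end

/-! ### The Riemannian volume measure in charts -/

noncomputable section

open scoped Matrix Topology

section RiemannianVolume

variable {n : ℕ} {M : Type*} [TopologicalSpace M] [ChartedSpace (EuclideanSpace ℝ (Fin n)) M]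
  [IsManifold (𝓡 n) ∞ M] [MeasurableSpace M] [BorelSpace M]

local notation "𝔼" n => EuclideanSpace ℝ (Fin n)

namespace RMetric

lemma det_eq_det_jac {ψ : (𝔼 n) → 𝔼 n} {y : 𝔼 n} (h : DifferentiableAt ℝ ψ y) :
    (fderiv ℝ ψ y).det = (Coord.jac ψ y).det := by
  rw [ContinuousLinearMap.det, ← LinearMap.det_toMatrix (EuclideanSpace.basisFun (Fin n) ℝ).toBasis]
  congr 1
  ext a i
  have h4 := ((EuclideanSpace.proj a : (𝔼 n) →L[ℝ] ℝ).hasFDerivAt.comp y h.hasFDerivAt).fderiv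
  have h5 := DFunLike.congr_fun h4 (EuclideanSpace.single i 1)
  simp only [LinearMap.toMatrix_apply, OrthonormalBasis.coe_toBasis, EuclideanSpace.basisFun_apply]
  exact h5.symm

omit [MeasurableSpace M] [BorelSpace M] in
-- Take determinants in the transformation law of g_{ij}: det g picks up the square of the Jacobian
-- determinant, and its square root the absolute value.
lemma density_trans (g : RMetric n M) {p q : M} {y : 𝔼 n} (hy : y ∈ transDom p q) :
    Coord.density (g.coeff p) y =
      |(fderiv ℝ (trans p q) y).det| * Coord.density (g.coeff q) (trans p q y) := by
  rw [Coord.density, Coord.density, g.coeff_trans hy, Matrix.det_mul, Matrix.det_mul,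
    Matrix.det_transpose, det_eq_det_jac ((contDiffAt_trans hy).differentiableAt (by simp)),
    mul_right_comm, Real.sqrt_mul (mul_self_nonneg _), Real.sqrt_mul_self_eq_abs]

omit [IsManifold (𝓡 n) ∞ M] in
lemma measurableSet_chart_preimage (p : M) {A : Set M} (hA : MeasurableSet A) :
    MeasurableSet ((extChartAt (𝓡 n) p).target ∩ (extChartAt (𝓡 n) p).symm ⁻¹' A) := by
  have h := (isOpen_extChartAt_target (I := 𝓡 n) p).measurableSet.subtype_image
    ((continuousOn_iff_continuous_domRestrict.1
      (continuousOn_extChartAt_symm (I := 𝓡 n) p)).measurable hA)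
  convert h using 1
  ext y
  simp [and_comm]

omit [MeasurableSpace M] [BorelSpace M] in
lemma SmoothCoeff.continuousOn_density {g : RMetric n M} (hg : g.SmoothCoeff) (p : M) :
    ContinuousOn (Coord.density (g.coeff p)) (extChartAt (𝓡 n) p).target :=
  fun _ hy => ((hg p).smooth_density hy).continuousAt.continuousWithinAt

lemma aemeasurable_symm (g : RMetric n M) (p : M) : AEMeasurable (extChartAt (𝓡 n) p).symm
    ((volume.restrict (extChartAt (𝓡 n) p).target).withDensity
      (fun y => ENNReal.ofReal (Real.sqrt (g.coeff p y).det))) :=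
  ((continuousOn_extChartAt_symm p).aemeasurable
    (isOpen_extChartAt_target p).measurableSet).mono_ac (withDensity_absolutelyContinuous _ _)

namespace SmoothCoeff

variable {g : RMetric n M} (hg : g.SmoothCoeff)
include hg

omit [MeasurableSpace M] [BorelSpace M] in
lemma aemeasurable_density (p : M) :
    AEMeasurable (fun y => ENNReal.ofReal (Real.sqrt (g.coeff p y).det))
      (volume.restrict (extChartAt (𝓡 n) p).target) :=
  ((hg.continuousOn_density p).aemeasurable
    (isOpen_extChartAt_target p).measurableSet).ennreal_ofReal

lemma chartVolume_apply (p : M) {A : Set M} (hA : MeasurableSet A) : g.chartVolume p A =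
    ∫⁻ y in (extChartAt (𝓡 n) p).target ∩ (extChartAt (𝓡 n) p).symm ⁻¹' A,
      ENNReal.ofReal (Coord.density (g.coeff p) y) := by
  rw [chartVolume, Measure.map_apply_of_aemeasurable (aemeasurable_symm g p) hA, withDensity_apply',
    Measure.restrict_restrict' (isOpen_extChartAt_target p).measurableSet, inter_comm]
  rfl

/-- The change of variables formula for the transition map, with `density_trans` absorbing the
Jacobian: the chart measures agree on overlaps. -/
lemma chartVolume_inter_source (p q : M) {A : Set M} (hA : MeasurableSet A) :
    g.chartVolume q (A ∩ (extChartAt (𝓡 n) p).source) =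
      g.chartVolume p (A ∩ (extChartAt (𝓡 n) q).source) := by
  have hsp := (isOpen_extChartAt_source (I := 𝓡 n) p).measurableSet
  have hsq := (isOpen_extChartAt_source (I := 𝓡 n) q).measurableSet
  rw [hg.chartVolume_apply q (hA.inter hsp), hg.chartVolume_apply p (hA.inter hsq)]
  set s := (extChartAt (𝓡 n) p).target ∩ (extChartAt (𝓡 n) p).symm ⁻¹'
    (A ∩ (extChartAt (𝓡 n) q).source) with hs
  have hsd : s ⊆ transDom p q := fun y hy => ⟨hy.1, hy.2.2⟩
  have himg : (extChartAt (𝓡 n) q).target ∩ (extChartAt (𝓡 n) q).symm ⁻¹'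
      (A ∩ (extChartAt (𝓡 n) p).source) = trans p q '' s := by
    ext z
    constructor
    · rintro ⟨hz, hzA, hzp⟩
      refine ⟨trans q p z, ⟨(extChartAt (𝓡 n) p).map_source hzp, ?_⟩, ?_⟩
      · simp only [mem_preimage, trans, (extChartAt (𝓡 n) p).left_inv hzp]
        exact ⟨hzA, (extChartAt (𝓡 n) q).map_target hz⟩
      · simp only [trans, (extChartAt (𝓡 n) p).left_inv hzp, (extChartAt (𝓡 n) q).right_inv hz]
    · rintro ⟨y, ⟨hy, hyA, hyq⟩, rfl⟩
      refine ⟨(extChartAt (𝓡 n) q).map_source hyq, ?_⟩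
      simp only [mem_preimage, trans, (extChartAt (𝓡 n) q).left_inv hyq]
      exact ⟨hyA, (extChartAt (𝓡 n) p).map_target hy⟩
  have hinj : InjOn (trans p q) s := fun y hy z hz h =>
    (extChartAt (𝓡 n) p).symm.injOn hy.1 hz.1 ((extChartAt (𝓡 n) q).injOn hy.2.2 hz.2.2 h)
  have hms : MeasurableSet s := measurableSet_chart_preimage p (hA.inter hsq)
  rw [himg, lintegral_image_eq_lintegral_abs_det_fderiv_mul volume hms (fun y hy =>
    ((contDiffAt_trans (hsd hy)).differentiableAt (by simp)).hasFDerivAt.hasFDerivWithinAt) hinj]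
  refine setLIntegral_congr_fun hms fun y hy => ?_
  rw [density_trans g (hsd hy), ENNReal.ofReal_mul (abs_nonneg _)]

lemma chartVolume_inter_self (p : M) {A : Set M} (hA : MeasurableSet A) :
    g.chartVolume p (A ∩ (extChartAt (𝓡 n) p).source) = g.chartVolume p A := by
  rw [hg.chartVolume_apply p hA,
    hg.chartVolume_apply p (hA.inter (isOpen_extChartAt_source p).measurableSet)]
  congr 2
  ext y
  simp only [mem_inter_iff, mem_preimage]
  exact ⟨fun h => ⟨h.1, h.2.1⟩, fun h => ⟨h.1, h.2, (extChartAt (𝓡 n) p).map_target h.1⟩⟩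

/-- Inside the domain of the chart at p every other chart measure is dominated by the one at p,
since they agree on overlaps; hence so is the supremum. The other inequality holds because the
measure at p is one member of the supremum. -/
lemma vol_restrict_source (p : M) :
    g.vol.restrict (extChartAt (𝓡 n) p).source = g.chartVolume p := by
  have hs := (isOpen_extChartAt_source (I := 𝓡 n) p).measurableSet
  refine le_antisymm ?_ ?_
  · have h1 : g.vol ≤ g.chartVolume p + g.vol.restrict (extChartAt (𝓡 n) p).sourceᶜ := by
      refine iSup_le fun q => Measure.le_iff.2 fun A hA => ?_
      rw [Measure.add_apply, Measure.restrict_apply hA, ← measure_inter_add_sdiff A hs,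
        hg.chartVolume_inter_source p q hA]
      exact add_le_add (measure_mono inter_subset_left) (le_iSup g.chartVolume q _)
    refine Measure.le_iff.2 fun A hA => ?_
    rw [Measure.restrict_apply hA]
    refine (h1 _).trans ?_
    rw [Measure.add_apply, Measure.restrict_apply (hA.inter hs), inter_assoc, inter_compl_self]
    simpa using measure_mono inter_subset_left
  · refine Measure.le_iff.2 fun A hA => ?_
    rw [Measure.restrict_apply hA, ← hg.chartVolume_inter_self p hA]
    exact le_iSup g.chartVolume p _

/-- The integral against the volume measure of a function supported in a chart. -/
lemma integral_vol_eq (p : M) {F : M → ℝ} (hF : Continuous F)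
    (hs : Function.support F ⊆ (extChartAt (𝓡 n) p).source) :
    ∫ x, F x ∂g.vol = ∫ y in (extChartAt (𝓡 n) p).target,
      F ((extChartAt (𝓡 n) p).symm y) * Coord.density (g.coeff p) y := by
  rw [← setIntegral_eq_integral_of_forall_compl_eq_zero (s := (extChartAt (𝓡 n) p).source)
    (fun x hx => by_contra fun h => hx (hs h)), hg.vol_restrict_source, chartVolume,
    integral_map (aemeasurable_symm g p) hF.aestronglyMeasurable, integral_withDensity_eq_integral_toReal_smul₀
      (hg.aemeasurable_density p) (by simp)]
  refine setIntegral_congr_fun (isOpen_extChartAt_target p).measurableSet fun y _ => ?_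
  simp only [smul_eq_mul]
  rw [ENNReal.toReal_ofReal (Real.sqrt_nonneg _), mul_comm]
  rfl

/-- The volume measure is finite near each point. -/
lemma isLocallyFiniteMeasure_vol : IsLocallyFiniteMeasure g.vol := by
  refine ⟨fun p => ?_⟩
  obtain ⟨r, hr, hrt⟩ := Metric.nhds_basis_closedBall.mem_iff.1 (extChartAt_target_mem_nhds (I := 𝓡 n) p)
  refine ⟨(extChartAt (𝓡 n) p).source ∩ extChartAt (𝓡 n) p ⁻¹' Metric.ball (extChartAt (𝓡 n) p p) r,
    Filter.inter_mem (extChartAt_source_mem_nhds p)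
      ((continuousAt_extChartAt p).preimage_mem_nhds (Metric.ball_mem_nhds _ hr)), ?_⟩
  have hU := (continuousOn_extChartAt p).isOpen_inter_preimage (isOpen_extChartAt_source (I := 𝓡 n) p)
    (Metric.isOpen_ball (x := extChartAt (𝓡 n) p p) (ε := r))
  have h1 : g.vol _ = g.vol.restrict (extChartAt (𝓡 n) p).source _ :=
    (Measure.restrict_eq_self _ (inter_subset_left
      (t := extChartAt (𝓡 n) p ⁻¹' Metric.ball (extChartAt (𝓡 n) p p) r))).symm
  rw [h1, hg.vol_restrict_source, hg.chartVolume_apply p hU.measurableSet]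
  refine lt_of_le_of_lt (lintegral_mono_set ?_)
    (((hg.continuousOn_density p).mono hrt).integrableOn_compact
      (isCompact_closedBall _ _)).lintegral_lt_top
  intro y hy
  have := hy.2.2
  rw [mem_preimage, (extChartAt (𝓡 n) p).right_inv hy.1] at this
  exact Metric.ball_subset_closedBall this

end SmoothCoeff

end RMetric

end RiemannianVolume

end

/-! ### Divergence theorem and differentiation under the integral sign -/

noncomputable section

open scoped Matrix Topology

namespace Coord

variable {n : ℕ}

local notation "𝔼" n => EuclideanSpace ℝ (Fin n)
local notation "𝕄" n => Matrix (Fin n) (Fin n) ℝ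

section Divergence

variable {V K : Set (𝔼 n)} {Φ : (𝔼 n) → ℝ} (hV : IsOpen V) (hK : IsCompact K) (hKV : K ⊆ V)
  (hΦ : ∀ y ∈ V, ContDiffAt ℝ ∞ Φ y) (h0 : ∀ y ∈ V \ K, Φ y = 0)
include hV hK hKV hΦ h0

/-- The integral of a partial derivative of a compactly supported function vanishes. -/
lemma integral_pd_eq_zero (i : Fin n) :
    IntegrableOn (pd i Φ) V ∧ ∫ y in V, pd i Φ y = 0 := by
  have hz : ∀ y ∉ K, V.indicator Φ y = 0 := fun y hy => by
    by_cases h : y ∈ V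
    · rw [indicator_of_mem h, h0 y ⟨h, hy⟩]
    · exact indicator_of_notMem h _
  have hev : ∀ y ∈ V, Φ =ᶠ[𝓝 y] V.indicator Φ := fun y hy => by
    filter_upwards [hV.mem_nhds hy] with z hz using (indicator_of_mem hz _).symm
  have hev0 : ∀ y ∉ K, V.indicator Φ =ᶠ[𝓝 y] fun _ => 0 := fun y hy => by
    filter_upwards [hK.isClosed.isOpen_compl.mem_nhds hy] with z hzK using hz z hzK
  -- The extension by zero is smooth because V and the complement of K are open and cover the space.
  have hsm : ContDiff ℝ ∞ (V.indicator Φ) := contDiff_iff_contDiffAt.2 fun y => by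
    by_cases h : y ∈ V
    · exact (hΦ y h).congr_of_eventuallyEq (hev y h).symm
    · exact contDiffAt_const.congr_of_eventuallyEq (hev0 y fun hy => h (hKV hy))
  have hcs : HasCompactSupport (V.indicator Φ) := HasCompactSupport.intro hK hz
  have hpd : ∀ y ∈ V, pd i Φ y = pd i (V.indicator Φ) y := fun y hy => pd_congr (hev y hy)
  have hint : Integrable fun y => fderiv ℝ (V.indicator Φ) y (EuclideanSpace.single i 1) := by
    refine Continuous.integrable_of_hasCompactSupport ?_ (hcs.fderiv_apply ℝ _)
    exact (hsm.continuous_fderiv (by simp)).clm_apply continuous_const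
  refine ⟨hint.integrableOn.congr_fun (fun y hy => (hpd y hy).symm) hV.measurableSet, ?_⟩
  rw [setIntegral_congr_fun hV.measurableSet hpd, setIntegral_eq_integral_of_forall_compl_eq_zero]
  -- Integration by parts against the constant function 1, whose derivative is zero.
  · have := integral_mul_fderiv_eq_neg_fderiv_mul_of_integrable (μ := (volume : Measure (𝔼 n)))
      (f := fun _ => (1 : ℝ)) (g := V.indicator Φ) (v := EuclideanSpace.single i 1) (by simp)
      (by simpa only [one_mul] using hint) (by simpa using hsm.continuous.integrable_of_hasCompactSupport hcs)
      (fun _ _ => by fun_prop) (fun y _ => (hsm.differentiable (by simp)) y)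
    simpa [pd] using this
  · intro y hy
    rw [pd_congr (hev0 y fun h => hy (hKV h)), pd_const]

end Divergence

/-- Differentiation under the integral sign. -/
lemma TS.hasDerivWithinAt_integral {T : ℝ} {V K : Set (𝔼 n)} {H : ℝ → (𝔼 n) → ℝ} (hT : 0 < T)
    (hV : IsOpen V) (hK : IsCompact K) (hKV : K ⊆ V) (hH : TS T V H)
    (h0 : ∀ s ∈ Icc 0 T, ∀ y ∈ V \ K, H s y = 0) {t : ℝ} (ht : t ∈ Icc 0 T) :
    HasDerivWithinAt (fun s => ∫ y in V, H s y) (∫ y in V, Coord.dt T H t y) (Icc 0 T) t := by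
  have hdt0 : ∀ y ∈ V \ K, Coord.dt T H t y = 0 := fun y hy => by
    rw [Coord.dt, derivWithin_congr (f := fun _ => 0) (fun s hs => h0 s hs y hy) (h0 t ht y hy)]
    simp
  have hc : ∀ s ∈ Icc 0 T, ContinuousOn (H s) K := fun s hs y hy =>
    (hH.contDiffAt hV hs (hKV hy)).continuousAt.continuousWithinAt
  have hint : ∀ s ∈ Icc 0 T, IntegrableOn (H s) K := fun s hs => (hc s hs).integrableOn_compact hK
  -- Compactness of [0,T] × K bounds ∂_t H uniformly. By the mean value inequality C then dominates
  -- all difference quotients, including the one-sided ones at the end times.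
  obtain ⟨C, hC⟩ := (isCompact_Icc.prod hK).exists_bound_of_continuousOn
    ((hH.dt hT hV).continuousOn.mono (prod_mono le_rfl hKV))
  rw [setIntegral_eq_of_subset_of_forall_sdiff_eq_zero hV.measurableSet hKV hdt0]
  have heq : ∀ s ∈ Icc 0 T, ∫ y in V, H s y = ∫ y in K, H s y := fun s hs =>
    setIntegral_eq_of_subset_of_forall_sdiff_eq_zero hV.measurableSet hKV (h0 s hs)
  refine HasDerivWithinAt.congr ?_ heq (heq t ht)
  rw [hasDerivWithinAt_iff_tendsto_slope]
  have hmem : ∀ᶠ s in 𝓝[Icc 0 T \ {t}] t, s ∈ Icc 0 T \ {t} := self_mem_nhdsWithin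
  have key : Tendsto (fun s => ∫ y in K, slope (fun r => H r y) t s) (𝓝[Icc 0 T \ {t}] t)
      (𝓝 (∫ y in K, Coord.dt T H t y)) := by
    refine tendsto_integral_filter_of_dominated_convergence (fun _ => C) ?_ ?_ ?_ ?_
    · filter_upwards [hmem] with s hs
      exact (((hint s hs.1).sub (hint t ht)).smul (s - t)⁻¹).aestronglyMeasurable
    · filter_upwards [hmem] with s hs
      refine (ae_restrict_iff' hK.measurableSet).2 (ae_of_all _ fun y hy => ?_)
      have h1 := Convex.norm_image_sub_le_of_norm_hasDerivWithin_le
        (fun r hr => hH.hasDerivWithinAt hr (hKV hy)) (fun r hr => hC (r, y) ⟨hr, hy⟩)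
        (convex_Icc 0 T) ht hs.1
      have h2 : 0 < ‖s - t‖ := norm_pos_iff.2 (sub_ne_zero.2 hs.2)
      rw [slope_def_module, norm_smul, norm_inv, inv_mul_le_iff₀ h2, mul_comm]
      exact h1
    · exact integrableOn_const hK.measure_ne_top
    · refine (ae_restrict_iff' hK.measurableSet).2 (ae_of_all _ fun y hy => ?_)
      exact hasDerivWithinAt_iff_tendsto_slope.1 (hH.hasDerivWithinAt ht (hKV hy))
  refine key.congr' ?_
  filter_upwards [hmem] with s hs
  simp only [slope_def_module]
  rw [integral_smul, integral_sub (hint s hs.1) (hint t ht)]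

lemma IsCoordFlow.ts_density {G : ℝ → (𝔼 n) → 𝕄 n} {T : ℝ} {V : Set (𝔼 n)}
    (hG : IsCoordFlow G T V) : TS T V fun s => density (G s) := fun z hz =>
  (hG.smooth.det z hz).sqrt (hG.posDef z.1 hz.1 z.2 hz.2).det_pos.ne'

end Coord

/-! ### Partition of unity and integration by parts on the manifold -/

section GlobalIntegrals

variable {n : ℕ} {M : Type*} [TopologicalSpace M] [ChartedSpace (EuclideanSpace ℝ (Fin n)) M]
  [IsManifold (𝓡 n) ∞ M]

local notation "𝔼" n => EuclideanSpace ℝ (Fin n)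

/-- A finite smooth partition of unity near a compact set, subordinate to charts. -/
lemma exists_finite_partition [T2Space M] [SecondCountableTopology M] {K : Set M}
    (hK : IsCompact K) : ∃ (A : Finset M) (χ : A → M → ℝ),
      (∀ a, ContMDiff (𝓡 n) 𝓘(ℝ) ∞ (χ a)) ∧
      (∀ a, tsupport (χ a) ⊆ (extChartAt (𝓡 n) (a : M)).source) ∧ ∀ x ∈ K, ∑ a, χ a x = 1 := by
  have : LocallyCompactSpace M := Manifold.locallyCompact_of_finiteDimensional (𝓡 n)
  obtain ⟨A, -, hA⟩ := hK.elim_nhds_subcover (fun x => (extChartAt (𝓡 n) x).source)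
    fun x _ => extChartAt_source_mem_nhds x
  obtain ⟨χ, hχ⟩ := SmoothPartitionOfUnity.exists_isSubordinate (𝓡 n) hK.isClosed
    (fun a : A => (extChartAt (𝓡 n) (a : M)).source) (fun a => isOpen_extChartAt_source _)
    (fun x hx => by simpa using hA hx)
  refine ⟨A, fun a => χ a, fun a => (χ a).contMDiff, hχ, fun x hx => ?_⟩
  rw [← finsum_eq_sum_of_fintype]
  exact χ.sum_eq_one hx

namespace RMetric

variable [MeasurableSpace M] [BorelSpace M]

omit [MeasurableSpace M] [BorelSpace M] in
lemma gradInner_sum (g : RMetric n M) {κ : Type*} (s : Finset κ) {F : κ → M → ℝ} (h : M → ℝ)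
    (hF : ∀ k ∈ s, ContMDiff (𝓡 n) 𝓘(ℝ) ∞ (F k)) (x : M) :
    g.gradInner (fun z => ∑ k ∈ s, F k z) h x = ∑ k ∈ s, g.gradInner (F k) h x := by
  simp only [gradInner, Coord.gradInner]
  have : ∀ i : Fin n, Coord.pd i (fun y => ∑ k ∈ s, F k ((extChartAt (𝓡 n) x).symm y))
      (extChartAt (𝓡 n) x x) = ∑ k ∈ s, Coord.pd i (fun y => F k ((extChartAt (𝓡 n) x).symm y))
      (extChartAt (𝓡 n) x x) := fun i => Coord.pd_sum s fun k hk =>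
    (contDiffAt_comp_symm (mem_extChartAt_target x) (hF k hk).contMDiffAt).differentiableAt (by simp)
  simp only [this, Finset.mul_sum, Finset.sum_mul]
  rw [Finset.sum_comm (s := s)]
  exact Finset.sum_congr rfl fun i _ => Finset.sum_comm

omit [MeasurableSpace M] [BorelSpace M] in
lemma gradInner_eq_zero (g : RMetric n M) {f : M → ℝ} (h : M → ℝ) {x : M} (hx : x ∉ tsupport f) :
    g.gradInner f h x = 0 := by
  have h1 : (fun y => f ((extChartAt (𝓡 n) x).symm y)) =ᶠ[𝓝 (extChartAt (𝓡 n) x x)]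
      fun _ => 0 := by
    have h2 := (continuousAt_extChartAt_symm (I := 𝓡 n) x).preimage_mem_nhds
      ((isClosed_tsupport f).isOpen_compl.mem_nhds (by simpa using hx))
    filter_upwards [h2] with y hy using image_eq_zero_of_notMem_tsupport hy
  rw [gradInner, Coord.gradInner_congr h1 (EventuallyEq.refl _ _)]
  simp [Coord.gradInner, Coord.pd_const]

omit [MeasurableSpace M] [BorelSpace M] in
lemma support_div_subset (g : RMetric n M) (f h : M → ℝ) :
    Function.support (fun x => g.gradInner f h x + f x * g.laplacian h x) ⊆ tsupport f :=
  fun x hx => by_contra fun hn => hx (by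
    simp [g.gradInner_eq_zero h hn, image_eq_zero_of_notMem_tsupport hn])

namespace SmoothCoeff

variable {g : RMetric n M} (hg : g.SmoothCoeff)
include hg

omit [MeasurableSpace M] [BorelSpace M] in
lemma continuous_div {f h : M → ℝ} (hf : ContMDiff (𝓡 n) 𝓘(ℝ) ∞ f)
    (hh : ContMDiff (𝓡 n) 𝓘(ℝ) ∞ h) :
    Continuous fun x => g.gradInner f h x + f x * g.laplacian h x :=
  (hg.contMDiff_gradInner hf hh).continuous.add
    (hf.continuous.mul (hg.contMDiff_laplacian hh).continuous)

/-- In the chart the integrand times the density is the sum over i of ∂_i(f √det g · g^{ij} ∂_j h)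
by `div_eq`, and each of these functions has compact support in the target. -/
lemma integral_div_chart_eq_zero {p : M} {f h : M → ℝ} (hf : ContMDiff (𝓡 n) 𝓘(ℝ) ∞ f)
    (hh : ContMDiff (𝓡 n) 𝓘(ℝ) ∞ h) (hfc : HasCompactSupport f)
    (hfp : tsupport f ⊆ (extChartAt (𝓡 n) p).source) :
    ∫ x, (g.gradInner f h x + f x * g.laplacian h x) ∂g.vol = 0 := by
  have hsupp : Function.support (fun x => g.gradInner f h x + f x * g.laplacian h x) ⊆
      (extChartAt (𝓡 n) p).source := (g.support_div_subset f h).trans hfp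
  rw [hg.integral_vol_eq p (hg.continuous_div hf hh) hsupp]
  set V := (extChartAt (𝓡 n) p).target with hVdef
  have hV : IsOpen V := isOpen_extChartAt_target p
  set F : (𝔼 n) → ℝ := fun y => f ((extChartAt (𝓡 n) p).symm y) with hF
  set H : (𝔼 n) → ℝ := fun y => h ((extChartAt (𝓡 n) p).symm y) with hH
  set G := g.coeff p
  have hFs : ∀ y ∈ V, ContDiffAt ℝ ∞ F y := fun y hy => contDiffAt_comp_symm hy hf.contMDiffAt
  have hHs : ∀ y ∈ V, ContDiffAt ℝ ∞ H y := fun y hy => contDiffAt_comp_symm hy hh.contMDiffAt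
  have hKc : IsCompact (extChartAt (𝓡 n) p '' tsupport f) :=
    IsCompact.image_of_continuousOn hfc ((continuousOn_extChartAt p).mono hfp)
  have hKV : extChartAt (𝓡 n) p '' tsupport f ⊆ V := by
    rintro _ ⟨x, hx, rfl⟩
    exact (extChartAt (𝓡 n) p).map_source (hfp hx)
  have key := fun i => Coord.integral_pd_eq_zero hV hKc hKV
    (Φ := fun z => F z * (Coord.density G z * ∑ j, (G z)⁻¹ i j * Coord.pd j H z))
    (fun y hy => (hFs y hy).mul (((hg p).smooth_density hy).mul
      (ContDiffAt.sum fun j _ => ((hg p).smooth_inv hy i j).mul (Coord.contDiffAt_pd (hHs y hy)))))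
    (fun y hy => by
      have : F y = 0 := image_eq_zero_of_notMem_tsupport (f := f) fun h =>
        hy.2 ⟨_, h, (extChartAt (𝓡 n) p).right_inv hy.1⟩
      rw [this, zero_mul]) i
  rw [← Finset.sum_eq_zero (s := Finset.univ) fun i _ => (key i).2,
    ← integral_finsetSum _ fun i _ => (key i).1]
  refine setIntegral_congr_fun hV.measurableSet fun y hy => ?_
  have hs := (extChartAt (𝓡 n) p).map_target hy
  rw [(hg p).div_eq hy (hFs y hy) (hHs y hy), hg.gradInner_eq hs hf.contMDiffAt hh.contMDiffAt,
    hg.laplacian_eq hs hh, (extChartAt (𝓡 n) p).right_inv hy]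
  ring

/-- Integration by parts. -/
theorem integral_mul_laplacian [T2Space M] [SecondCountableTopology M] {f h : M → ℝ}
    (hf : ContMDiff (𝓡 n) 𝓘(ℝ) ∞ f) (hh : ContMDiff (𝓡 n) 𝓘(ℝ) ∞ h) (hfc : HasCompactSupport f) :
    Integrable (fun x => g.gradInner f h x + f x * g.laplacian h x) g.vol ∧
      ∫ x, (g.gradInner f h x + f x * g.laplacian h x) ∂g.vol = 0 := by
  have := hg.isLocallyFiniteMeasure_vol
  have hint : ∀ {k : M → ℝ}, ContMDiff (𝓡 n) 𝓘(ℝ) ∞ k → HasCompactSupport k →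
      Integrable (fun x => g.gradInner k h x + k x * g.laplacian h x) g.vol := fun hk hkc =>
    (hg.continuous_div hk hh).integrable_of_hasCompactSupport (hkc.of_isClosed_subset
      (isClosed_tsupport _) (closure_minimal (g.support_div_subset _ h) (isClosed_tsupport _)))
  refine ⟨hint hf hfc, ?_⟩
  obtain ⟨A, χ, hχ, hχs, hχ1⟩ := exists_finite_partition (n := n) hfc
  -- Only f is cut up: the integrand is linear in f, so h may keep arbitrary support.
  have hfs : f = fun x => ∑ a, χ a x * f x := by
    funext x
    rw [← Finset.sum_mul]
    by_cases hx : x ∈ tsupport f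
    · rw [hχ1 x hx, one_mul]
    · rw [image_eq_zero_of_notMem_tsupport hx, mul_zero]
  have hsm : ∀ a, ContMDiff (𝓡 n) 𝓘(ℝ) ∞ fun x => χ a x * f x := fun a => (hχ a).mul hf
  have hcs : ∀ a, HasCompactSupport fun x => χ a x * f x := fun a => hfc.mul_left
  have h1 : ∀ x, g.gradInner f h x + f x * g.laplacian h x = ∑ a, (g.gradInner
      (fun x => χ a x * f x) h x + χ a x * f x * g.laplacian h x) := fun x => by
    rw [Finset.sum_add_distrib, ← g.gradInner_sum _ _ (fun a _ => hsm a), ← hfs, ← Finset.sum_mul,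
      ← congrFun hfs x]
  simp only [h1]
  rw [integral_finsetSum]
  · exact Finset.sum_eq_zero fun a _ => hg.integral_div_chart_eq_zero (hsm a) hh (hcs a)
      ((closure_mono (Function.support_mul_subset_left _ _)).trans (hχs a))
  · exact fun a _ => hint (hsm a) (hcs a)

end SmoothCoeff

end RMetric

end GlobalIntegrals

end

/-! ### Time derivative of integrals along the flow -/

noncomputable section

open scoped Matrix Topology

section TimeDerivative

variable {n : ℕ} {M : Type*} [TopologicalSpace M] [ChartedSpace (EuclideanSpace ℝ (Fin n)) M]
  [IsManifold (𝓡 n) ∞ M]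

local notation "𝔼" n => EuclideanSpace ℝ (Fin n)

variable (n) in
/-- `F` is smooth in space and time on `M × [0,T]`, in each chart of `M`. -/
def SpaceTimeSmooth (T : ℝ) (F : ℝ → M → ℝ) : Prop :=
  ∀ p : M, Coord.TS T (extChartAt (𝓡 n) p).target fun s y => F s ((extChartAt (𝓡 n) p).symm y)

namespace SpaceTimeSmooth

variable {T : ℝ} {F H : ℝ → M → ℝ}

lemma contMDiff (hF : SpaceTimeSmooth n T F) {t : ℝ} (ht : t ∈ Icc 0 T) :
    ContMDiff (𝓡 n) 𝓘(ℝ) ∞ (F t) := by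
  intro p
  refine (RMetric.contMDiffAt_comp_chart (mem_extChartAt_source p) ((hF p).contDiffAt
    (isOpen_extChartAt_target p) ht (mem_extChartAt_target p))).congr_of_eventuallyEq ?_
  filter_upwards [extChartAt_source_mem_nhds (I := 𝓡 n) p] with x hx
  rw [(extChartAt (𝓡 n) p).left_inv hx]

omit [IsManifold (𝓡 n) ∞ M] in
lemma mul (hF : SpaceTimeSmooth n T F) (hH : SpaceTimeSmooth n T H) :
    SpaceTimeSmooth n T fun s x => F s x * H s x := fun p => (hF p).mul (hH p)

omit [IsManifold (𝓡 n) ∞ M] in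
lemma sub (hF : SpaceTimeSmooth n T F) (hH : SpaceTimeSmooth n T H) :
    SpaceTimeSmooth n T fun s x => F s x - H s x := fun p => (hF p).sub (hH p)

omit [IsManifold (𝓡 n) ∞ M] in
lemma derivWithin (hT : 0 < T) (hF : SpaceTimeSmooth n T F) :
    SpaceTimeSmooth n T fun s x => derivWithin (fun r => F r x) (Icc 0 T) s :=
  fun p => (hF p).dt hT (isOpen_extChartAt_target p)

omit [IsManifold (𝓡 n) ∞ M] in
lemma hasDerivWithinAt (hF : SpaceTimeSmooth n T F) {t : ℝ} (ht : t ∈ Icc 0 T) (x : M) :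
    HasDerivWithinAt (fun s => F s x) (_root_.derivWithin (fun r => F r x) (Icc 0 T) t)
      (Icc 0 T) t := by
  have := (hF x).hasDerivWithinAt ht (mem_extChartAt_target x)
  simpa only [Coord.dt, extChartAt_to_inv] using this

omit [IsManifold (𝓡 n) ∞ M] in
-- Adding β > 0 keeps the base positive, so real powers are smooth even at zeros of F. This is how β
-- makes the powers of |Rm|² + β smooth where the curvature vanishes.
lemma add_const_rpow (hF : SpaceTimeSmooth n T F) {β : ℝ} (hβ : 0 < β)
    (h0 : ∀ s ∈ Icc 0 T, ∀ x, 0 ≤ F s x) (r : ℝ) :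
    SpaceTimeSmooth n T fun s x => (F s x + β) ^ r := fun p z hz =>
  (((hF p).add (Coord.TS.const β)) z hz).rpow_const_of_ne
    (add_pos_of_nonneg_of_pos (h0 z.1 hz.1 _) hβ).ne'

/-- A smooth function on `M × [0,T]` is smooth in each chart. -/
lemma of_contMDiffOn {φ : M → ℝ → ℝ}
    (hφ : ContMDiffOn ((𝓡 n).prod 𝓘(ℝ, ℝ)) 𝓘(ℝ, ℝ) ∞ (fun z : M × ℝ => φ z.1 z.2)
      (univ ×ˢ Icc 0 T)) : SpaceTimeSmooth n T fun s x => φ x s := by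
  intro p
  have h1 : ContMDiffOn 𝓘(ℝ, ℝ × 𝔼 n) ((𝓡 n).prod 𝓘(ℝ, ℝ)) ∞
      (fun z : ℝ × (𝔼 n) => ((extChartAt (𝓡 n) p).symm z.2, z.1))
      (Icc 0 T ×ˢ (extChartAt (𝓡 n) p).target) :=
    ((contMDiffOn_extChartAt_symm p).comp contDiff_snd.contMDiff.contMDiffOn
      fun z hz => hz.2).prodMk contDiff_fst.contMDiff.contMDiffOn
  exact contMDiffOn_iff_contDiffOn.1 (hφ.comp h1 fun z hz => ⟨mem_univ _, hz.1⟩)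

end SpaceTimeSmooth

namespace RMetric

/-- The scalar curvature of `g`. -/
def scal (g : RMetric n M) (x : M) : ℝ := Coord.scal (g.coeff x) (extChartAt (𝓡 n) x x)

lemma SmoothCoeff.scal_eq {g : RMetric n M} (hg : g.SmoothCoeff) {q x : M}
    (hx : x ∈ (extChartAt (𝓡 n) q).source) :
    g.scal x = Coord.scal (g.coeff q) (extChartAt (𝓡 n) q x) := by
  rw [RMetric.scal, (hg.isPullback x q).scal_eq (mem_transDom hx), trans_self]

end RMetric

namespace IsCompleteRicciFlow

variable {g : ℝ → RMetric n M} {T : ℝ} (hg : IsCompleteRicciFlow g T) (hT : 0 < T)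
include hg hT

lemma spaceTimeSmooth_rmSq : SpaceTimeSmooth n T fun s => (g s).rmSq := fun p =>
  (hg.isCoordFlow hT p).ts_rmSq.congr fun s hs y hy => by
    beta_reduce
    rw [(hg.smoothCoeff hT hs).rmSq_eq ((extChartAt (𝓡 n) p).map_target hy),
      (extChartAt (𝓡 n) p).right_inv hy]

lemma spaceTimeSmooth_scal : SpaceTimeSmooth n T fun s => (g s).scal := fun p =>
  (hg.isCoordFlow hT p).ts_scal.congr fun s hs y hy => by
    beta_reduce
    rw [(hg.smoothCoeff hT hs).scal_eq ((extChartAt (𝓡 n) p).map_target hy),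
      (extChartAt (𝓡 n) p).right_inv hy]

/-- The time derivative of an integral under Ricci flow. -/
theorem hasDerivWithinAt_integral [T2Space M] [SecondCountableTopology M] [MeasurableSpace M]
    [BorelSpace M] {F : ℝ → M → ℝ} (hF : SpaceTimeSmooth n T F) {K : Set M} (hK : IsCompact K)
    (h0 : ∀ s ∈ Icc 0 T, ∀ x ∉ K, F s x = 0) {t : ℝ} (ht : t ∈ Icc 0 T) :
    Integrable (fun x => derivWithin (fun r => F r x) (Icc 0 T) t - (g t).scal x * F t x)
      (g t).vol ∧
    HasDerivWithinAt (fun s => ∫ x, F s x ∂(g s).vol)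
      (∫ x, (derivWithin (fun r => F r x) (Icc 0 T) t - (g t).scal x * F t x) ∂(g t).vol)
      (Icc 0 T) t := by
  obtain ⟨A, χ, hχ, hχs, hχ1⟩ := exists_finite_partition (n := n) hK
  set D : M → ℝ := fun x => derivWithin (fun r => F r x) (Icc 0 T) t - (g t).scal x * F t x with hD
  have hDc : Continuous D := (((hF.derivWithin hT).sub
    ((hg.spaceTimeSmooth_scal hT).mul hF)).contMDiff ht).continuous
  have hD0 : ∀ x ∉ K, D x = 0 := fun x hx => by
    have : derivWithin (fun r => F r x) (Icc 0 T) t = 0 := by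
      rw [derivWithin_congr (f := fun _ => 0) (fun s hs => h0 s hs x hx) (h0 t ht x hx)]
      simp
    simp only [hD, this, h0 t ht x hx, mul_zero, sub_zero]
  refine ⟨?_, ?_⟩
  · have := (hg.smoothCoeff hT ht).isLocallyFiniteMeasure_vol
    exact hDc.integrable_of_hasCompactSupport (HasCompactSupport.intro hK hD0)
  -- The partition of unity does not depend on time, so the moving measure is replaced by finitely
  -- many fixed Lebesgue integrals and all time dependence sits in k and in the density.
  have hloc : ∀ s ∈ Icc 0 T, ∀ k : M → ℝ, Continuous k → (∀ x ∉ K, k x = 0) →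
      ∫ x, k x ∂(g s).vol = ∑ a : A, ∫ y in (extChartAt (𝓡 n) (a : M)).target,
        χ a ((extChartAt (𝓡 n) (a : M)).symm y) * k ((extChartAt (𝓡 n) (a : M)).symm y) *
          Coord.density ((g s).coeff a) y := fun s hs k hk hk0 => by
    have hgs := hg.smoothCoeff hT hs
    have := hgs.isLocallyFiniteMeasure_vol
    have hks : k = fun x => ∑ a, χ a x * k x := by
      funext x
      rw [← Finset.sum_mul]
      by_cases hx : x ∈ K
      · rw [hχ1 x hx, one_mul]
      · rw [hk0 x hx, mul_zero]
    have hc : ∀ a, Continuous fun x => χ a x * k x := fun a => (hχ a).continuous.mul hk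
    conv_lhs => rw [hks]
    rw [integral_finsetSum]
    · exact Finset.sum_congr rfl fun a _ => hgs.integral_vol_eq (a : M) (hc a)
        ((Function.support_mul_subset_left _ _).trans (subset_closure.trans (hχs a)))
    · exact fun a _ => (hc a).integrable_of_hasCompactSupport
        (HasCompactSupport.intro hK fun x hx => by rw [hk0 x hx, mul_zero])
  refine HasDerivWithinAt.congr ?_ (fun s hs => hloc s hs (F s) (hF.contMDiff hs).continuous
    (h0 s hs)) (hloc t ht (F t) (hF.contMDiff ht).continuous (h0 t ht))
  rw [hloc t ht D hDc hD0]
  refine HasDerivWithinAt.fun_sum fun a _ => ?_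
  have hflow := hg.isCoordFlow hT (a : M)
  have hV := isOpen_extChartAt_target (I := 𝓡 n) (a : M)
  have hdens : Coord.TS T (extChartAt (𝓡 n) (a : M)).target
      fun s => Coord.density ((g s).coeff (a : M)) := hflow.ts_density
  have hH := ((Coord.TS.of_space (T := T) (V := (extChartAt (𝓡 n) (a : M)).target)
    (f := fun y => χ a ((extChartAt (𝓡 n) (a : M)).symm y)) fun y hy =>
      (RMetric.contDiffAt_comp_symm hy (hχ a).contMDiffAt).contDiffWithinAt).mul (hF a)).mul hdens
  -- Cutting K down to the support of the partition function gives one compact set in the chart, the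
  -- same for all times.
  have hKa : IsCompact (extChartAt (𝓡 n) (a : M) '' (K ∩ tsupport (χ a))) :=
    (hK.inter_right (isClosed_tsupport _)).image_of_continuousOn
      ((continuousOn_extChartAt _).mono (inter_subset_right.trans (hχs a)))
  have hKV : extChartAt (𝓡 n) (a : M) '' (K ∩ tsupport (χ a)) ⊆ (extChartAt (𝓡 n) (a : M)).target := by
    rintro _ ⟨x, hx, rfl⟩
    exact (extChartAt (𝓡 n) (a : M)).map_source (hχs a hx.2)
  refine (hH.hasDerivWithinAt_integral hT hV hKa hKV (fun s hs y hy => ?_) ht).congr_deriv ?_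
  · by_cases h1 : (extChartAt (𝓡 n) (a : M)).symm y ∈ K
    · have h2 : (extChartAt (𝓡 n) (a : M)).symm y ∉ tsupport (χ a) := fun h =>
        hy.2 ⟨_, ⟨h1, h⟩, (extChartAt (𝓡 n) (a : M)).right_inv hy.1⟩
      rw [image_eq_zero_of_notMem_tsupport h2]; ring
    · rw [h0 s hs _ h1]; ring
  · refine setIntegral_congr_fun hV.measurableSet fun y hy => ?_
    have h1 := ((hF.hasDerivWithinAt ht ((extChartAt (𝓡 n) (a : M)).symm y)).const_mul
      (χ a ((extChartAt (𝓡 n) (a : M)).symm y))).mul (hflow.dt_density ht hy)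
    have h2 := h1.derivWithin (uniqueDiffOn_Icc hT t ht)
    have h3 := (hg.smoothCoeff hT ht).scal_eq ((extChartAt (𝓡 n) (a : M)).map_target hy)
    rw [(extChartAt (𝓡 n) (a : M)).right_inv hy] at h3
    refine h2.trans ?_
    simp only [hD, h3]
    ring

end IsCompleteRicciFlow

end TimeDerivative

end

/-! ### Gradient calculus and the pointwise energy inequality -/

noncomputable section

open scoped Matrix Topology

namespace Coord

variable {n : ℕ}

local notation "𝔼" n => EuclideanSpace ℝ (Fin n)
local notation "𝕄" n => Matrix (Fin n) (Fin n) ℝ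

lemma gradInner_eq_of_pd {G : (𝔼 n) → 𝕄 n} {f f₁ f₂ : (𝔼 n) → ℝ} {y : 𝔼 n} {a b : ℝ}
    (h : (𝔼 n) → ℝ) (e : ∀ i, pd i f y = a * pd i f₁ y + b * pd i f₂ y) :
    gradInner G f h y = a * gradInner G f₁ h y + b * gradInner G f₂ h y := by
  simp only [gradInner, e, Finset.mul_sum, ← Finset.sum_add_distrib]
  exact Finset.sum_congr rfl fun i _ => Finset.sum_congr rfl fun j _ => by ring

lemma pd_rpow {f : (𝔼 n) → ℝ} {y : 𝔼 n} (hf : DifferentiableAt ℝ f y) (h : 0 < f y) (r : ℝ)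
    (i : Fin n) : pd i (fun z => f z ^ r) y = r * f y ^ (r - 1) * pd i f y := by
  rw [pd, (hf.hasFDerivAt.rpow_const (Or.inl h.ne')).fderiv]
  rfl

namespace IsMetricOn

variable {G : (𝔼 n) → 𝕄 n} {V : Set (𝔼 n)} {y : 𝔼 n}

lemma gradInner_symm (hG : IsMetricOn G V) (hy : y ∈ V) (f h : (𝔼 n) → ℝ) :
    gradInner G f h y = gradInner G h f y := by
  simp only [gradInner]
  rw [Finset.sum_comm]
  refine Finset.sum_congr rfl fun i _ => Finset.sum_congr rfl fun j _ => ?_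
  rw [hG.inv_symm hy]
  ring

/-- This is |a∇f + b∇h|² ≥ 0, expanded; it is the form in which Cauchy–Schwarz for gradients enters
the energy inequality. -/
lemma quadratic_nonneg (hG : IsMetricOn G V) (hy : y ∈ V) (f h : (𝔼 n) → ℝ) (a b : ℝ) :
    0 ≤ a ^ 2 * gradInner G f f y + 2 * a * b * gradInner G f h y + b ^ 2 * gradInner G h h y := by
  have h1 := (hG.posDef y hy).inv.posSemidef.dotProduct_mulVec_nonneg
    (fun i => a * pd i f y + b * pd i h y)
  have h2 : a ^ 2 * gradInner G f f y + 2 * a * b * gradInner G f h y + b ^ 2 * gradInner G h h y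
      = a ^ 2 * gradInner G f f y + a * b * gradInner G f h y + a * b * gradInner G h f y
        + b ^ 2 * gradInner G h h y := by
    rw [hG.gradInner_symm hy h f]; ring
  rw [h2]
  refine h1.trans_eq ?_
  simp only [gradInner, dotProduct, Matrix.mulVec, star_trivial, Finset.mul_sum,
    ← Finset.sum_add_distrib]
  exact Finset.sum_congr rfl fun i _ => Finset.sum_congr rfl fun j _ => by ring

end IsMetricOn

end Coord

section GradientCalculus

variable {n : ℕ} {M : Type*} [TopologicalSpace M] [ChartedSpace (EuclideanSpace ℝ (Fin n)) M]
  [IsManifold (𝓡 n) ∞ M]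

namespace RMetric

variable (g : RMetric n M) {f k : M → ℝ} (h : M → ℝ) (x : M)

lemma gradSq_eq_gradInner : g.gradSq f x = g.gradInner f f x := rfl

lemma gradInner_mul (hf : ContMDiff (𝓡 n) 𝓘(ℝ) ∞ f) (hk : ContMDiff (𝓡 n) 𝓘(ℝ) ∞ k) :
    g.gradInner (fun z => f z * k z) h x =
      k x * g.gradInner f h x + f x * g.gradInner k h x := by
  have hd : ∀ {f : M → ℝ}, ContMDiff (𝓡 n) 𝓘(ℝ) ∞ f → DifferentiableAt ℝ
      (fun y => f ((extChartAt (𝓡 n) x).symm y)) (extChartAt (𝓡 n) x x) := fun hf =>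
    (contDiffAt_comp_symm (mem_extChartAt_target x) hf.contMDiffAt).differentiableAt (by simp)
  refine Coord.gradInner_eq_of_pd _ fun i => ?_
  rw [Coord.pd_mul (hd hf) (hd hk), extChartAt_to_inv]
  ring

lemma gradInner_const_mul (c : ℝ) (hf : ContMDiff (𝓡 n) 𝓘(ℝ) ∞ f) :
    g.gradInner (fun z => c * f z) h x = c * g.gradInner f h x := by
  have h1 : g.gradInner (fun _ => c) h x = 0 := by
    simp [gradInner, Coord.gradInner, Coord.pd_const]
  rw [g.gradInner_mul h x contMDiff_const hf, h1]
  ring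

lemma gradInner_add_const_rpow (hf : ContMDiff (𝓡 n) 𝓘(ℝ) ∞ f) {β : ℝ} (hβ : 0 < f x + β)
    (r : ℝ) : g.gradInner (fun z => (f z + β) ^ r) h x =
      r * (f x + β) ^ (r - 1) * g.gradInner f h x := by
  have hd : DifferentiableAt ℝ (fun y => f ((extChartAt (𝓡 n) x).symm y)) (extChartAt (𝓡 n) x x) :=
    (contDiffAt_comp_symm (mem_extChartAt_target x) hf.contMDiffAt).differentiableAt (by simp)
  have h1 := Coord.gradInner_eq_of_pd (G := g.coeff x) (y := extChartAt (𝓡 n) x x)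
    (f := fun y => (f ((extChartAt (𝓡 n) x).symm y) + β) ^ r)
    (f₁ := fun y => f ((extChartAt (𝓡 n) x).symm y)) (f₂ := fun _ => 0)
    (a := r * (f x + β) ^ (r - 1)) (b := 0) (fun y => h ((extChartAt (𝓡 n) x).symm y)) fun i => by
      rw [Coord.pd_rpow (hd.add_const β) (by rwa [extChartAt_to_inv]), extChartAt_to_inv,
        Coord.pd_add hd (by fun_prop), Coord.pd_const]
      ring
  rw [zero_mul, add_zero] at h1
  exact h1

variable {g}

lemma SmoothCoeff.gradInner_symm (hg : g.SmoothCoeff) (f h : M → ℝ) :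
    g.gradInner f h x = g.gradInner h f x :=
  (hg x).gradInner_symm (mem_extChartAt_target x) _ _

lemma SmoothCoeff.quadratic_nonneg (hg : g.SmoothCoeff) (f h : M → ℝ) (a b : ℝ) :
    0 ≤ a ^ 2 * g.gradInner f f x + 2 * a * b * g.gradInner f h x + b ^ 2 * g.gradInner h h x :=
  (hg x).quadratic_nonneg (mem_extChartAt_target x) _ _ a b

end RMetric

end GradientCalculus

/-- Dictionary: m = n, u = |Rm|², w = u + β, v = w^{n/8}, q = w^{n/8−1}, P = |∇φ|², Q = ⟨∇φ, ∇u⟩, R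
= |∇u|², S = Scal; φt, ut are time derivatives and Lφ, Lu Laplacians. The powers w^{n/4}, w^{n/4−1},
w^{n/4−2} are then v², vq, q². Once the heat inequality and the evolution of u are used, the right
side minus the left is bounded below by (10n + 5/3) v²P + (11n/12) φvq Q + (11n²/192 − n/8) φ²q² R,
which is nonnegative. -/
lemma energy_density_le {m w v q φ φt Lφ ut Lu u N P Q R S : ℝ} (hm : 3 ≤ m) (hφ : 0 ≤ φ)
    (hq : 0 ≤ q) (hv : v = q * w) (hu : 0 ≤ u) (huw : u ≤ w) (hN : 0 ≤ N)
    (hR : R ≤ 2 * u * N) (hφt : φt ≤ Lφ) (hut : ut ≤ Lu - N + 16 * (u * √u))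
    (hS : S ^ 2 ≤ m ^ 2 * u) (hquad : ∀ a b, 0 ≤ a ^ 2 * P + 2 * a * b * Q + b ^ 2 * R) :
    2 * φ * φt * v ^ 2 + φ ^ 2 * (m / 4 * (v * q) * ut) - S * (φ ^ 2 * v ^ 2)
      - (2 * v ^ 2 * P + 2 * φ * (m / 4 * (v * q) * Q) + 2 * φ * v ^ 2 * Lφ)
      - (2 * φ * (m / 4 * (v * q)) * Q + φ ^ 2 * (m / 4) * ((m / 4 - 1) * q ^ 2) * R
        + φ ^ 2 * (m / 4 * (v * q)) * Lu) ≤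
    -(1 / 3) * (v ^ 2 * P + 2 * φ * v * (m / 8 * q) * Q + φ ^ 2 * (m / 8 * q) ^ 2 * R)
      + 10 * m * (P * v ^ 2) + 5 * m * (φ ^ 2 * (v ^ 2 * √w)) := by
  have hw : 0 ≤ w := hu.trans huw
  have hv0 : 0 ≤ v := hv ▸ mul_nonneg hq hw
  have hsq : √u ≤ √w := Real.sqrt_le_sqrt huw
  have hR0 : 0 ≤ R := by simpa using hquad 0 1
  have hP0 : 0 ≤ P := by simpa using hquad 1 0
  have e1 : 2 * φ * v ^ 2 * φt ≤ 2 * φ * v ^ 2 * Lφ :=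
    mul_le_mul_of_nonneg_left hφt (by positivity)
  have e2 : φ ^ 2 * (m / 4 * (v * q)) * ut ≤ φ ^ 2 * (m / 4 * (v * q)) * (Lu - N + 16 * (u * √u)) :=
    mul_le_mul_of_nonneg_left hut (by positivity)
  have e3 : -S ≤ m * √w := by
    refine (neg_le_abs S).trans ((abs_le_of_sq_le_sq ?_ (by positivity)).trans
      (mul_le_mul_of_nonneg_left hsq (by linarith)))
    rwa [mul_pow, Real.sq_sqrt hu]
  have e4 : φ ^ 2 * v ^ 2 * (-S) ≤ φ ^ 2 * v ^ 2 * (m * √w) :=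
    mul_le_mul_of_nonneg_left e3 (by positivity)
  have e5 : φ ^ 2 * (m / 4 * (v * q)) * (16 * (u * √u)) ≤
      φ ^ 2 * (m / 4 * (v * q)) * (16 * (w * √w)) :=
    mul_le_mul_of_nonneg_left (by gcongr) (by positivity)
  -- The reaction term contributes 16·(n/4) = 4n; together with n from the scalar curvature this
  -- uses up the constant 5n exactly.
  have e6 : φ ^ 2 * (m / 4 * (v * q)) * (16 * (w * √w)) = 4 * m * (φ ^ 2 * (v ^ 2 * √w)) := by
    rw [hv]; ring
  have e7 : R / 2 ≤ w * N := by nlinarith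
  -- Kato's inequality: the good term −N pays for half of |∇u|², since vq = q²w. It improves the
  -- factor n/4 − 1 in the coefficient of R to n/4 − 1/2.
  have e8 : φ ^ 2 * (m / 4) * q ^ 2 * (R / 2) ≤ φ ^ 2 * (m / 4) * q ^ 2 * (w * N) :=
    mul_le_mul_of_nonneg_left e7 (by positivity)
  have e9 : φ ^ 2 * (m / 4) * q ^ 2 * (w * N) = φ ^ 2 * (m / 4 * (v * q)) * N := by rw [hv]; ring
  -- The square is chosen to reproduce the cross term: 2·(11/3)·(n/8) = 11n/12. It consumes 121/9 of
  -- the coefficient of v²P and n²/64 of that of φ²q²R.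
  have e10 := hquad (11 / 3 * v) (m / 8 * φ * q)
  have e11 : 0 ≤ (10 * m + 5 / 3 - 121 / 9) * (v ^ 2 * P) :=
    mul_nonneg (by linarith) (by positivity)
  -- The remaining coefficient of φ²q²R is 11n²/192 − n/8 − n²/64 = n(n − 3)/24; its sign is where n
  -- ≥ 3 is decisive.
  have e12 : 0 ≤ (m * (m - 3) / 24) * (φ ^ 2 * q ^ 2 * R) :=
    mul_nonneg (by have : 0 ≤ m * (m - 3) := mul_nonneg (by linarith) (by linarith)
                   linarith) (by positivity)
  nlinarith

end

/-! ### The local energy inequality -/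

noncomputable section

open scoped Matrix Topology

lemma integral_le_of_sub_le {X : Type*} [MeasurableSpace X] {μ : Measure X}
    {E D₁ D₂ A₁ A₂ A₃ : X → ℝ} {a₁ a₂ a₃ : ℝ} (hE : Integrable E μ) (hD₁ : Integrable D₁ μ)
    (hD₂ : Integrable D₂ μ) (h₁ : ∫ x, D₁ x ∂μ = 0) (h₂ : ∫ x, D₂ x ∂μ = 0)
    (hA₁ : Integrable A₁ μ) (hA₂ : Integrable A₂ μ) (hA₃ : Integrable A₃ μ)
    (h : ∀ x, E x - D₁ x - D₂ x ≤ a₁ * A₁ x + a₂ * A₂ x + a₃ * A₃ x) :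
    ∫ x, E x ∂μ ≤ a₁ * ∫ x, A₁ x ∂μ + a₂ * ∫ x, A₂ x ∂μ + a₃ * ∫ x, A₃ x ∂μ := by
  have h3 := integral_mono ((hE.sub hD₁).sub hD₂)
    (((hA₁.const_mul a₁).add (hA₂.const_mul a₂)).add (hA₃.const_mul a₃)) h
  rw [integral_sub' (hE.sub hD₁) hD₂, integral_sub' hE hD₁,
    integral_add' ((hA₁.const_mul a₁).add (hA₂.const_mul a₂)) (hA₃.const_mul a₃),
    integral_add' (hA₁.const_mul a₁) (hA₂.const_mul a₂), integral_const_mul, integral_const_mul,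
    integral_const_mul, h₁, h₂] at h3
  linarith

section LocalEnergy

variable {n : ℕ} {M : Type*} [TopologicalSpace M] [ChartedSpace (EuclideanSpace ℝ (Fin n)) M]
  [IsManifold (𝓡 n) ∞ M]

/-- The evolution inequality for `|Rm|²` under Ricci flow. -/
theorem IsCompleteRicciFlow.evolution {g : ℝ → RMetric n M} {T : ℝ}
    (hg : IsCompleteRicciFlow g T) (hT : 0 < T) {t : ℝ} (ht : t ∈ Icc 0 T) (x : M) :
    0 ≤ (g t).rmSq x ∧ (g t).scal x ^ 2 ≤ n ^ 2 * (g t).rmSq x ∧ ∃ N, 0 ≤ N ∧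
      (g t).gradInner (g t).rmSq (g t).rmSq x ≤ 2 * (g t).rmSq x * N ∧
      derivWithin (fun s => (g s).rmSq x) (Icc 0 T) t ≤ (g t).laplacian (g t).rmSq x - N
        + 16 * ((g t).rmSq x * √((g t).rmSq x)) := by
  -- Derivatives of |Rm|² at x involve its values at nearby points, which by definition are computed
  -- in other charts; independence of the chart moves them all to the chart at x.
  have hev : (fun y => (g t).rmSq ((extChartAt (𝓡 n) x).symm y)) =ᶠ[𝓝 (extChartAt (𝓡 n) x x)]
      Coord.rmSq ((g t).coeff x) := by
    filter_upwards [extChartAt_target_mem_nhds (I := 𝓡 n) x] with y hy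
    rw [(hg.smoothCoeff hT ht).rmSq_eq ((extChartAt (𝓡 n) x).map_target hy),
      (extChartAt (𝓡 n) x).right_inv hy]
  obtain ⟨h0, h1, N, hN, h2, h3⟩ := (hg.isCoordFlow hT x).evolution ht (mem_extChartAt_target x)
  refine ⟨h0, h1, N, hN, ?_, ?_⟩
  · rw [RMetric.gradInner, Coord.gradInner_congr hev hev]
    exact h2
  · rw [RMetric.laplacian, Coord.laplacian_congr hev]
    exact h3

lemma RMetric.SmoothCoeff.gradSq_mul_rpow {g : RMetric n M} (hg : g.SmoothCoeff) {f u : M → ℝ}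
    (hf : ContMDiff (𝓡 n) 𝓘(ℝ) ∞ f) (hu : ContMDiff (𝓡 n) 𝓘(ℝ) ∞ u) {β r : ℝ}
    (hw : ContMDiff (𝓡 n) 𝓘(ℝ) ∞ fun z => (u z + β) ^ r) {x : M} (hβ : 0 < u x + β) :
    g.gradSq (fun z => f z * (u z + β) ^ r) x =
      ((u x + β) ^ r) ^ 2 * g.gradInner f f x
        + 2 * f x * (u x + β) ^ r * (r * (u x + β) ^ (r - 1)) * g.gradInner f u x
        + f x ^ 2 * (r * (u x + β) ^ (r - 1)) ^ 2 * g.gradInner u u x := by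
  have key : ∀ h, g.gradInner (fun z => f z * (u z + β) ^ r) h x = (u x + β) ^ r *
      g.gradInner f h x + f x * (r * (u x + β) ^ (r - 1) * g.gradInner u h x) := fun h => by
    rw [g.gradInner_mul h x hf hw, g.gradInner_add_const_rpow h x hu hβ]
  rw [g.gradSq_eq_gradInner, key, hg.gradInner_symm x f, hg.gradInner_symm x u, key, key,
    hg.gradInner_symm x u f]
  ring

/-- The pointwise inequality behind the local energy estimate: the terms `⟨∇f, ∇h⟩ + f Δh` on the
left have vanishing integral. -/
lemma IsCompleteRicciFlow.energy_density_le {g : ℝ → RMetric n M} {T : ℝ}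
    (hg : IsCompleteRicciFlow g T) (hT : 0 < T) (hn : 3 ≤ n) {φ : M → ℝ → ℝ}
    (hφS : SpaceTimeSmooth n T fun s x => φ x s) {t : ℝ} (ht : t ∈ Icc 0 T) {x : M}
    (hφ0 : 0 ≤ φ x t) (hheat : heatOp g T φ x t ≤ 0) {β : ℝ} (hβ : 0 < β) :
    derivWithin (fun s => φ x s ^ 2 * ((g s).rmSq x + β) ^ ((n : ℝ) / 4)) (Icc 0 T) t
      - (g t).scal x * (φ x t ^ 2 * ((g t).rmSq x + β) ^ ((n : ℝ) / 4))
      - ((g t).gradInner (fun x => 2 * (φ x t * ((g t).rmSq x + β) ^ ((n : ℝ) / 4)))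
          (fun x => φ x t) x + 2 * (φ x t * ((g t).rmSq x + β) ^ ((n : ℝ) / 4)) *
          (g t).laplacian (fun x => φ x t) x)
      - ((g t).gradInner (fun x => φ x t * (φ x t * ((n : ℝ) / 4 *
          ((g t).rmSq x + β) ^ ((n : ℝ) / 4 - 1)))) (g t).rmSq x
        + φ x t * (φ x t * ((n : ℝ) / 4 * ((g t).rmSq x + β) ^ ((n : ℝ) / 4 - 1))) *
          (g t).laplacian (g t).rmSq x) ≤
    -(1 / 3) * (g t).gradSq (fun x => φ x t * ((g t).rmSq x + β) ^ ((n : ℝ) / 8)) x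
      + 10 * n * ((g t).gradSq (fun x => φ x t) x * ((g t).rmSq x + β) ^ ((n : ℝ) / 4))
      + 5 * n * (φ x t ^ 2 * ((g t).rmSq x + β) ^ ((n : ℝ) / 4 + 1 / 2)) := by
  have hgt := hg.smoothCoeff hT ht
  have huS : SpaceTimeSmooth n T fun s => (g s).rmSq := hg.spaceTimeSmooth_rmSq hT
  have hu0 : ∀ s ∈ Icc 0 T, ∀ x, 0 ≤ (g s).rmSq x := fun s hs x => (hg.evolution hT hs x).1
  have hφ : ContMDiff (𝓡 n) 𝓘(ℝ) ∞ fun x => φ x t := hφS.contMDiff ht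
  have hu : ContMDiff (𝓡 n) 𝓘(ℝ) ∞ (g t).rmSq := huS.contMDiff ht
  have hw : ∀ r : ℝ, ContMDiff (𝓡 n) 𝓘(ℝ) ∞ fun x => ((g t).rmSq x + β) ^ r := fun r =>
    (huS.add_const_rpow hβ hu0 r).contMDiff ht
  have hf₂' : ContMDiff (𝓡 n) 𝓘(ℝ) ∞
      fun x => (n : ℝ) / 4 * ((g t).rmSq x + β) ^ ((n : ℝ) / 4 - 1) := contMDiff_const.mul (hw _)
  have hφf : ContMDiff (𝓡 n) 𝓘(ℝ) ∞
      fun x => φ x t * ((n : ℝ) / 4 * ((g t).rmSq x + β) ^ ((n : ℝ) / 4 - 1)) := hφ.mul hf₂'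
  have hφw : ∀ r : ℝ, ContMDiff (𝓡 n) 𝓘(ℝ) ∞ fun x => φ x t * ((g t).rmSq x + β) ^ r :=
    fun r => hφ.mul (hw r)
  obtain ⟨h0, h1, N, hN, h2, h3⟩ := hg.evolution hT ht x
  have hW : 0 < (g t).rmSq x + β := by linarith
  have p1 : ((g t).rmSq x + β) ^ ((n : ℝ) / 8) =
      ((g t).rmSq x + β) ^ ((n : ℝ) / 8 - 1) * ((g t).rmSq x + β) := by
    rw [Real.rpow_sub_one hW.ne']; field_simp
  have p2 : ((g t).rmSq x + β) ^ ((n : ℝ) / 4) = (((g t).rmSq x + β) ^ ((n : ℝ) / 8)) ^ 2 := by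
    rw [← Real.rpow_mul_natCast hW.le]; congr 1; push_cast; ring
  have p3 : ((g t).rmSq x + β) ^ ((n : ℝ) / 4 - 1) =
      ((g t).rmSq x + β) ^ ((n : ℝ) / 8) * ((g t).rmSq x + β) ^ ((n : ℝ) / 8 - 1) := by
    rw [← Real.rpow_add hW]; congr 1; ring
  have p4 : ((g t).rmSq x + β) ^ ((n : ℝ) / 4 - 1 - 1) =
      (((g t).rmSq x + β) ^ ((n : ℝ) / 8 - 1)) ^ 2 := by
    rw [← Real.rpow_mul_natCast hW.le]; congr 1; push_cast; ring
  have p5 : ((g t).rmSq x + β) ^ ((n : ℝ) / 4 + 1 / 2) =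
      (((g t).rmSq x + β) ^ ((n : ℝ) / 8)) ^ 2 * √((g t).rmSq x + β) := by
    rw [Real.rpow_add hW, p2, Real.sqrt_eq_rpow]
  have q1 : derivWithin (fun s => φ x s ^ 2 * ((g s).rmSq x + β) ^ ((n : ℝ) / 4)) (Icc 0 T) t =
      2 * φ x t * derivWithin (fun s => φ x s) (Icc 0 T) t *
        ((g t).rmSq x + β) ^ ((n : ℝ) / 4) + φ x t ^ 2 * ((n : ℝ) / 4 *
        ((g t).rmSq x + β) ^ ((n : ℝ) / 4 - 1) *
          derivWithin (fun s => (g s).rmSq x) (Icc 0 T) t) := by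
    have d1 := (hφS.hasDerivWithinAt ht x).fun_pow 2
    have d2 := ((huS.hasDerivWithinAt ht x).add_const β).rpow_const (p := (n : ℝ) / 4)
      (Or.inl hW.ne')
    rw [(d1.fun_mul d2).derivWithin (uniqueDiffOn_Icc hT t ht)]
    push_cast
    ring
  have q2 : (g t).gradInner (fun x => 2 * (φ x t * ((g t).rmSq x + β) ^ ((n : ℝ) / 4)))
      (fun x => φ x t) x = 2 * ((g t).rmSq x + β) ^ ((n : ℝ) / 4) *
        (g t).gradInner (fun x => φ x t) (fun x => φ x t) x + 2 * φ x t * ((n : ℝ) / 4 *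
        ((g t).rmSq x + β) ^ ((n : ℝ) / 4 - 1) * (g t).gradInner (fun x => φ x t) (g t).rmSq x) := by
    rw [(g t).gradInner_const_mul _ x 2 (hφw _), (g t).gradInner_mul _ x hφ (hw _),
      (g t).gradInner_add_const_rpow _ x hu hW, hgt.gradInner_symm x (g t).rmSq]
    ring
  have q3 : (g t).gradInner (fun x => φ x t * (φ x t * ((n : ℝ) / 4 *
      ((g t).rmSq x + β) ^ ((n : ℝ) / 4 - 1)))) (g t).rmSq x =
      2 * φ x t * ((n : ℝ) / 4 * ((g t).rmSq x + β) ^ ((n : ℝ) / 4 - 1)) *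
        (g t).gradInner (fun x => φ x t) (g t).rmSq x + φ x t ^ 2 * ((n : ℝ) / 4) *
        (((n : ℝ) / 4 - 1) * ((g t).rmSq x + β) ^ ((n : ℝ) / 4 - 1 - 1)) *
        (g t).gradInner (g t).rmSq (g t).rmSq x := by
    rw [(g t).gradInner_mul _ x hφ hφf, (g t).gradInner_mul _ x hφ hf₂',
      (g t).gradInner_const_mul _ x _ (hw _), (g t).gradInner_add_const_rpow _ x hu hW]
    ring
  have q4 : derivWithin (fun s => φ x s) (Icc 0 T) t ≤ (g t).laplacian (fun x => φ x t) x :=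
    sub_nonpos.1 hheat
  have key := _root_.energy_density_le (m := n) (w := (g t).rmSq x + β) (by exact_mod_cast hn)
    hφ0 (Real.rpow_nonneg hW.le ((n : ℝ) / 8 - 1)) p1 h0 (by linarith) hN h2 q4 h3 h1
    (hgt.quadratic_nonneg x (fun x => φ x t) (g t).rmSq)
  rw [q1, q2, q3, hgt.gradSq_mul_rpow hφ hu (hw _) hW, (g t).gradSq_eq_gradInner, p5, p4, p3, p2]
  linarith

end LocalEnergy

theorem mainTheorem8 {n : ℕ} (hn : 3 ≤ n)
    {M : Type*} [TopologicalSpace M] [T2Space M] [SecondCountableTopology M]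
    [ChartedSpace (EuclideanSpace ℝ (Fin n)) M] [IsManifold (𝓡 n) ∞ M]
    [MeasurableSpace M] [BorelSpace M]
    {T : ℝ} (hT : 0 < T) (g : ℝ → RMetric n M) (hg : IsCompleteRicciFlow g T)
    (φ : M → ℝ → ℝ)
    (hφ_smooth : ContMDiffOn ((𝓡 n).prod 𝓘(ℝ, ℝ)) 𝓘(ℝ, ℝ) ∞ (fun z : M × ℝ => φ z.1 z.2)
      (univ ×ˢ Icc 0 T))
    (hφ_nonneg : ∀ x : M, ∀ t ∈ Icc 0 T, 0 ≤ φ x t)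
    (hφ_supp : IsCompact (closure {z : M × ℝ | z.2 ∈ Icc 0 T ∧ φ z.1 z.2 ≠ 0}))
    (hφ_heat : ∀ x : M, ∀ t ∈ Icc 0 T, heatOp g T φ x t ≤ 0)
    {β : ℝ} (hβ : 0 < β) (t : ℝ) (ht : t ∈ Icc 0 T) :
    -- the integrals exist
    Integrable (fun x => φ x t ^ 2 * ((g t).rmSq x + β) ^ ((n : ℝ) / 4)) (g t).vol ∧
    Integrable (fun x => (g t).gradSq
      (fun x' => φ x' t * ((g t).rmSq x' + β) ^ ((n : ℝ) / 8)) x) (g t).vol ∧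
    Integrable (fun x => (g t).gradSq (fun x' => φ x' t) x *
      ((g t).rmSq x + β) ^ ((n : ℝ) / 4)) (g t).vol ∧
    Integrable (fun x => φ x t ^ 2 *
      ((g t).rmSq x + β) ^ ((n : ℝ) / 4 + 1 / 2)) (g t).vol ∧
    -- the time derivative exists
    DifferentiableWithinAt ℝ
      (fun s => ∫ x, φ x s ^ 2 * ((g s).rmSq x + β) ^ ((n : ℝ) / 4) ∂(g s).vol) (Icc 0 T) t ∧
    -- the inequality
    derivWithin
      (fun s => ∫ x, φ x s ^ 2 * ((g s).rmSq x + β) ^ ((n : ℝ) / 4) ∂(g s).vol) (Icc 0 T) t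
      ≤ -(1 / 3) * ∫ x, (g t).gradSq
            (fun x' => φ x' t * ((g t).rmSq x' + β) ^ ((n : ℝ) / 8)) x ∂(g t).vol
        + 10 * n * ∫ x, (g t).gradSq (fun x' => φ x' t) x *
            ((g t).rmSq x + β) ^ ((n : ℝ) / 4) ∂(g t).vol
        + 5 * n * ∫ x, φ x t ^ 2 *
            ((g t).rmSq x + β) ^ ((n : ℝ) / 4 + 1 / 2) ∂(g t).vol := by
  have hgt := hg.smoothCoeff hT ht
  have := hgt.isLocallyFiniteMeasure_vol
  -- the support
  obtain ⟨K, hK, hφK⟩ : ∃ K : Set M, IsCompact K ∧ ∀ s ∈ Icc 0 T, ∀ x ∉ K, φ x s = 0 :=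
    ⟨_, hφ_supp.image continuous_fst, fun s hs x hx => by_contra fun h =>
      hx ⟨(x, s), subset_closure ⟨hs, h⟩, rfl⟩⟩
  have hφt0 := hφK t ht
  have hint : ∀ k : M → ℝ, Continuous k → (∀ x ∉ K, k x = 0) → Integrable k (g t).vol :=
    fun k hk hk0 => hk.integrable_of_hasCompactSupport (HasCompactSupport.intro hK hk0)
  have hts : ∀ k : M → ℝ, (∀ x ∉ K, k x = 0) → tsupport k ⊆ K := fun k hk =>
    closure_minimal (fun x hx => by_contra fun h => hx (hk x h)) hK.isClosed
  -- smoothness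
  have hφS : SpaceTimeSmooth n T fun s x => φ x s := .of_contMDiffOn hφ_smooth
  have huS : SpaceTimeSmooth n T fun s => (g s).rmSq := hg.spaceTimeSmooth_rmSq hT
  have hu0 : ∀ s ∈ Icc 0 T, ∀ x, 0 ≤ (g s).rmSq x := fun s hs x => (hg.evolution hT hs x).1
  have hFS : SpaceTimeSmooth n T fun s x => φ x s ^ 2 * ((g s).rmSq x + β) ^ ((n : ℝ) / 4) := by
    simpa only [sq] using (hφS.mul hφS).mul (huS.add_const_rpow hβ hu0 _)
  have hφ : ContMDiff (𝓡 n) 𝓘(ℝ) ∞ fun x => φ x t := hφS.contMDiff ht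
  have hu : ContMDiff (𝓡 n) 𝓘(ℝ) ∞ (g t).rmSq := huS.contMDiff ht
  have hw : ∀ r : ℝ, ContMDiff (𝓡 n) 𝓘(ℝ) ∞ fun x => ((g t).rmSq x + β) ^ r := fun r =>
    (huS.add_const_rpow hβ hu0 r).contMDiff ht
  have hφv : ContMDiff (𝓡 n) 𝓘(ℝ) ∞ fun x => φ x t * ((g t).rmSq x + β) ^ ((n : ℝ) / 8) :=
    hφ.mul (hw _)
  -- integrability
  have i1 : Integrable (fun x => φ x t ^ 2 * ((g t).rmSq x + β) ^ ((n : ℝ) / 4)) (g t).vol :=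
    hint _ (hFS.contMDiff ht).continuous fun x hx => by simp [hφt0 x hx]
  have i2 : Integrable (fun x => (g t).gradSq
      (fun x' => φ x' t * ((g t).rmSq x' + β) ^ ((n : ℝ) / 8)) x) (g t).vol := by
    simp only [RMetric.gradSq_eq_gradInner]
    exact hint _ (hgt.contMDiff_gradInner hφv hφv).continuous fun x hx =>
      (g t).gradInner_eq_zero _ fun h => hx (hts _ (fun z hz => by simp [hφt0 z hz]) h)
  have i3 : Integrable (fun x => (g t).gradSq (fun x' => φ x' t) x *
      ((g t).rmSq x + β) ^ ((n : ℝ) / 4)) (g t).vol := by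
    simp only [RMetric.gradSq_eq_gradInner]
    exact hint _ ((hgt.contMDiff_gradInner hφ hφ).continuous.mul (hw _).continuous) fun x hx => by
      rw [(g t).gradInner_eq_zero _ fun h => hx (hts _ hφt0 h), zero_mul]
  have i4 : Integrable (fun x => φ x t ^ 2 *
      ((g t).rmSq x + β) ^ ((n : ℝ) / 4 + 1 / 2)) (g t).vol :=
    hint _ ((hφ.continuous.pow 2).mul (hw _).continuous) fun x hx => by simp [hφt0 x hx]
  -- the time derivative
  obtain ⟨i5, hder⟩ := hg.hasDerivWithinAt_integral hT hFS hK
    (fun s hs x hx => by simp [hφK s hs x hx]) ht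
  refine ⟨i1, i2, i3, i4, hder.differentiableWithinAt, ?_⟩
  rw [hder.derivWithin (uniqueDiffOn_Icc hT t ht)]
  -- integration by parts
  have hf₁ : ContMDiff (𝓡 n) 𝓘(ℝ) ∞
      fun x => 2 * (φ x t * ((g t).rmSq x + β) ^ ((n : ℝ) / 4)) :=
    contMDiff_const.mul (hφ.mul (hw _))
  have hf₂' : ContMDiff (𝓡 n) 𝓘(ℝ) ∞
      fun x => (n : ℝ) / 4 * ((g t).rmSq x + β) ^ ((n : ℝ) / 4 - 1) := contMDiff_const.mul (hw _)
  have hf₂ : ContMDiff (𝓡 n) 𝓘(ℝ) ∞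
      fun x => φ x t * (φ x t * ((n : ℝ) / 4 * ((g t).rmSq x + β) ^ ((n : ℝ) / 4 - 1))) :=
    hφ.mul (hφ.mul hf₂')
  obtain ⟨j1, k1⟩ := hgt.integral_mul_laplacian hf₁ hφ
    (HasCompactSupport.intro hK fun x hx => by simp [hφt0 x hx])
  obtain ⟨j2, k2⟩ := hgt.integral_mul_laplacian hf₂ hu
    (HasCompactSupport.intro hK fun x hx => by simp [hφt0 x hx])
  -- The integrated terms are the divergences of 2φw^{n/4} ∇φ and of (n/4)φ²w^{n/4−1} ∇|Rm|².
  -- Subtracting these null integrals reduces the claim to the pointwise inequality.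
  exact integral_le_of_sub_le i5 j1 j2 k1 k2 i2 i3 i4 fun x =>
    hg.energy_density_le hT hn hφS ht (hφ_nonneg x t ht) (hφ_heat x t ht) hβ

end
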